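/- **Setting.** Let $K$ be a field and $A=\bigoplus_{i\in\mathbb Z}A_i$ a finite-dimensional $\mathbb Z$-graded $K$-algebra with a triangular decomposition $(A^-,T,A^+)$: that is, $A\neq 0$; $A^-,T,A^+$ are graded subalgebras such that multiplication $A^-\otimes_K T\otimes_K A^+\to A$ is bijective; $T\subseteq A_0$, $A^-$ is supported in degrees $\le 0$ and $A^+$ in degrees $\ge 0$, with $A^-_0=K=A^+_0$; $A^{\pm}T=TA^{\pm}$; and $T$ is split, i.e. $\operatorname{End}_T(S)=K$ for every simple $T$-module $S$. Assume that $T$ is semisimple. Let $\mathcal G(A)$ and $\mathcal G(T)$ be the abelian categories of finitely generated graded left modules with degree-preserving morphisms. Every simple object $\lambda$ of $\mathcal G(T)$ is concentrated in a single degree, denoted $\deg\lambda$. Put $B^\pm=A^\pm T$, and let $B^\pm$ act on $T$-modules through the projection $B^\pm\to T$ that kills the components of nonzero degree. For a simple object $\lambda$ of $\mathcal G(T)$ let $\Delta(\lambda)=A\otimes_{B^+}\lambda$, let $\nabla(\lambda)=\operatorname{Hom}_{B^-}(A,\lambda)$ (with $(ah)(x)=h(xa)$, graded by the degree of maps), and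 let $L(\lambda)$ be the head of $\Delta(\lambda)$; the $L(\lambda)$ are the simple objects of $\mathcal G(A)$. One says that $A$ has the *KL-property* if for all simple $\lambda,\mu$ in $\mathcal G(T)$ and all $m\ge 0$, $$\operatorname{Ext}^m_{\mathcal G(A)}(\Delta(\lambda),L(\mu))\ne 0\ \Rightarrow\ m\equiv\deg\lambda-\deg\mu \pmod 2,$$ $$\operatorname{Ext}^m_{\mathcal G(A)}(L(\mu),\nabla(\lambda))\ne 0\ \Rightarrow\ m\equiv\deg\lambda-\deg\mu \pmod 2.$$ The simple module $L(\lambda)$ is called *rigid* if $A^-_{i}$ for $i<0$ and $A^+_{i}$ for $i>0$ act on it by zero (equivalently, $L(\lambda)\simeq\lambda$ as a $T$-module). **Proposition.** Suppose that $A^-$ and $A^+$ are commutative graded complete intersections, minimally presented in dual degrees: there are $n\ge 0$ and integers $d_1,\dots,d_n<0$, $e_1,\dots,e_n$ such that, as graded algebras, $$A^-\cong K[x_1,\dots,x_n]/(f_1,\dots,f_n),\qquad A^+\cong K[y_1,\dots,y_n]/(g_1,\dots,g_n),$$ where $\deg x_i=d_i$ and $\deg y_i=-d_i$; the $f_j$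 and the $g_j$ are homogeneous of degrees $e_j$ and $-e_j$ respectively; $f_1,\dots,f_n$ and $g_1,\dots,g_n$ are regular sequences; and $f_j\in(x_1,\dots,x_n)^2$, $g_j\in(y_1,\dots,y_n)^2$ for all $j$. Suppose moreover that every simple module $L(\lambda)$ is rigid. Then $A$ has the KL-property if and only if every $\deg x_i$ is odd and every $\deg f_j$ is even. -/

import Mathlib

open CategoryTheory CategoryTheory.Limits
open scoped TensorProduct

universe v u

/-! ## Vector spaces graded by the integers -/

section Grading

variable {K : Type*} {V : Type*} [Field K] [AddCommGroup V] [Module K V]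

/-- The isomorphism of a graded vector space with the direct sum of its components. -/
noncomputable def grEquiv (gr : ℤ → Submodule K V) (h : DirectSum.IsInternal gr) :
    (DirectSum ℤ fun i => gr i) ≃ₗ[K] V :=
  LinearEquiv.ofBijective (DirectSum.coeLinearMap gr) ⟨h.1, h.2⟩

/-- The projection of a graded vector space onto its homogeneous component of degree `i`,
as an endomorphism. -/
noncomputable def grComp (gr : ℤ → Submodule K V) (h : DirectSum.IsInternal gr) (i : ℤ) :
    V →ₗ[K] V :=
  (gr i).subtype ∘ₗ DirectSum.component K ℤ (fun i => gr i) i ∘ₗ (grEquiv gr h).symm.toLinearMap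

theorem grComp_mem (gr : ℤ → Submodule K V) (h : DirectSum.IsInternal gr) (i : ℤ) (x : V) :
    grComp gr h i x ∈ gr i := by
  simp [grComp]

theorem grEquiv_symm_apply (gr : ℤ → Submodule K V) (h : DirectSum.IsInternal gr) {i : ℤ} {x : V}
    (hx : x ∈ gr i) :
    (grEquiv gr h).symm x = DirectSum.lof K ℤ (fun i => gr i) i ⟨x, hx⟩ := by
  rw [LinearEquiv.symm_apply_eq]
  exact (DirectSum.coeLinearMap_lof gr i ⟨x, hx⟩).symm

theorem grComp_of_mem (gr : ℤ → Submodule K V) (h : DirectSum.IsInternal gr) {i : ℤ} {x : V}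
    (hx : x ∈ gr i) : grComp gr h i x = x := by
  simp [grComp, grEquiv_symm_apply gr h hx, DirectSum.component.lof_self]

theorem grComp_of_ne (gr : ℤ → Submodule K V) (h : DirectSum.IsInternal gr) {i j : ℤ} {x : V}
    (hx : x ∈ gr i) (hij : i ≠ j) : grComp gr h j x = 0 := by
  simp [grComp, grEquiv_symm_apply gr h hx, DirectSum.component.of, hij]

theorem exists_sum_grComp (gr : ℤ → Submodule K V) (h : DirectSum.IsInternal gr)
    [Module.Finite K V] :
    ∃ s : Finset ℤ, (∀ i ∉ s, gr i = ⊥) ∧ ∀ x, ∑ i ∈ s, grComp gr h i x = x := by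
  have hfin := WellFoundedGT.finite_ne_bot_of_iSupIndep h.submodule_iSupIndep
  refine ⟨hfin.toFinset, fun i hi => by simpa using hi, fun x => ?_⟩
  have hx : x ∈ ⨆ i, gr i := by rw [h.submodule_iSup_eq_top]; trivial
  induction hx using Submodule.iSup_induction' with
  | mem i x hx =>
    by_cases hi : gr i = ⊥
    · rw [hi, Submodule.mem_bot] at hx; simp [hx]
    · rw [Finset.sum_eq_single i, grComp_of_mem gr h hx]
      · intro j _ hj; exact grComp_of_ne gr h hx hj.symm
      · intro h'; simp [hi] at h'
  | zero => simp
  | add x y _ _ hx hy => simp only [map_add, Finset.sum_add_distrib, hx, hy]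

/-- A criterion for a family of subspaces to be a grading. -/
theorem isInternal_of_separating (gr : ℤ → Submodule K V) {W : Type*} [AddCommGroup W] [Module K W]
    (hsup : ∀ x, x ∈ ⨆ i, gr i) (q : ℤ → V →ₗ[K] W)
    (hne : ∀ i j x, x ∈ gr i → i ≠ j → q j x = 0)
    (hinj : ∀ i x, x ∈ gr i → q i x = 0 → x = 0) : DirectSum.IsInternal gr := by
  rw [DirectSum.isInternal_submodule_iff_iSupIndep_and_iSup_eq_top]
  refine ⟨?_, eq_top_iff.2 fun x _ => hsup x⟩
  intro i
  rw [Submodule.disjoint_def]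
  intro x hx hx'
  refine hinj i x hx ?_
  have : ⨆ j, ⨆ (_ : j ≠ i), gr j ≤ LinearMap.ker (q i) :=
    iSup_le fun j => iSup_le fun hj y hy => hne j i y hy hj
  exact this hx'

end Grading

/-! ## The category of finite-dimensional graded modules -/

/-- A finite-dimensional graded left module over a `K`-algebra `R` whose homogeneous components
are `ℛ i`. (If `R` is finite-dimensional, these are the finitely generated graded modules.) -/
structure GrMod {K : Type v} {R : Type u} [Field K] [Ring R] [Algebra K R]
    (ℛ : ℤ → Submodule K R) : Type (max (u + 1) v) where
  carrier : Type u
  [addCommGroup : AddCommGroup carrier]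
  [moduleBase : Module K carrier]
  [module : Module R carrier]
  [isScalarTower : IsScalarTower K R carrier]
  [finite : Module.Finite K carrier]
  gr : ℤ → Submodule K carrier
  isInternal : DirectSum.IsInternal gr
  smul_mem : ∀ {i j : ℤ} {r : R} {x : carrier}, r ∈ ℛ i → x ∈ gr j → r • x ∈ gr (i + j)

namespace GrMod

variable {K : Type v} {R : Type u} [Field K] [Ring R] [Algebra K R] {ℛ : ℤ → Submodule K R}

instance : CoeSort (GrMod ℛ) (Type u) := ⟨GrMod.carrier⟩

attribute [instance] addCommGroup moduleBase module isScalarTower finite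

/-- The projection onto the component of degree `i`. -/
noncomputable def comp (M : GrMod ℛ) (i : ℤ) : M →ₗ[K] M := grComp M.gr M.isInternal i

/-- Morphisms of graded modules: linear maps preserving the degree. -/
@[ext]
structure Hom (M N : GrMod ℛ) : Type u where
  toLin : M →ₗ[R] N
  map_mem : ∀ i x, x ∈ M.gr i → toLin x ∈ N.gr i

instance : Category (GrMod ℛ) where
  Hom := Hom
  id M := ⟨LinearMap.id, fun _ _ h => h⟩
  comp f g := ⟨g.toLin ∘ₗ f.toLin, fun i x h => g.map_mem i _ (f.map_mem i x h)⟩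

@[ext]
theorem hom_ext {M N : GrMod ℛ} {f g : M ⟶ N} (h : ∀ x, f.toLin x = g.toLin x) : f = g :=
  Hom.ext (LinearMap.ext h)

@[simp] theorem id_toLin (M : GrMod ℛ) : Hom.toLin (𝟙 M) = LinearMap.id := rfl

@[simp] theorem comp_toLin {M N P : GrMod ℛ} (f : M ⟶ N) (g : N ⟶ P) :
    (f ≫ g).toLin = g.toLin ∘ₗ f.toLin := rfl

instance (M N : GrMod ℛ) : Zero (M ⟶ N) := ⟨⟨0, fun i _ _ => (N.gr i).zero_mem⟩⟩
instance (M N : GrMod ℛ) : Add (M ⟶ N) :=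
  ⟨fun f g => ⟨f.toLin + g.toLin, fun i x h => (N.gr i).add_mem (f.map_mem i x h) (g.map_mem i x h)⟩⟩
instance (M N : GrMod ℛ) : Neg (M ⟶ N) :=
  ⟨fun f => ⟨-f.toLin, fun i x h => (N.gr i).neg_mem (f.map_mem i x h)⟩⟩
instance (M N : GrMod ℛ) : Sub (M ⟶ N) :=
  ⟨fun f g => ⟨f.toLin - g.toLin, fun i x h => (N.gr i).sub_mem (f.map_mem i x h) (g.map_mem i x h)⟩⟩
instance (M N : GrMod ℛ) : SMul ℕ (M ⟶ N) :=
  ⟨fun n f => ⟨n • f.toLin, fun i x h => (N.gr i).nsmul_mem (f.map_mem i x h) n⟩⟩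
instance (M N : GrMod ℛ) : SMul ℤ (M ⟶ N) :=
  ⟨fun n f => ⟨n • f.toLin, fun i x h => zsmul_mem (f.map_mem i x h) n⟩⟩

@[simp] theorem zero_toLin (M N : GrMod ℛ) : (0 : M ⟶ N).toLin = 0 := rfl
@[simp] theorem add_toLin {M N : GrMod ℛ} (f g : M ⟶ N) : (f + g).toLin = f.toLin + g.toLin := rfl

instance (M N : GrMod ℛ) : AddCommGroup (M ⟶ N) :=
  Function.Injective.addCommGroup (fun f : M ⟶ N => f.toLin) (fun _ _ h => Hom.ext h)
    rfl (fun _ _ => rfl) (fun _ => rfl) (fun _ _ => rfl) (fun _ _ => rfl) (fun _ _ => rfl)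

instance : Preadditive (GrMod ℛ) where
  add_comp _ _ _ f f' g := by ext x; simp
  comp_add _ _ _ f g g' := by ext x; simp

/-- A submodule is graded if it contains the homogeneous components of its elements. -/
def IsGraded (M : GrMod ℛ) (N : Submodule R M) : Prop := ∀ i x, x ∈ N → M.comp i x ∈ N

theorem comp_mem (M : GrMod ℛ) (i : ℤ) (x : M) : M.comp i x ∈ M.gr i := grComp_mem _ _ _ _

theorem comp_of_mem (M : GrMod ℛ) {i : ℤ} {x : M} (h : x ∈ M.gr i) : M.comp i x = x :=
  grComp_of_mem _ _ h

theorem comp_of_ne (M : GrMod ℛ) {i j : ℤ} {x : M} (h : x ∈ M.gr i) (hij : i ≠ j) :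
    M.comp j x = 0 := grComp_of_ne _ _ h hij

theorem exists_sum_comp (M : GrMod ℛ) :
    ∃ s : Finset ℤ, (∀ i ∉ s, M.gr i = ⊥) ∧ ∀ x, ∑ i ∈ s, M.comp i x = x :=
  exists_sum_grComp M.gr M.isInternal

theorem mem_iSup_gr (M : GrMod ℛ) (x : M) : x ∈ ⨆ i, M.gr i := by
  rw [M.isInternal.submodule_iSup_eq_top]; trivial

/-- Two linear maps agree if they agree on homogeneous elements. -/
theorem linearMap_ext (M : GrMod ℛ) {W : Type*} [AddCommGroup W] [Module K W]
    {f g : M →ₗ[K] W} (h : ∀ i x, x ∈ M.gr i → f x = g x) : f = g := by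
  have : (⨆ i, M.gr i) ≤ LinearMap.eqLocus f g := iSup_le fun i x hx => h i x hx
  exact LinearMap.ext fun x => this (M.mem_iSup_gr x)

theorem comp_smul (M : GrMod ℛ) {i : ℤ} {r : R} (hr : r ∈ ℛ i) (k : ℤ) (x : M) :
    M.comp (i + k) (r • x) = r • M.comp k x := by
  have := M.linearMap_ext (f := M.comp (i + k) ∘ₗ Module.toModuleEnd K (S := R) M r)
    (g := Module.toModuleEnd K (S := R) M r ∘ₗ M.comp k) (by
      intro j y hy
      simp only [LinearMap.comp_apply, Module.toModuleEnd_apply, DistribSMul.toLinearMap_apply]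
      by_cases hj : j = k
      · subst hj
        rw [M.comp_of_mem hy, M.comp_of_mem (M.smul_mem hr hy)]
      · rw [M.comp_of_ne hy hj, M.comp_of_ne (M.smul_mem hr hy) (by omega), smul_zero])
  exact LinearMap.congr_fun this x

theorem Hom.comp_apply {M N : GrMod ℛ} (f : M ⟶ N) (i : ℤ) (x : M) :
    N.comp i (f.toLin x) = f.toLin (M.comp i x) := by
  have := M.linearMap_ext (f := N.comp i ∘ₗ f.toLin.restrictScalars K)
    (g := f.toLin.restrictScalars K ∘ₗ M.comp i) (by
      intro j y hy
      simp only [LinearMap.comp_apply, LinearMap.restrictScalars_apply]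
      by_cases hj : j = i
      · subst hj
        rw [M.comp_of_mem hy, N.comp_of_mem (f.map_mem _ _ hy)]
      · rw [M.comp_of_ne hy hj, N.comp_of_ne (f.map_mem _ _ hy) hj, map_zero])
  exact LinearMap.congr_fun this x

/-- A graded submodule as an object. -/
def sub (M : GrMod ℛ) (N : Submodule R M) (hN : M.IsGraded N) : GrMod ℛ where
  carrier := N
  finite := inferInstanceAs (Module.Finite K (N.restrictScalars K))
  gr i := (M.gr i).comap (N.subtype.restrictScalars K)
  isInternal := by
    refine isInternal_of_separating _ ?_ (fun i => M.comp i ∘ₗ N.subtype.restrictScalars K) ?_ ?_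
    · intro x
      obtain ⟨s, -, hs⟩ := M.exists_sum_comp
      have hx : x = ∑ i ∈ s, (⟨M.comp i x, hN i x x.2⟩ : N) := by
        apply Subtype.ext
        simpa using (hs x).symm
      rw [hx]
      exact Submodule.sum_mem _ fun i _ => Submodule.mem_iSup_of_mem i (M.comp_mem i _)
    · intro i j x hx hij
      exact M.comp_of_ne hx hij
    · intro i x hx h0
      have h1 : M.comp i x = x := M.comp_of_mem hx
      exact Subtype.ext (h1.symm.trans h0)
  smul_mem hr hx := M.smul_mem hr hx

/-- The quotient by a graded submodule as an object. -/
def quot (M : GrMod ℛ) (N : Submodule R M) (hN : M.IsGraded N) : GrMod ℛ where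
  carrier := M ⧸ N
  finite := Module.Finite.of_surjective (N.mkQ.restrictScalars K) N.mkQ_surjective
  gr i := (M.gr i).map (N.mkQ.restrictScalars K)
  isInternal := by
    refine isInternal_of_separating _ ?_
      (fun i => (N.restrictScalars K).mapQ (N.restrictScalars K) (M.comp i) (fun x hx => hN i x hx))
      ?_ ?_
    · intro x
      obtain ⟨y, rfl⟩ := N.mkQ_surjective x
      have : ⨆ i, M.gr i ≤ (⨆ i, (M.gr i).map (N.mkQ.restrictScalars K)).comap
          (N.mkQ.restrictScalars K) :=
        iSup_le fun i z hz => Submodule.mem_iSup_of_mem i ⟨z, hz, rfl⟩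
      exact this (M.mem_iSup_gr y)
    · rintro i j _ ⟨y, hy, rfl⟩ hij
      have : M.comp j y = 0 := M.comp_of_ne hy hij
      change Submodule.Quotient.mk (M.comp j y) = _
      rw [this]; rfl
    · rintro i _ ⟨y, hy, rfl⟩ h0
      have : M.comp i y = y := M.comp_of_mem hy
      change Submodule.Quotient.mk (M.comp i y) = _ at h0
      rw [this] at h0; exact h0
  smul_mem := by
    rintro i j r _ hr ⟨y, hy, rfl⟩
    exact ⟨r • y, M.smul_mem hr hy, rfl⟩

/-- The inclusion of a graded submodule. -/
def subι (M : GrMod ℛ) (N : Submodule R M) (hN : M.IsGraded N) : M.sub N hN ⟶ M :=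
  ⟨N.subtype, fun _ _ h => h⟩

/-- The projection to a graded quotient. -/
def quotπ (M : GrMod ℛ) (N : Submodule R M) (hN : M.IsGraded N) : M ⟶ M.quot N hN :=
  ⟨N.mkQ, fun _ x h => ⟨x, h, rfl⟩⟩

/-- The direct sum of two graded modules. -/
def prod (M N : GrMod ℛ) : GrMod ℛ where
  carrier := M × N
  gr i := (M.gr i).prod (N.gr i)
  isInternal := by
    refine isInternal_of_separating _ ?_ (fun i => (M.comp i).prodMap (N.comp i)) ?_ ?_
    · rintro ⟨x, y⟩
      have h1 : ⨆ i, M.gr i ≤ (⨆ i, (M.gr i).prod (N.gr i)).comap (LinearMap.inl K M N) :=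
        iSup_le fun i z hz => Submodule.mem_iSup_of_mem i ⟨hz, (N.gr i).zero_mem⟩
      have h2 : ⨆ i, N.gr i ≤ (⨆ i, (M.gr i).prod (N.gr i)).comap (LinearMap.inr K M N) :=
        iSup_le fun i z hz => Submodule.mem_iSup_of_mem i ⟨(M.gr i).zero_mem, hz⟩
      have h3 : (x, y) = LinearMap.inl K M N x + LinearMap.inr K M N y := by simp
      rw [h3]
      exact Submodule.add_mem _ (h1 (M.mem_iSup_gr x)) (h2 (N.mem_iSup_gr y))
    · rintro i j ⟨x, y⟩ ⟨hx, hy⟩ hij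
      exact Prod.ext (M.comp_of_ne hx hij) (N.comp_of_ne hy hij)
    · rintro i ⟨x, y⟩ ⟨hx, hy⟩ h0
      have h1 : M.comp i x = 0 := congrArg Prod.fst h0
      have h2 : N.comp i y = 0 := congrArg Prod.snd h0
      exact Prod.ext ((M.comp_of_mem hx).symm.trans h1) ((N.comp_of_mem hy).symm.trans h2)
  smul_mem hr hx := ⟨M.smul_mem hr hx.1, N.smul_mem hr hx.2⟩

/-- The zero module. -/
def zeroObj : GrMod ℛ where
  carrier := PUnit
  gr _ := ⊤
  isInternal := by
    refine isInternal_of_separating (W := PUnit.{1}) _ (fun x => ?_) (fun _ => 0) ?_ ?_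
    · exact Submodule.mem_iSup_of_mem 0 trivial
    · intros; rfl
    · intros; rfl
  smul_mem _ _ := trivial

theorem isZero_zeroObj : IsZero (zeroObj : GrMod ℛ) where
  unique_to M := ⟨⟨⟨0⟩, fun f => by
    ext x
    have : x = 0 := rfl
    rw [this, map_zero, map_zero]⟩⟩
  unique_from M := ⟨⟨⟨0⟩, fun f => by ext x; rfl⟩⟩

instance : HasZeroObject (GrMod ℛ) := ⟨⟨zeroObj, isZero_zeroObj⟩⟩

instance : HasBinaryProducts (GrMod ℛ) := by
  apply @hasBinaryProducts_of_hasLimit_pair _ _ ?_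
  intro M N
  exact ⟨⟨{
    cone := BinaryFan.mk (P := M.prod N) ⟨LinearMap.fst R M N, fun _ _ h => h.1⟩
      ⟨LinearMap.snd R M N, fun _ _ h => h.2⟩
    isLimit := BinaryFan.IsLimit.mk _
      (fun f g => ⟨LinearMap.prod f.toLin g.toLin,
        fun i x h => ⟨f.map_mem i x h, g.map_mem i x h⟩⟩)
      (fun f g => rfl) (fun f g => rfl)
      (fun f g m h1 h2 => by
        subst h1 h2
        rfl) }⟩⟩

instance : HasFiniteProducts (GrMod ℛ) :=
  have : HasTerminal (GrMod ℛ) := HasZeroObject.hasTerminal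
  hasFiniteProducts_of_has_binary_and_terminal

theorem isGraded_ker {M N : GrMod ℛ} (f : M ⟶ N) : M.IsGraded (LinearMap.ker f.toLin) := by
  intro i x hx
  rw [LinearMap.mem_ker] at hx ⊢
  rw [← Hom.comp_apply, hx, map_zero]

theorem isGraded_range {M N : GrMod ℛ} (f : M ⟶ N) : N.IsGraded (LinearMap.range f.toLin) := by
  rintro i _ ⟨x, rfl⟩
  exact ⟨M.comp i x, (Hom.comp_apply f i x).symm⟩

/-- Kernels are the usual ones. -/
def isLimitKer {M N : GrMod ℛ} (f : M ⟶ N) :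
    IsLimit (KernelFork.ofι (f := f) (M.subι _ (isGraded_ker f)) (by ext x; exact x.2)) :=
  KernelFork.IsLimit.ofι _ _
    (fun g hg => ⟨LinearMap.codRestrict _ g.toLin
      (fun x => congrArg (fun h : _ ⟶ N => h.toLin x) hg), fun i x h => g.map_mem i x h⟩)
    (fun g hg => rfl)
    (fun g hg m hm => by subst hm; rfl)

/-- Cokernels are the usual ones. -/
def isColimitCoker {M N : GrMod ℛ} (f : M ⟶ N) :
    IsColimit (CokernelCofork.ofπ (f := f) (N.quotπ _ (isGraded_range f)) (by
      ext x
      exact (Submodule.Quotient.mk_eq_zero _).2 ⟨x, rfl⟩)) :=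
  CokernelCofork.IsColimit.ofπ _ _
    (fun g hg => ⟨Submodule.liftQ _ g.toLin (by
        rintro _ ⟨x, rfl⟩
        exact congrArg (fun h : M ⟶ _ => h.toLin x) hg), by
        rintro i _ ⟨x, hx, rfl⟩
        exact g.map_mem i x hx⟩)
    (fun g hg => rfl)
    (fun g hg m hm => by
      subst hm
      ext x
      obtain ⟨y, rfl⟩ := Submodule.mkQ_surjective _ x
      rfl)

instance : HasKernels (GrMod ℛ) := ⟨fun f => ⟨⟨⟨_, isLimitKer f⟩⟩⟩⟩
instance : HasCokernels (GrMod ℛ) := ⟨fun f => ⟨⟨⟨_, isColimitCoker f⟩⟩⟩⟩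

theorem injective_of_mono {M N : GrMod ℛ} (f : M ⟶ N) [Mono f] : Function.Injective f.toLin := by
  rw [← LinearMap.ker_eq_bot, eq_bot_iff]
  intro x hx
  have h0 : M.subι _ (isGraded_ker f) = 0 := by
    rw [← cancel_mono f, zero_comp]
    ext y
    exact y.2
  exact congrArg (fun h : M.sub _ (isGraded_ker f) ⟶ M => h.toLin ⟨x, hx⟩) h0

theorem surjective_of_epi {M N : GrMod ℛ} (f : M ⟶ N) [Epi f] : Function.Surjective f.toLin := by
  have h0 : N.quotπ _ (isGraded_range f) = 0 := by
    rw [← cancel_epi f, comp_zero]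
    ext y
    exact (Submodule.Quotient.mk_eq_zero _).2 ⟨y, rfl⟩
  intro x
  have : Submodule.Quotient.mk x = 0 :=
    congrArg (fun h : N ⟶ N.quot _ (isGraded_range f) => h.toLin x) h0
  exact (Submodule.Quotient.mk_eq_zero _).1 this

theorem mem_gr_of_map_mem {M N : GrMod ℛ} (f : M ⟶ N) (hf : Function.Injective f.toLin) {i : ℤ}
    {x : M} (hx : f.toLin x ∈ N.gr i) : x ∈ M.gr i := by
  have : M.comp i x = x := hf (by rw [← Hom.comp_apply, N.comp_of_mem hx])
  rw [← this]
  exact M.comp_mem i x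

theorem exists_preimage_mem {M N : GrMod ℛ} (f : M ⟶ N) (hf : Function.Surjective f.toLin)
    {i : ℤ} {y : N} (hy : y ∈ N.gr i) : ∃ x ∈ M.gr i, f.toLin x = y := by
  obtain ⟨x, rfl⟩ := hf y
  exact ⟨M.comp i x, M.comp_mem i x, by rw [← Hom.comp_apply, N.comp_of_mem hy]⟩

/-- Monomorphisms are kernels of their cokernels. -/
@[reducible]
noncomputable def normalMono {M N : GrMod ℛ} (f : M ⟶ N) [Mono f] : NormalMono f where
  Z := N.quot _ (isGraded_range f)
  g := N.quotπ _ (isGraded_range f)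
  w := by
    ext x
    exact (Submodule.Quotient.mk_eq_zero _).2 ⟨x, rfl⟩
  isLimit := KernelFork.IsLimit.ofι' _ _ fun {W} g hg => by
    have hr : ∀ x, g.toLin x ∈ LinearMap.range f.toLin := fun x =>
      (Submodule.Quotient.mk_eq_zero _).1
        (congrArg (fun h : W ⟶ N.quot _ (isGraded_range f) => h.toLin x) hg)
    let e := LinearEquiv.ofInjective f.toLin (injective_of_mono f)
    have he : ∀ x, f.toLin (e.symm ⟨g.toLin x, hr x⟩) = g.toLin x := fun x =>
      congrArg Subtype.val (e.apply_symm_apply ⟨g.toLin x, hr x⟩)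
    refine ⟨⟨e.symm.toLinearMap ∘ₗ g.toLin.codRestrict _ hr, fun i x hx => ?_⟩, ?_⟩
    · refine mem_gr_of_map_mem f (injective_of_mono f) ?_
      exact (he x).symm ▸ g.map_mem i x hx
    · ext x
      exact he x

/-- Epimorphisms are cokernels of their kernels. -/
@[reducible]
noncomputable def normalEpi {M N : GrMod ℛ} (f : M ⟶ N) [Epi f] : NormalEpi f where
  W := M.sub _ (isGraded_ker f)
  g := M.subι _ (isGraded_ker f)
  w := by
    ext x
    exact x.2
  isColimit := CokernelCofork.IsColimit.ofπ' _ _ fun {W} g hg => by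
    have hr : LinearMap.ker f.toLin ≤ LinearMap.ker g.toLin := fun x hx =>
      congrArg (fun h : M.sub _ (isGraded_ker f) ⟶ W => h.toLin ⟨x, hx⟩) hg
    let e := f.toLin.quotKerEquivOfSurjective (surjective_of_epi f)
    have he : ∀ x, e.symm (f.toLin x) = Submodule.Quotient.mk x := fun x => by
      rw [LinearEquiv.symm_apply_eq]; rfl
    have he' : ∀ x, Submodule.liftQ _ g.toLin hr (e.symm (f.toLin x)) = g.toLin x := fun x => by
      rw [he]; rfl
    refine ⟨⟨Submodule.liftQ _ g.toLin hr ∘ₗ e.symm.toLinearMap, fun i y hy => ?_⟩, ?_⟩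
    · obtain ⟨x, hx, rfl⟩ := exists_preimage_mem f (surjective_of_epi f) hy
      exact (he' x).symm ▸ g.map_mem i x hx
    · ext x
      exact he' x

noncomputable instance : Abelian (GrMod ℛ) where
  normalMonoOfMono f := ⟨normalMono f⟩
  normalEpiOfEpi f := ⟨normalEpi f⟩

end GrMod

/-- The group `Ext^m(X, Y)` in an abelian category is nonzero. -/
def ExtNonzero {C : Type*} [Category* C] [Abelian C] (X Y : C) (m : ℕ) : Prop :=
  haveI := HasExt.standard C
  Nontrivial (Abelian.Ext X Y m)

namespace GrMod

section Head

variable {K : Type v} {R : Type u} [Field K] [Ring R] [Algebra K R] {ℛ : ℤ → Submodule K R}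

/-- The radical: the intersection of the maximal graded submodules. -/
def rad (M : GrMod ℛ) : Submodule R M := sInf {N | Maximal (fun N => M.IsGraded N ∧ N ≠ ⊤) N}

theorem isGraded_rad (M : GrMod ℛ) : M.IsGraded M.rad := by
  intro i x hx
  rw [rad, Submodule.mem_sInf] at hx ⊢
  exact fun N hN => hN.1.1 i x (hx N hN)

/-- The head of a graded module: its quotient by the radical. -/
def head (M : GrMod ℛ) : GrMod ℛ := M.quot M.rad M.isGraded_rad

/-- A graded module is concentrated in degree `d`. -/
def IsConcentratedIn (M : GrMod ℛ) (d : ℤ) : Prop := M.gr d = ⊤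

end Head

section GradedAlgebra

variable {K : Type v} {A : Type u} [Field K] [Ring A] [Algebra K A]
  {𝒜 : ℤ → Submodule K A} [GradedAlgebra 𝒜]

/-- A submodule generated by homogeneous elements is graded. -/
theorem isGraded_span (M : GrMod 𝒜) (s : Set M) (hs : ∀ x ∈ s, ∃ i, x ∈ M.gr i) :
    M.IsGraded (Submodule.span A s) := by
  intro i x hx
  induction hx using Submodule.span_induction generalizing i with
  | mem x hx =>
    obtain ⟨j, hj⟩ := hs x hx
    by_cases hij : j = i
    · subst hij
      rw [M.comp_of_mem hj]
      exact Submodule.subset_span hx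
    · rw [M.comp_of_ne hj hij]
      exact Submodule.zero_mem _
  | zero => rw [map_zero]; exact Submodule.zero_mem _
  | add x y _ _ hx hy => rw [map_add]; exact Submodule.add_mem _ (hx i) (hy i)
  | smul a x _ hx =>
    induction a using DirectSum.Decomposition.inductionOn 𝒜 with
    | zero => rw [zero_smul, map_zero]; exact Submodule.zero_mem _
    | homogeneous a =>
      rename_i k
      have := M.comp_smul a.2 (i - k) x
      rw [add_sub_cancel] at this
      rw [this]
      exact Submodule.smul_mem _ _ (hx _)
    | add a b ha hb => rw [add_smul, map_add]; exact Submodule.add_mem _ ha hb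

variable (𝒜) in
/-- The regular module. -/
def regular [Module.Finite K A] : GrMod 𝒜 where
  carrier := A
  gr := 𝒜
  isInternal := DirectSum.Decomposition.isInternal 𝒜
  smul_mem hr hx := SetLike.mul_mem_graded hr hx

variable (𝒜) in
/-- Projections onto the homogeneous components of a graded algebra. -/
theorem exists_projections [Module.Finite K A] : ∃ (p : ℤ → A →ₗ[K] A) (s : Finset ℤ),
    (∀ i a, p i a ∈ 𝒜 i) ∧ (∀ i a, a ∈ 𝒜 i → p i a = a) ∧
    (∀ i j a, a ∈ 𝒜 i → i ≠ j → p j a = 0) ∧ (∀ i ∉ s, 𝒜 i = ⊥) ∧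
    (∀ a, ∑ i ∈ s, p i a = a) ∧ ∀ i k a b, a ∈ 𝒜 i → p (i + k) (a * b) = a * p k b := by
  obtain ⟨s, hs, hs'⟩ := (regular 𝒜).exists_sum_comp
  exact ⟨(regular 𝒜).comp, s, fun i a => (regular 𝒜).comp_mem i a,
    fun i a h => (regular 𝒜).comp_of_mem h, fun i j a h hij => (regular 𝒜).comp_of_ne h hij,
    hs, hs', fun i k a b h => (regular 𝒜).comp_smul h k b⟩

end GradedAlgebra

end GrMod

/-! ## Triangular decompositions -/

section Triangular

variable {K : Type v} {A : Type u} [Field K] [Ring A] [Algebra K A]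

/-- The multiplication map `S₁ ⊗ S₂ ⊗ S₃ → A` for three subalgebras of `A`. -/
noncomputable def tripleMul (S₁ S₂ S₃ : Subalgebra K A) : (S₁ ⊗[K] S₂) ⊗[K] S₃ →ₗ[K] A :=
  LinearMap.mul' K A ∘ₗ
    TensorProduct.map
      (LinearMap.mul' K A ∘ₗ TensorProduct.map S₁.val.toLinearMap S₂.val.toLinearMap)
      S₃.val.toLinearMap

/-- The grading on a subalgebra induced by the grading of the algebra. -/
def subGrading (𝒜 : ℤ → Submodule K A) (S : Subalgebra K A) (i : ℤ) : Submodule K S :=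
  (𝒜 i).comap S.val.toLinearMap

/-- A triangular decomposition `(A⁻, T, A⁺)` of a graded algebra `A`. -/
structure TriangularDecomposition (𝒜 : ℤ → Submodule K A) [GradedAlgebra 𝒜] where
  Aneg : Subalgebra K A
  T : Subalgebra K A
  Apos : Subalgebra K A
  nontrivial : Nontrivial A
  graded_neg : ∀ a ∈ Aneg, ∀ i, (DirectSum.decompose 𝒜 a i : A) ∈ Aneg
  graded_pos : ∀ a ∈ Apos, ∀ i, (DirectSum.decompose 𝒜 a i : A) ∈ Apos
  bijective_mul : Function.Bijective (tripleMul Aneg T Apos)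
  T_le : Subalgebra.toSubmodule T ≤ 𝒜 0
  supp_neg : ∀ i > 0, Subalgebra.toSubmodule Aneg ⊓ 𝒜 i = ⊥
  supp_pos : ∀ i < 0, Subalgebra.toSubmodule Apos ⊓ 𝒜 i = ⊥
  zero_neg : Subalgebra.toSubmodule Aneg ⊓ 𝒜 0 = Subalgebra.toSubmodule ⊥
  zero_pos : Subalgebra.toSubmodule Apos ⊓ 𝒜 0 = Subalgebra.toSubmodule ⊥
  mul_comm_neg : Subalgebra.toSubmodule Aneg * Subalgebra.toSubmodule T =
    Subalgebra.toSubmodule T * Subalgebra.toSubmodule Aneg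
  mul_comm_pos : Subalgebra.toSubmodule Apos * Subalgebra.toSubmodule T =
    Subalgebra.toSubmodule T * Subalgebra.toSubmodule Apos
  /-- The algebra `T` is split. -/
  split : ∀ (S : Type u) [AddCommGroup S] [Module T S] [IsSimpleModule T S] (f : S →ₗ[T] S),
    ∃ c : K, ∀ x, f x = algebraMap K T c • x

namespace TriangularDecomposition

variable {𝒜 : ℤ → Submodule K A} [GradedAlgebra 𝒜] (D : TriangularDecomposition 𝒜)

/-- The category of finite-dimensional graded `T`-modules. -/
abbrev TMod := GrMod (subGrading 𝒜 D.T)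

/-- The negative Borel subalgebra, generated by `A⁻` and `T`. -/
def Bneg : Subalgebra K A := D.Aneg ⊔ D.T

/-- The positive Borel subalgebra, generated by `A⁺` and `T`. -/
def Bpos : Subalgebra K A := D.Apos ⊔ D.T

theorem smul_mem_T (M : D.TMod) (t : D.T) {i : ℤ} {x : M} (hx : x ∈ M.gr i) : t • x ∈ M.gr i := by
  have := M.smul_mem (i := 0) (r := t) (D.T_le t.2) hx
  rwa [zero_add] at this

theorem comp_smul_T (M : D.TMod) (t : D.T) (i : ℤ) (x : M) : M.comp i (t • x) = t • M.comp i x := by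
  have := M.comp_smul (i := 0) (r := t) (D.T_le t.2) i x
  rwa [zero_add] at this

/-- The space of `B⁻`-linear maps `A → M`, where `B⁻` acts on `M` through `B⁻ → T`: this map is
the identity on `T` and kills the elements of `B⁻` of negative degree. -/
def coind (M : D.TMod) : Submodule K (A →ₗ[K] M) where
  carrier := {h | (∀ (t : D.T) (a : A), h (t * a) = t • h a) ∧
    ∀ (i : ℤ) (b : A), i < 0 → b ∈ D.Bneg → b ∈ 𝒜 i → ∀ a, h (b * a) = 0}
  add_mem' := fun {h h'} ⟨h1, h2⟩ ⟨h1', h2'⟩ =>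
    ⟨fun t a => by rw [LinearMap.add_apply, h1, h1', LinearMap.add_apply, smul_add],
      fun i b hi hb hb' a => by rw [LinearMap.add_apply, h2 i b hi hb hb', h2' i b hi hb hb', add_zero]⟩
  zero_mem' := ⟨fun t a => by simp, fun i b hi hb hb' a => by simp⟩
  smul_mem' := fun c h ⟨h1, h2⟩ =>
    ⟨fun t a => by rw [LinearMap.smul_apply, h1, LinearMap.smul_apply, smul_comm],
      fun i b hi hb hb' a => by rw [LinearMap.smul_apply, h2 i b hi hb hb', smul_zero]⟩

/-- The action of `A` on maps `A → M`: `(a h)(x) = h(x a)`. -/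
instance (M : D.TMod) : SMul A (D.coind M) where
  smul a h := ⟨h.1 ∘ₗ LinearMap.mulRight K a, fun t x => by
      simp [mul_assoc, h.2.1 t], fun i b hi hb hb' x => by
      simp [mul_assoc, h.2.2 i b hi hb hb']⟩

theorem coind_smul_apply (M : D.TMod) (a : A) (h : D.coind M) (x : A) :
    (a • h).1 x = h.1 (x * a) := rfl

instance (M : D.TMod) : Module A (D.coind M) where
  one_smul h := Subtype.ext (LinearMap.ext fun x => by rw [coind_smul_apply, mul_one])
  mul_smul a b h := Subtype.ext (LinearMap.ext fun x => by
    rw [coind_smul_apply, coind_smul_apply, coind_smul_apply, mul_assoc])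
  smul_zero a := Subtype.ext (LinearMap.ext fun x => by rw [coind_smul_apply]; rfl)
  smul_add a h h' := Subtype.ext (LinearMap.ext fun x => by rw [coind_smul_apply]; rfl)
  add_smul a b h := Subtype.ext (LinearMap.ext fun x => by
    rw [coind_smul_apply, mul_add, map_add]; rfl)
  zero_smul h := Subtype.ext (LinearMap.ext fun x => by
    rw [coind_smul_apply, mul_zero, map_zero]; rfl)

instance (M : D.TMod) : IsScalarTower K A (D.coind M) where
  smul_assoc c a h := Subtype.ext (LinearMap.ext fun x => by
    rw [coind_smul_apply, mul_smul_comm, map_smul]; rfl)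

variable [Module.Finite K A]

/-- The graded `A`-module `A ⊗ M` over the ground field, for a graded `T`-module `M`. The
component of degree `k` is spanned by the `a ⊗ m` with `deg a + deg m = k`. -/
noncomputable def tensor (M : D.TMod) : GrMod 𝒜 where
  carrier := A ⊗[K] M
  gr k := Submodule.span K {z | ∃ i j, i + j = k ∧ ∃ a ∈ 𝒜 i, ∃ x ∈ M.gr j, a ⊗ₜ[K] x = z}
  isInternal := by
    obtain ⟨p, s, -, hp, hp', hs, -⟩ := GrMod.exists_projections 𝒜
    let q : ℤ → (A ⊗[K] M →ₗ[K] A ⊗[K] M) := fun k =>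
      ∑ i ∈ s, TensorProduct.map (p i) (M.comp (k - i))
    have hq : ∀ i j k a x, a ∈ 𝒜 i → x ∈ M.gr j →
        q k (a ⊗ₜ[K] x) = if i + j = k then a ⊗ₜ[K] x else 0 := by
      intro i j k a x ha hx
      simp only [q, LinearMap.sum_apply, TensorProduct.map_tmul]
      by_cases hi : i ∈ s
      · rw [Finset.sum_eq_single_of_mem i hi fun i' _ h => by
          rw [hp' i i' a ha h.symm, TensorProduct.zero_tmul], hp i a ha]
        split_ifs with h
        · have : k - i = j := by omega
          rw [this, M.comp_of_mem hx]
        · rw [M.comp_of_ne hx (by omega), TensorProduct.tmul_zero]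
      · have h1 : 𝒜 i = ⊥ := hs i hi
        rw [h1, Submodule.mem_bot] at ha
        subst ha
        simp
    refine isInternal_of_separating _ ?_ q ?_ ?_
    · intro z
      induction z with
      | zero => exact Submodule.zero_mem _
      | add y z hy hz => exact Submodule.add_mem _ hy hz
      | tmul a x =>
        have ha : a ∈ ⨆ i, 𝒜 i := (GrMod.regular 𝒜).mem_iSup_gr a
        have hx := M.mem_iSup_gr x
        induction ha using Submodule.iSup_induction' with
        | zero => rw [TensorProduct.zero_tmul]; exact Submodule.zero_mem _
        | add a b _ _ ha hb => rw [TensorProduct.add_tmul]; exact Submodule.add_mem _ ha hb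
        | mem i a ha =>
          induction hx using Submodule.iSup_induction' with
          | zero => rw [TensorProduct.tmul_zero]; exact Submodule.zero_mem _
          | add a b _ _ ha hb => rw [TensorProduct.tmul_add]; exact Submodule.add_mem _ ha hb
          | mem j x hx =>
            exact Submodule.mem_iSup_of_mem (i + j)
              (Submodule.subset_span ⟨i, j, rfl, a, ha, x, hx, rfl⟩)
    · intro k l z hz hkl
      induction hz using Submodule.span_induction with
      | zero => rw [map_zero]
      | add y z _ _ hy hz => rw [map_add, hy, hz, add_zero]
      | smul c z _ hz => rw [map_smul, hz, smul_zero]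
      | mem z hz =>
        obtain ⟨i, j, hij, a, ha, x, hx, rfl⟩ := hz
        rw [hq i j l a x ha hx, if_neg (by omega)]
    · intro k z hz h0
      rw [← h0]
      clear h0
      induction hz using Submodule.span_induction with
      | zero => rw [map_zero]
      | add y z _ _ hy hz => rw [map_add, ← hy, ← hz]
      | smul c z _ hz => rw [map_smul, ← hz]
      | mem z hz =>
        obtain ⟨i, j, hij, a, ha, x, hx, rfl⟩ := hz
        rw [hq i j k a x ha hx, if_pos hij]
  smul_mem := by
    intro i k r z hr hz
    induction hz using Submodule.span_induction with
    | zero => rw [smul_zero]; exact Submodule.zero_mem _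
    | add y z _ _ hy hz => rw [smul_add]; exact Submodule.add_mem _ hy hz
    | smul c z _ hz => rw [smul_comm]; exact Submodule.smul_mem _ _ hz
    | mem z hz =>
      obtain ⟨j, l, hjl, a, ha, x, hx, rfl⟩ := hz
      refine Submodule.subset_span ⟨i + j, l, by omega, r * a, SetLike.mul_mem_graded hr ha, x, hx, ?_⟩
      rw [TensorProduct.smul_tmul', smul_eq_mul]

/-- The elements of `A ⊗ M` that have to be killed in order to obtain `A ⊗ M` over the positive
Borel subalgebra `B⁺`, where `B⁺` acts on `M` through `B⁺ → T`: this map is the identity on `T`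
and kills the elements of `B⁺` of positive degree. -/
def tensorRel (M : D.TMod) : Set (D.tensor M) :=
  {z | ∃ (t : D.T) (j : ℤ) (x : M), x ∈ M.gr j ∧
    ((t : A) ⊗ₜ[K] x - (1 : A) ⊗ₜ[K] (t • x) : A ⊗[K] M) = z} ∪
  {z | ∃ (b : A) (i j : ℤ) (x : M), 0 < i ∧ b ∈ D.Bpos ∧ b ∈ 𝒜 i ∧ x ∈ M.gr j ∧
    (b ⊗ₜ[K] x : A ⊗[K] M) = z}

theorem tmul_mem_tensor (M : D.TMod) {i j k : ℤ} {a : A} {x : M} (ha : a ∈ 𝒜 i) (hx : x ∈ M.gr j)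
    (h : i + j = k) : (a ⊗ₜ[K] x : A ⊗[K] M) ∈ ((D.tensor M).gr k : Set (D.tensor M)) :=
  Submodule.subset_span ⟨i, j, h, a, ha, x, hx, rfl⟩

theorem tensorRel_homogeneous (M : D.TMod) (z : D.tensor M) (hz : z ∈ D.tensorRel M) :
    ∃ k, z ∈ (D.tensor M).gr k := by
  rcases hz with ⟨t, j, x, hx, rfl⟩ | ⟨b, i, j, x, -, -, hb, hx, rfl⟩
  · exact ⟨j, ((D.tensor M).gr j).sub_mem (D.tmul_mem_tensor M (D.T_le t.2) hx (zero_add j))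
      (D.tmul_mem_tensor M (SetLike.one_mem_graded 𝒜) (D.smul_mem_T M t hx) (zero_add j))⟩
  · exact ⟨i + j, D.tmul_mem_tensor M hb hx rfl⟩

/-- The standard module `Δ(M) = A ⊗ M` over `B⁺`, where `B⁺` acts on `M` through `B⁺ → T`. -/
noncomputable def standard (M : D.TMod) : GrMod 𝒜 :=
  (D.tensor M).quot (Submodule.span A (D.tensorRel M))
    ((D.tensor M).isGraded_span _ (D.tensorRel_homogeneous M))

/-- The costandard module `∇(M)`: the space of `B⁻`-linear maps `A → M`. The component of degree
`k` consists of the maps that raise degrees by `k`. -/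
noncomputable def costandard (M : D.TMod) : GrMod 𝒜 where
  carrier := D.coind M
  gr k :=
    { carrier := {h | ∀ j, ∀ a ∈ 𝒜 j, h.1 a ∈ M.gr (k + j)}
      add_mem' := fun h1 h2 j a ha => (M.gr (k + j)).add_mem (h1 j a ha) (h2 j a ha)
      zero_mem' := fun j a ha => (M.gr (k + j)).zero_mem
      smul_mem' := fun c _ h j a ha => (M.gr (k + j)).smul_mem c (h j a ha) }
  isInternal := by
    obtain ⟨p, s, hp₀, -, hp', -, hs, hmul⟩ := GrMod.exists_projections 𝒜
    obtain ⟨s₂, -, hs₂⟩ := M.exists_sum_comp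
    let q : ℤ → (D.coind M →ₗ[K] (A →ₗ[K] M)) := fun k =>
      ∑ j ∈ s, (LinearMap.llcomp K A M M (M.comp (k + j))) ∘ₗ
        (LinearMap.lcomp K M (p j)) ∘ₗ (D.coind M).subtype
    have hq : ∀ k h x, q k h x = ∑ j ∈ s, M.comp (k + j) (h.1 (p j x)) := by
      intro k h x
      simp only [q, LinearMap.sum_apply]
      rfl
    refine isInternal_of_separating _ ?_ q ?_ ?_
    · intro h
      have hE : ∀ l j, M.comp l ∘ₗ h.1 ∘ₗ p j ∈ D.coind M := by
        intro l j
        refine ⟨fun t x => ?_, fun i b hi hb hb' x => ?_⟩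
        · have h1 := hmul 0 j t x (D.T_le t.2)
          rw [zero_add] at h1
          simp only [LinearMap.comp_apply]
          rw [h1, h.2.1 t, D.comp_smul_T]
        · have h1 := hmul i (j - i) b x hb'
          rw [add_sub_cancel] at h1
          simp only [LinearMap.comp_apply]
          rw [h1, h.2.2 i b hi hb hb', map_zero]
      have hsum : h = ∑ l ∈ s₂, ∑ j ∈ s, (⟨_, hE l j⟩ : D.coind M) := by
        apply Subtype.ext
        ext x
        simp only [AddSubmonoidClass.coe_finsetSum, LinearMap.sum_apply, LinearMap.comp_apply]
        rw [Finset.sum_comm]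
        simp only [hs₂]
        rw [← map_sum, hs]
      rw [hsum]
      refine Submodule.sum_mem _ fun l _ => Submodule.sum_mem _ fun j _ =>
        Submodule.mem_iSup_of_mem (l - j) ?_
      intro i a ha
      change M.comp l (h.1 (p j a)) ∈ _
      by_cases hij : i = j
      · subst hij
        rw [sub_add_cancel]
        exact M.comp_mem _ _
      · rw [hp' i j a ha hij, map_zero, map_zero]
        exact Submodule.zero_mem _
    · intro i k h hh hik
      ext x
      rw [hq]
      exact Finset.sum_eq_zero fun j _ => M.comp_of_ne (hh j _ (hp₀ j x)) (by omega)
    · intro k h hh h0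
      apply Subtype.ext
      ext x
      have h1 := hq k h x
      rw [h0, Finset.sum_congr rfl fun j _ => M.comp_of_mem (hh j _ (hp₀ j x)), ← map_sum,
        hs] at h1
      exact h1.symm
  smul_mem := by
    intro i k a h ha hh j x hx
    have := hh _ _ (SetLike.mul_mem_graded hx ha)
    rw [coind_smul_apply]
    convert this using 2
    omega

/-- The module `L(M)`, the head of `Δ(M)`. -/
noncomputable def L (M : D.TMod) : GrMod 𝒜 := (D.standard M).head

/-- An `A`-module is rigid if the components of `A⁻` of negative degree and the components of `A⁺`
of positive degree act by zero. -/
def IsRigid (S : GrMod 𝒜) : Prop :=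
  (∀ i < 0, ∀ a ∈ D.Aneg, a ∈ 𝒜 i → ∀ x : S, a • x = 0) ∧
    ∀ i > 0, ∀ a ∈ D.Apos, a ∈ 𝒜 i → ∀ x : S, a • x = 0

/-- The Kazhdan-Lusztig property with respect to the degree function on simple graded
`T`-modules. (It uses `Δ` and `∇` of simple `T`-modules, as is appropriate when `T` is
semisimple.) -/
def KLProperty : Prop :=
  ∀ (lam mu : D.TMod) (k l : ℤ), Simple lam → Simple mu →
    lam.IsConcentratedIn k → mu.IsConcentratedIn l → ∀ m : ℕ,
      (ExtNonzero (D.standard lam) (D.L mu) m → (m : ℤ) ≡ k - l [ZMOD 2]) ∧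
      (ExtNonzero (D.L mu) (D.costandard lam) m → (m : ℤ) ≡ k - l [ZMOD 2])

end TriangularDecomposition

/-- A minimal presentation of a graded subalgebra `S` of `A` as a complete intersection: an
isomorphism of `S` with the quotient of the polynomial ring in variables of degrees `d i` by a
regular sequence of homogeneous elements of degrees `e j` without constant and linear terms. -/
structure CIPresentation (𝒜 : ℤ → Submodule K A) (S : Subalgebra K A) (n : ℕ)
    (d e : Fin n → ℤ) where
  φ : MvPolynomial (Fin n) K →ₐ[K] A
  f : Fin n → MvPolynomial (Fin n) K
  range_eq : φ.range = S
  ker_eq : RingHom.ker φ = Ideal.span (Set.range f)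
  degree_gen : ∀ i, φ (MvPolynomial.X i) ∈ 𝒜 (d i)
  degree_rel : ∀ j, MvPolynomial.IsWeightedHomogeneous d (f j) (e j)
  regular : RingTheory.Sequence.IsRegular (MvPolynomial (Fin n) K) (List.ofFn f)
  minimal : ∀ j, f j ∈ Ideal.span (Set.range (MvPolynomial.X (R := K) (σ := Fin n))) ^ 2

end Triangular

/-! Everything rests on Tate's resolution of the residue field of a complete intersection
`K[x]/(f)`. Write `f j = ∑ i, x i * a j i`, adjoin exterior variables with `x i` as boundaries, and
then divided power variables whose boundaries are the cycles given by `a j`. Regularity of `f` makes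
the result exact in positive degrees (`exists_tate_boundary`), in every characteristic. A basis
monomial with exterior part `I` and exponents `k` has homological degree `|I| + 2 ∑ k j` and
internal degree `∑ i ∈ I, d i + ∑ k j * e j`.

By the triangular decomposition `A` is free as a right `A⁺`-module, so this induces a resolution of
the left `A`-module `A ⊗ K` over `A⁺` (called `cyclic`) by graded free modules with one generator
for each monomial. Since `f j` has no linear term, the `a j i` can be chosen homogeneous without
constant term. All entries of the differential then act by zero on a rigid module, so `Ext^m` from
`cyclic` to a rigid module is the space of maps out of the `m`-th free module
(`extNonzero_cyclic_iff`). A rigid `L(μ)` lives in a single degree; if it is nonzero, such a map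
exists exactly when some monomial of homological degree `m` sits in that degree.

As `T` is semisimple, `cyclic`, which is `A ⊗ T` over `B⁺`, splits into standard modules of simple
modules, and every standard module of a simple module is a retract of it (`exists_sum_standard`,
`exists_retract_standard`). Dually, `A` is free as a left `A⁻`-module, the linear dual of the Tate
complex is an injective resolution of `cocyclic`, and `∇(λ)` is a retract of `cocyclic`
(`exists_retract_costandard`).

The KL-property thus compares the parities of the homological and internal degrees of all monomials.
They agree for all monomials as soon as they agree for the variables, of homological degrees 1 and
2, which means that every `d i` is odd and every `e j` is even. The standard half of the property
already forces this. -/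

/-! ## Operators on the underlying module of the Tate resolution -/

section AnticommutingSums

variable {E ι : Type*} [Ring E]

/-- Diagonal terms die by `e i * e i = 0` and the others cancel in pairs. Square-zero is a
hypothesis separate from anticommutation, so nothing is divided by 2 and characteristic 2 is
covered. -/
theorem sum_mul_sum_eq_zero_of_anticommute (s : Finset ι) (c e : ι → E)
    (hc : ∀ i j, Commute (c i) (c j)) (hce : ∀ i j, Commute (c i) (e j))
    (he : ∀ i, e i * e i = 0) (ha : ∀ i j, i ≠ j → e i * e j + e j * e i = 0) :
    (∑ i ∈ s, c i * e i) * (∑ i ∈ s, c i * e i) = 0 := by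
  classical
  induction s using Finset.induction with
  | empty => simp
  | insert a s has ih =>
    rw [Finset.sum_insert has, add_mul, mul_add, mul_add, ih, add_zero]
    have h1 : c a * e a * (c a * e a) = 0 := by
      rw [mul_assoc, ← mul_assoc (e a), ← (hce a a).eq, mul_assoc (c a) (e a), he, mul_zero,
        mul_zero]
    rw [h1, zero_add, Finset.mul_sum, Finset.sum_mul, ← Finset.sum_add_distrib]
    refine Finset.sum_eq_zero fun i hi => ?_
    have hne : a ≠ i := by rintro rfl; exact has hi
    have h2 : c a * e a * (c i * e i) = c a * c i * (e a * e i) := by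
      rw [mul_assoc, ← mul_assoc (e a), ← (hce i a).eq, mul_assoc, mul_assoc]
    have h3 : c i * e i * (c a * e a) = c a * c i * (e i * e a) := by
      rw [mul_assoc, ← mul_assoc (e i), ← (hce a i).eq, mul_assoc (c a) (e i), ← mul_assoc,
        (hc i a).eq]
    rw [h2, h3, ← mul_add, ha a i hne, mul_zero]

/-- The coefficients of each sum commute past the other sum, so the anticommutator expands
bilinearly. In the applications each anticommutator `e i * e' j + e' j * e i` is 0 or 1. -/
theorem sum_mul_sum_add_sum_mul_sum [Fintype ι] (c c' e e' : ι → E)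
    (hc : ∀ i j, Commute (c i) (c' j)) (hce : ∀ i j, Commute (c i) (e' j))
    (hce' : ∀ i j, Commute (c' i) (e j)) :
    (∑ i, c i * e i) * (∑ i, c' i * e' i) + (∑ i, c' i * e' i) * (∑ i, c i * e i) =
      ∑ i, ∑ j, c i * c' j * (e i * e' j + e' j * e i) := by
  rw [Finset.sum_mul_sum, Finset.sum_mul_sum, Finset.sum_comm (γ := ι) (s := Finset.univ)
    (t := Finset.univ) (f := fun i j => c' i * e' i * (c j * e j)), ← Finset.sum_add_distrib]
  refine Finset.sum_congr rfl fun i _ => ?_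
  rw [← Finset.sum_add_distrib]
  refine Finset.sum_congr rfl fun j _ => ?_
  rw [mul_add]
  congr 1
  · rw [mul_assoc, ← mul_assoc (e i), ← (hce' j i).eq, mul_assoc, mul_assoc]
  · rw [mul_assoc, ← mul_assoc (e' j), ← (hce i j).eq, mul_assoc (c i) (e' j), ← mul_assoc,
      (hc i j).eq]

end AnticommutingSums

/-! ### Wedge, contraction and lowering operators. -/

/-- The index set of the basis of the Tate resolution: products of `n` exterior variables and
divided powers of `r` further variables. -/
abbrev TateIndex (n r : ℕ) : Type := Finset (Fin n) × (Fin r → ℕ)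

namespace TateIndex

variable {n r : ℕ} {K N N' : Type*} [Field K] [AddCommGroup N] [Module K N]
  [AddCommGroup N'] [Module K N']

/-- The sign arising when the `i`-th exterior variable is moved to its place. -/
def sign (i : Fin n) (I : Finset (Fin n)) : ℤ := ∏ j ∈ I, if j < i then -1 else 1

theorem sign_insert (i j : Fin n) {I : Finset (Fin n)} (h : j ∉ I) :
    sign i (insert j I) = (if j < i then -1 else 1) * sign i I := Finset.prod_insert h

theorem sign_eq_erase (i j : Fin n) {I : Finset (Fin n)} (h : j ∈ I) :
    sign i I = (if j < i then -1 else 1) * sign i (I.erase j) := by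
  rw [← sign_insert i j (Finset.notMem_erase j I), Finset.insert_erase h]

theorem sign_mul_self (i : Fin n) (I : Finset (Fin n)) : sign i I * sign i I = 1 := by
  rw [sign, ← Finset.prod_mul_distrib]
  exact Finset.prod_eq_one fun j _ => by split_ifs <;> simp

theorem ite_lt_mul_ite_lt {i j : Fin n} (h : i ≠ j) :
    ((if i < j then -1 else 1) * (if j < i then -1 else 1) : ℤ) = -1 := by
  rcases lt_or_gt_of_ne h with h | h <;> simp [h, h.not_gt]

theorem ite_lt_add_ite_lt {i j : Fin n} (h : i ≠ j) :
    ((if i < j then -1 else 1) + (if j < i then -1 else 1) : ℤ) = 0 := by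
  rcases lt_or_gt_of_ne h with h | h <;> simp [h, h.not_gt]

variable (K N r) in
/-- Contraction with the `i`-th exterior variable. -/
def contractAt (i : Fin n) : Module.End K (TateIndex n r → N) where
  toFun x p := if i ∈ p.1 then 0 else sign i p.1 • x (insert i p.1, p.2)
  map_add' x y := by ext p; by_cases h : i ∈ p.1 <;> simp [h]
  map_smul' c x := by ext p; by_cases h : i ∈ p.1 <;> simp [h, smul_comm c]

variable (K N r) in
/-- Multiplication by the `i`-th exterior variable. -/
def wedgeAt (i : Fin n) : Module.End K (TateIndex n r → N) where
  toFun x p := if i ∈ p.1 then sign i p.1 • x (p.1.erase i, p.2) else 0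
  map_add' x y := by ext p; by_cases h : i ∈ p.1 <;> simp [h]
  map_smul' c x := by ext p; by_cases h : i ∈ p.1 <;> simp [h, smul_comm c]

variable (K N n) in
/-- Lowering of the `j`-th divided power. -/
def lowerAt (j : Fin r) : Module.End K (TateIndex n r → N) where
  toFun x p := x (p.1, p.2 + Pi.single j 1)
  map_add' x y := rfl
  map_smul' c x := rfl

theorem contractAt_apply (i : Fin n) (x : TateIndex n r → N) (p : TateIndex n r) :
    contractAt r K N i x p = if i ∈ p.1 then 0 else sign i p.1 • x (insert i p.1, p.2) := rfl

theorem wedgeAt_apply (i : Fin n) (x : TateIndex n r → N) (p : TateIndex n r) :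
    wedgeAt r K N i x p = if i ∈ p.1 then sign i p.1 • x (p.1.erase i, p.2) else 0 := rfl

theorem lowerAt_apply (j : Fin r) (x : TateIndex n r → N) (p : TateIndex n r) :
    lowerAt n K N j x p = x (p.1, p.2 + Pi.single j 1) := rfl

theorem contractAt_mul_self (i : Fin n) : contractAt r K N i * contractAt r K N i = 0 := by
  ext x p
  simp only [Module.End.mul_apply, contractAt_apply, LinearMap.zero_apply, Pi.zero_apply]
  simp

theorem wedgeAt_mul_self (i : Fin n) : wedgeAt r K N i * wedgeAt r K N i = 0 := by
  ext x p
  simp only [Module.End.mul_apply, wedgeAt_apply, LinearMap.zero_apply, Pi.zero_apply]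
  simp

theorem contractAt_anticommute {i j : Fin n} (h : i ≠ j) :
    contractAt r K N i * contractAt r K N j + contractAt r K N j * contractAt r K N i = 0 := by
  ext x ⟨I, k⟩
  simp only [Module.End.mul_apply, contractAt_apply, LinearMap.zero_apply, Pi.zero_apply,
    LinearMap.add_apply, Pi.add_apply]
  by_cases hi : i ∈ I
  · simp [hi]
  by_cases hj : j ∈ I
  · simp [hj]
  have h1 : j ∉ insert i I := by simp [hj, h.symm]
  have h2 : i ∉ insert j I := by simp [hi, h]
  rw [if_neg hi, if_neg hj, if_neg h1, if_neg h2, Finset.insert_comm, smul_smul, smul_smul,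
    ← add_smul, sign_insert j i hi, sign_insert i j hj]
  have : sign i I * ((if i < j then -1 else 1) * sign j I) +
      sign j I * ((if j < i then -1 else 1) * sign i I) = 0 := by
    linear_combination (sign i I * sign j I) * ite_lt_add_ite_lt h
  rw [this, zero_smul]

theorem wedgeAt_anticommute {i j : Fin n} (h : i ≠ j) :
    wedgeAt r K N i * wedgeAt r K N j + wedgeAt r K N j * wedgeAt r K N i = 0 := by
  ext x ⟨I, k⟩
  simp only [Module.End.mul_apply, wedgeAt_apply, LinearMap.zero_apply, Pi.zero_apply,
    LinearMap.add_apply, Pi.add_apply]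
  by_cases hi : i ∈ I
  · by_cases hj : j ∈ I
    · have h1 : j ∈ I.erase i := by simp [hj, h.symm]
      have h2 : i ∈ I.erase j := by simp [hi, h]
      rw [if_pos hi, if_pos hj, if_pos h1, if_pos h2, Finset.erase_right_comm, smul_smul,
        smul_smul, ← add_smul]
      have : sign i I * sign j (I.erase i) + sign j I * sign i (I.erase j) = 0 := by
        rw [sign_eq_erase i j hj, sign_eq_erase j i hi]
        linear_combination (sign i (I.erase j) * sign j (I.erase i)) * ite_lt_add_ite_lt h
      rw [this, zero_smul]
    · simp [hj]
  · simp [hi]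

theorem contractAt_wedgeAt_anticommute {i j : Fin n} (h : i ≠ j) :
    contractAt r K N i * wedgeAt r K N j + wedgeAt r K N j * contractAt r K N i = 0 := by
  ext x ⟨I, k⟩
  simp only [Module.End.mul_apply, wedgeAt_apply, contractAt_apply, LinearMap.zero_apply,
    Pi.zero_apply, LinearMap.add_apply, Pi.add_apply]
  by_cases hi : i ∈ I
  · have h2 : i ∈ I.erase j := by simp [hi, h]
    simp [hi, h]
  · by_cases hj : j ∈ I
    · have h1 : j ∈ insert i I := by simp [hj]
      have h2 : i ∉ I.erase j := by simp [hi]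
      rw [if_neg hi, if_pos hj, if_pos h1, if_neg h2, Finset.erase_insert_of_ne h, smul_smul,
        smul_smul, ← add_smul, sign_insert j i hi, sign_eq_erase i j hj]
      have : (if j < i then -1 else 1) * sign i (I.erase j) *
          ((if i < j then -1 else 1) * sign j I) + sign j I * sign i (I.erase j) = 0 := by
        linear_combination (sign i (I.erase j) * sign j I) * ite_lt_mul_ite_lt h
      rw [this, zero_smul]
    · simp [hj, h.symm]

theorem contractAt_wedgeAt_apply (i : Fin n) (x : TateIndex n r → N) (p : TateIndex n r) :
    contractAt r K N i (wedgeAt r K N i x) p = if i ∈ p.1 then 0 else x p := by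
  rw [contractAt_apply]
  split_ifs with h
  · rfl
  · rw [wedgeAt_apply, if_pos (Finset.mem_insert_self _ _), smul_smul, sign_insert i i h,
      Finset.erase_insert h, if_neg (lt_irrefl i), one_mul, sign_mul_self, one_smul]

theorem wedgeAt_contractAt_apply (i : Fin n) (x : TateIndex n r → N) (p : TateIndex n r) :
    wedgeAt r K N i (contractAt r K N i x) p = if i ∈ p.1 then x p else 0 := by
  rw [wedgeAt_apply]
  split_ifs with h
  · rw [contractAt_apply, if_neg (Finset.notMem_erase _ _), smul_smul, sign_eq_erase i i h,
      Finset.insert_erase h, if_neg (lt_irrefl i), one_mul, sign_mul_self, one_smul]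
  · rfl

/-- On the coefficient at `p` exactly one of the two products is the identity and the other is zero,
according to whether `i ∈ p.1`. Together with the anticommutation rules these are the Clifford
relations behind all identities for the differentials. -/
theorem contractAt_wedgeAt_add (i : Fin n) :
    contractAt r K N i * wedgeAt r K N i + wedgeAt r K N i * contractAt r K N i = 1 := by
  ext x p
  simp only [LinearMap.add_apply, Pi.add_apply, Module.End.mul_apply, contractAt_wedgeAt_apply,
    wedgeAt_contractAt_apply, Module.End.one_apply]
  split_ifs <;> simp

theorem commute_lowerAt_lowerAt (i j : Fin r) : Commute (lowerAt n K N i) (lowerAt n K N j) := by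
  ext x p
  simp only [Module.End.mul_apply, lowerAt_apply, add_right_comm]

theorem commute_lowerAt_wedgeAt (j : Fin r) (i : Fin n) :
    Commute (lowerAt n K N j) (wedgeAt r K N i) := by
  ext x p
  simp only [Module.End.mul_apply, lowerAt_apply, wedgeAt_apply]

theorem commute_lowerAt_contractAt (j : Fin r) (i : Fin n) :
    Commute (lowerAt n K N j) (contractAt r K N i) := by
  ext x p
  simp only [Module.End.mul_apply, lowerAt_apply, contractAt_apply]

theorem compLeft_contractAt (φ : N →ₗ[K] N') (i : Fin n) (x : TateIndex n r → N) :
    φ.compLeft _ (contractAt r K N i x) = contractAt r K N' i (φ.compLeft _ x) := by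
  ext p
  simp only [LinearMap.compLeft_apply, contractAt_apply, Function.comp_apply]
  split_ifs <;> simp

theorem compLeft_wedgeAt (φ : N →ₗ[K] N') (i : Fin n) (x : TateIndex n r → N) :
    φ.compLeft _ (wedgeAt r K N i x) = wedgeAt r K N' i (φ.compLeft _ x) := by
  ext p
  simp only [LinearMap.compLeft_apply, wedgeAt_apply, Function.comp_apply]
  split_ifs <;> simp

theorem compLeft_lowerAt (φ : N →ₗ[K] N') (j : Fin r) (x : TateIndex n r → N) :
    φ.compLeft _ (lowerAt n K N j x) = lowerAt n K N' j (φ.compLeft _ x) := rfl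

/-! ### The Koszul and Tate differentials. -/

variable {S : Type*} [CommRing S] [Algebra K S] (ρ : S →ₐ[K] Module.End K N)

variable (n r) in
/-- The coordinatewise action of scalars. -/
def act (s : S) : Module.End K (TateIndex n r → N) := (ρ s).compLeft _

theorem act_apply (s : S) (x : TateIndex n r → N) (p : TateIndex n r) :
    act n r ρ s x p = ρ s (x p) := rfl

theorem act_mul (s t : S) : act n r ρ (s * t) = act n r ρ s * act n r ρ t := by
  ext x p; simp [act_apply]

theorem act_sum {ι : Type*} (s : Finset ι) (f : ι → S) :
    act n r ρ (∑ i ∈ s, f i) = ∑ i ∈ s, act n r ρ (f i) := by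
  ext x p; simp [act_apply, LinearMap.sum_apply]

theorem commute_act_act (s t : S) : Commute (act n r ρ s) (act n r ρ t) := by
  rw [Commute, SemiconjBy, ← act_mul, mul_comm, act_mul]

theorem commute_act_contractAt (s : S) (i : Fin n) :
    Commute (act n r ρ s) (contractAt r K N i) :=
  LinearMap.ext fun x => compLeft_contractAt (ρ s) i x

theorem commute_act_wedgeAt (s : S) (i : Fin n) : Commute (act n r ρ s) (wedgeAt r K N i) :=
  LinearMap.ext fun x => compLeft_wedgeAt (ρ s) i x

theorem commute_act_lowerAt (s : S) (j : Fin r) : Commute (act n r ρ s) (lowerAt n K N j) :=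
  LinearMap.ext fun x => compLeft_lowerAt (ρ s) j x

variable (r) in
/-- The Koszul differential of a family of scalars. -/
def koszul (y : Fin n → S) : Module.End K (TateIndex n r → N) :=
  ∑ i, act n r ρ (y i) * contractAt r K N i

variable (r) in
/-- Multiplication by a linear combination of the exterior variables. -/
def wedge (b : Fin n → S) : Module.End K (TateIndex n r → N) :=
  ∑ i, act n r ρ (b i) * wedgeAt r K N i

/-- The differential of the Tate construction. -/
def tate (y : Fin n → S) (a : Fin r → Fin n → S) : Module.End K (TateIndex n r → N) :=
  koszul r ρ y + ∑ j, lowerAt n K N j * wedge r ρ (a j)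

variable (y : Fin n → S) (a : Fin r → Fin n → S) (b : Fin n → S)

theorem koszul_mul_koszul : koszul r ρ y * koszul r ρ y = 0 :=
  sum_mul_sum_eq_zero_of_anticommute _ _ _ (fun _ _ => commute_act_act ρ _ _)
    (fun _ _ => commute_act_contractAt ρ _ _) contractAt_mul_self
    fun _ _ h => contractAt_anticommute h

theorem wedge_mul_wedge : wedge r ρ b * wedge r ρ b = 0 :=
  sum_mul_sum_eq_zero_of_anticommute _ _ _ (fun _ _ => commute_act_act ρ _ _)
    (fun _ _ => commute_act_wedgeAt ρ _ _) wedgeAt_mul_self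
    fun _ _ h => wedgeAt_anticommute h

theorem wedge_anticommute (b b' : Fin n → S) :
    wedge r ρ b * wedge r ρ b' + wedge r ρ b' * wedge r ρ b = 0 := by
  rw [wedge, wedge, sum_mul_sum_add_sum_mul_sum _ _ _ _ (fun _ _ => commute_act_act ρ _ _)
    (fun _ _ => commute_act_wedgeAt ρ _ _) (fun _ _ => commute_act_wedgeAt ρ _ _)]
  refine Finset.sum_eq_zero fun i _ => Finset.sum_eq_zero fun j _ => ?_
  by_cases h : i = j
  · subst h
    rw [wedgeAt_mul_self, add_zero, mul_zero]
  · rw [wedgeAt_anticommute h, mul_zero]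

/-- Only the diagonal anticommutators of contractions and wedges survive. Wedging with `b` is
therefore a null-homotopy of multiplication by `∑ i, y i * b i`. -/
theorem koszul_wedge_anticommute :
    koszul r ρ y * wedge r ρ b + wedge r ρ b * koszul r ρ y = act n r ρ (∑ i, y i * b i) := by
  rw [koszul, wedge, sum_mul_sum_add_sum_mul_sum _ _ _ _ (fun _ _ => commute_act_act ρ _ _)
    (fun _ _ => commute_act_wedgeAt ρ _ _) (fun _ _ => commute_act_contractAt ρ _ _), act_sum]
  refine Finset.sum_congr rfl fun i _ => ?_
  rw [Finset.sum_eq_single_of_mem i (Finset.mem_univ i), contractAt_wedgeAt_add, mul_one, act_mul]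
  intro j _ h
  rw [contractAt_wedgeAt_anticommute h.symm, mul_zero]

theorem commute_lowerAt_wedge (j : Fin r) : Commute (lowerAt n K N j) (wedge r ρ b) :=
  Commute.sum_right _ _ _ fun i _ =>
    (commute_act_lowerAt ρ (b i) j).symm.mul_right (commute_lowerAt_wedgeAt j i)

theorem commute_lowerAt_koszul (j : Fin r) : Commute (lowerAt n K N j) (koszul r ρ y) :=
  Commute.sum_right _ _ _ fun i _ =>
    (commute_act_lowerAt ρ (y i) j).symm.mul_right (commute_lowerAt_contractAt j i)

theorem commute_act_wedge (s : S) : Commute (act n r ρ s) (wedge r ρ b) :=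
  Commute.sum_right _ _ _ fun i _ =>
    (commute_act_act ρ s (b i)).mul_right (commute_act_wedgeAt ρ s i)

theorem commute_act_koszul (s : S) : Commute (act n r ρ s) (koszul r ρ y) :=
  Commute.sum_right _ _ _ fun i _ =>
    (commute_act_act ρ s (y i)).mul_right (commute_act_contractAt ρ s i)

theorem commute_act_tate (s : S) : Commute (act n r ρ s) (tate ρ y a) :=
  (commute_act_koszul ρ y s).add_right <| Commute.sum_right _ _ _ fun j _ =>
    (commute_act_lowerAt ρ s j).mul_right (commute_act_wedge ρ (a j) s)

/-- The divided power part of the differential anticommutes with `wedge`, so only the Koszul part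
contributes. When the next variable is adjoined, `b` is the cycle it kills, and the right side is
multiplication by the next relation. -/
theorem tate_wedge_anticommute :
    tate ρ y a * wedge r ρ b + wedge r ρ b * tate ρ y a = act n r ρ (∑ i, y i * b i) := by
  rw [tate, add_mul, mul_add, add_add_add_comm, koszul_wedge_anticommute, Finset.sum_mul,
    Finset.mul_sum, ← Finset.sum_add_distrib]
  refine add_eq_left.2 (Finset.sum_eq_zero fun j _ => ?_)
  rw [← mul_assoc (wedge r ρ b), ← (commute_lowerAt_wedge ρ b j).eq, mul_assoc, mul_assoc,
    ← mul_add, wedge_anticommute, mul_zero]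

/-- The Koszul part and the divided power part square to zero, and the cross terms give
multiplication by the relations. The square is thus zero only modulo the relations: the construction
is run over the polynomial ring and read modulo ideals. -/
theorem tate_mul_tate :
    tate ρ y a * tate ρ y a = ∑ j, lowerAt n K N j * act n r ρ (∑ i, y i * a j i) := by
  have h : (∑ j, lowerAt n K N j * wedge r ρ (a j)) * (∑ j, lowerAt n K N j * wedge r ρ (a j)) = 0 :=
    sum_mul_sum_eq_zero_of_anticommute _ _ _ (fun i j => commute_lowerAt_lowerAt i j)
      (fun i j => commute_lowerAt_wedge ρ (a j) i) (fun i => wedge_mul_wedge ρ (a i))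
      fun i j _ => wedge_anticommute ρ (a i) (a j)
  rw [tate, add_mul, mul_add, mul_add, koszul_mul_koszul, zero_add, h, add_zero, Finset.mul_sum,
    Finset.sum_mul, ← Finset.sum_add_distrib]
  refine Finset.sum_congr rfl fun j _ => ?_
  rw [← koszul_wedge_anticommute, ← mul_assoc, ← (commute_lowerAt_koszul ρ y j).eq, mul_assoc,
    mul_assoc, ← mul_add]

theorem tate_apply (x : TateIndex n r → N) (p : TateIndex n r) :
    tate ρ y a x p =
      (∑ i, if i ∈ p.1 then 0 else sign i p.1 • ρ (y i) (x (insert i p.1, p.2))) +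
      ∑ j, ∑ i, if i ∈ p.1 then
        sign i p.1 • ρ (a j i) (x (p.1.erase i, p.2 + Pi.single j 1)) else 0 := by
  simp only [tate, koszul, wedge, LinearMap.add_apply, LinearMap.sum_apply, Module.End.mul_apply,
    Pi.add_apply, Finset.sum_apply, act_apply, contractAt_apply, lowerAt_apply, wedgeAt_apply]
  congr 1
  · exact Finset.sum_congr rfl fun i _ => by split_ifs <;> simp
  · exact Finset.sum_congr rfl fun j _ => Finset.sum_congr rfl fun i _ => by split_ifs <;> simp

theorem compLeft_tate (ρ' : S →ₐ[K] Module.End K N') (φ : N →ₗ[K] N')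
    (h : ∀ s x, φ (ρ s x) = ρ' s (φ x)) (x : TateIndex n r → N) :
    φ.compLeft _ (tate ρ y a x) = tate ρ' y a (φ.compLeft _ x) := by
  ext p
  simp only [LinearMap.compLeft_apply, Function.comp_apply, tate_apply, map_add, map_sum]
  congr 1
  · exact Finset.sum_congr rfl fun i _ => by split_ifs <;> simp [h]
  · exact Finset.sum_congr rfl fun j _ => Finset.sum_congr rfl fun i _ => by
      split_ifs <;> simp [h]

end TateIndex

/-! ## Exactness of the Tate resolution -/

/-- Adjoining a divided power variable that kills the cycle representing a regular element. -/
theorem exists_boundary_of_adjoin_divided_power {K M : Type*} [Ring K] [AddCommGroup M] [Module K M]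
    (d z g : Module.End K M) (V I I' E : Submodule K M)
    (hdV : ∀ x ∈ V, d x ∈ V) (hzV : ∀ x ∈ V, z x ∈ V) (hEV : E ≤ V)
    (hdI : ∀ x ∈ I, d x ∈ I) (hzI : ∀ x ∈ I, z x ∈ I) (hdI' : ∀ x ∈ I', d x ∈ I')
    (hzI' : ∀ x ∈ I', z x ∈ I') (hII' : I ≤ I') (hgI' : ∀ x, g x ∈ I')
    (hdd : ∀ x, d (d x) ∈ I) (hdz : ∀ x, d (z x) + z (d x) = g x) (hzz : ∀ x, z (z x) = 0)
    (hgd : ∀ x, d (g x) = g (d x)) (hreg : ∀ x, g x ∈ I → x ∈ I) (hE : ∀ c ∈ E, d c = 0)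
    (hlift : ∀ y ∈ V, y ∈ I' → ∃ w ∈ V, y - g w ∈ I)
    (hex : ∀ x ∈ V, d x ∈ I → ∃ u ∈ V, ∃ c ∈ E, x - d u - c ∈ I) (m : ℕ) :
    ∀ X : ℕ → M, (∀ k, X k ∈ V) → (∀ k, m < k → X k ∈ I') →
      (∀ k, d (X k) + z (X (k + 1)) ∈ I') →
      ∃ U : ℕ → M, (∀ k, U k ∈ V) ∧ (∃ b, ∀ k, b < k → U k = 0) ∧
        (∀ k, X (k + 1) - (d (U (k + 1)) + z (U (k + 2))) ∈ I') ∧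
        ∃ c ∈ E, X 0 - (d (U 0) + z (U 1)) - c ∈ I' := by
  -- boundaries can be subtracted
  have hcyc : ∀ X U : ℕ → M, (∀ k, d (X k) + z (X (k + 1)) ∈ I') →
      ∀ k, d (X k - (d (U k) + z (U (k + 1)))) +
        z (X (k + 1) - (d (U (k + 1)) + z (U (k + 2)))) ∈ I' := by
    intro X U h k
    have h1 := I'.sub_mem (h k) (I'.add_mem (hII' (hdd (U k))) (hgI' (U (k + 1))))
    convert h1 using 1
    simp only [map_sub, map_add, hzz, ← hdz]
    abel
  -- Write `d x ≡ g w` modulo `I`. Then `g (d w) ≡ d (d x) ≡ 0`, so by regularity `w` is a cycle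
  -- modulo `I`, and so is `x - z w`. Exactness applied to both, with `z d = g - d z`, gives the
  -- decomposition; `c'` is the constant part of `w`.
  have htop : ∀ x ∈ V, d x ∈ I' → ∃ u ∈ V, ∃ c ∈ E, ∃ c' ∈ E, x - d u - z c' - c ∈ I' := by
    intro x hx hdx
    obtain ⟨w, hw, hw'⟩ := hlift _ (hdV x hx) hdx
    have hdw : d w ∈ I := by
      apply hreg
      rw [← hgd]
      have := I.sub_mem (hdd x) (hdI _ hw')
      simpa using this
    have h1 : d (x - z w) ∈ I := by
      have := I.add_mem hw' (hzI _ hdw)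
      convert this using 1
      rw [map_sub, ← hdz]
      abel
    obtain ⟨u, hu, c, hc, h2⟩ := hex _ (V.sub_mem hx (hzV w hw)) h1
    obtain ⟨t, ht, c', hc', h3⟩ := hex w hw hdw
    refine ⟨u - z t, V.sub_mem hu (hzV t ht), c, hc, c', hc', ?_⟩
    have h4 := I'.add_mem (I'.add_mem (hII' h2) (hII' (hzI _ h3))) (hgI' t)
    convert h4 using 1
    simp only [map_sub, ← hdz]
    abel
  -- `X k` stands for the coefficient of the `k`-th divided power of the new variable, and the total
  -- differential has coefficients `d (X k) + z (X (k + 1))`. The induction lowers the bound beyond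
  -- which the coefficients lie in `I'`.
  induction m with
  | zero =>
    intro X hX hX' hd
    have hd0 : d (X 0) ∈ I' := by
      have := I'.sub_mem (hd 0) (hzI' _ (hX' 1 one_pos))
      simpa using this
    obtain ⟨u, hu, c, hc, c', hc', h⟩ := htop _ (hX 0) hd0
    -- Placing `c'` at exponent 1 accounts for the term `z c'` at exponent 0; as `d c' = 0`, it adds
    -- nothing at exponent 1.
    refine ⟨fun k => if k = 0 then u else if k = 1 then c' else 0, ?_, ⟨1, ?_⟩, ?_, c, hc, ?_⟩
    · intro k
      dsimp only
      split_ifs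
      exacts [hu, hEV hc', V.zero_mem]
    · intro k hk
      dsimp only
      rw [if_neg (by omega), if_neg (by omega)]
    · intro k
      rcases k with - | k
      · simpa [hE c' hc'] using hX' 1 one_pos
      · simpa using hX' (k + 2) (by omega)
    · simpa [sub_sub] using h
  | succ m ih =>
    intro X hX hX' hd
    have hd0 : d (X (m + 1)) ∈ I' := by
      have := I'.sub_mem (hd (m + 1)) (hzI' _ (hX' (m + 2) (by omega)))
      simpa using this
    obtain ⟨u, hu, c, hc, c', hc', h⟩ := htop _ (hX (m + 1)) hd0
    -- the coefficient of top degree is now constant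
    have h1 : d (X m - z u) + z c ∈ I' := by
      have h2 := I'.sub_mem (I'.sub_mem (hd m) (hzI' _ h)) (hgI' u)
      convert h2 using 1
      simp only [map_sub, hzz, ← hdz]
      abel
    obtain ⟨w, hw, hw'⟩ := hlift _ (V.add_mem (hdV _ (V.sub_mem (hX m) (hzV u hu)))
      (hzV c (hEV hc))) h1
    -- Applying `d` gives `g c ≡ g (d w)`, and `g` cancels. The constant left over at a positive
    -- exponent is thus itself a boundary modulo `I`, and adding `w` to `u` removes the top
    -- coefficient altogether.
    have h3 : c - d w ∈ I := by
      apply hreg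
      have h4 := I.sub_mem (hdI _ hw') (hdd (X m - z u))
      have h5 : d (z c) = g c := by rw [← hdz, hE c hc, map_zero, add_zero]
      convert h4 using 1
      simp only [map_sub, map_add, hgd, h5]
      abel
    let U : ℕ → M := fun k => if k = m + 1 then u + w else if k = m + 2 then c' else 0
    have hU0 : U (m + 1) = u + w := if_pos rfl
    have hU1 : U (m + 2) = c' := by simp [U]
    have hU2 : ∀ k, m + 2 < k → U k = 0 := fun k hk => by
      simp only [U]
      rw [if_neg (by omega), if_neg (by omega)]
    have hUV : ∀ k, U k ∈ V := by
      intro k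
      dsimp only [U]
      split_ifs
      exacts [V.add_mem hu hw, hEV hc', V.zero_mem]
    obtain ⟨U', hU'V, ⟨b, hb⟩, hU'1, c'', hc'', hU'2⟩ := ih
      (fun k => X k - (d (U k) + z (U (k + 1))))
      (fun k => V.sub_mem (hX k) (V.add_mem (hdV _ (hUV k)) (hzV _ (hUV (k + 1))))) (by
        intro k hk
        obtain ⟨l, rfl⟩ : ∃ l, k = m + 1 + l := ⟨k - (m + 1), by omega⟩
        rcases l with - | l | l
        · have h5 := I'.add_mem h (hII' h3)
          change X (m + 1) - (d (U (m + 1)) + z (U (m + 2))) ∈ I'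
          rw [hU0, hU1]
          convert h5 using 1
          rw [map_add]
          abel
        · change X (m + 2) - (d (U (m + 2)) + z (U (m + 3))) ∈ I'
          rw [hU1, hU2 _ (by omega), hE c' hc', map_zero, add_zero, sub_zero]
          exact hX' _ (by omega)
        · rw [hU2 _ (by omega), hU2 _ (by omega), map_zero, map_zero, add_zero, sub_zero]
          exact hX' _ (by omega))
      (hcyc X U hd)
    refine ⟨U + U', fun k => V.add_mem (hUV k) (hU'V k), ⟨b + m + 2, fun k hk => ?_⟩, fun k => ?_,
      c'', hc'', ?_⟩
    · rw [Pi.add_apply, hU2 k (by omega), hb k (by omega), add_zero]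
    · convert hU'1 k using 1
      simp only [Pi.add_apply, map_add]
      abel
    · convert hU'2 using 1
      simp only [Pi.add_apply, map_add]
      abel

namespace TateIndex

variable {n r : ℕ} {K : Type*} [Field K]

/-! ### Adjoining the divided power variables one at a time. -/

section General

variable {S : Type*} [CommRing S] [Algebra K S]

variable (K) in
/-- Families with values in an ideal. -/
def valuedIn (n r : ℕ) (I : Ideal S) : Submodule K (TateIndex n r → S) where
  carrier := {x | ∀ p, x p ∈ I}
  add_mem' hx hy p := I.add_mem (hx p) (hy p)
  zero_mem' _ := I.zero_mem
  smul_mem' c _ hx p := (I.restrictScalars K).smul_mem c (hx p)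

variable (K) in
/-- Families in which the exponents of the divided powers are bounded. -/
def bounded (n r : ℕ) (N : Type*) [AddCommGroup N] [Module K N] :
    Submodule K (TateIndex n r → N) where
  carrier := {x | ∃ b, ∀ p : TateIndex n r, (∃ j, b < p.2 j) → x p = 0}
  add_mem' := by
    rintro x y ⟨b, hb⟩ ⟨c, hc⟩
    refine ⟨max b c, fun p ⟨j, hj⟩ => ?_⟩
    rw [max_lt_iff] at hj
    rw [Pi.add_apply, hb p ⟨j, hj.1⟩, hc p ⟨j, hj.2⟩, add_zero]
  zero_mem' := ⟨0, fun _ _ => rfl⟩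
  smul_mem' := by
    rintro c x ⟨b, hb⟩
    exact ⟨b, fun p hp => by rw [Pi.smul_apply, hb p hp, smul_zero]⟩

variable (K) in
/-- Families supported at the unit basis element. -/
def constants (n r : ℕ) (N : Type*) [AddCommGroup N] [Module K N] :
    Submodule K (TateIndex n r → N) where
  carrier := {x | ∀ p : TateIndex n r, p ≠ (∅, 0) → x p = 0}
  add_mem' hx hy p hp := by rw [Pi.add_apply, hx p hp, hy p hp, add_zero]
  zero_mem' _ _ := rfl
  smul_mem' c x hx p hp := by rw [Pi.smul_apply, hx p hp, smul_zero]

theorem constants_le_bounded (N : Type*) [AddCommGroup N] [Module K N] :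
    constants K n r N ≤ bounded K n r N := fun x hx => ⟨0, fun p ⟨j, hj⟩ => hx p (by
  rintro rfl
  exact lt_irrefl _ hj)⟩

section Action

variable {N : Type*} [AddCommGroup N] [Module K N] (ρ : S →ₐ[K] Module.End K N)
  (y : Fin n → S) (a : Fin r → Fin n → S) (b : Fin n → S)

theorem wedge_apply (x : TateIndex n r → N) (p : TateIndex n r) :
    wedge r ρ b x p =
      ∑ i, if i ∈ p.1 then sign i p.1 • ρ (b i) (x (p.1.erase i, p.2)) else 0 := by
  simp only [wedge, LinearMap.sum_apply, Module.End.mul_apply, Finset.sum_apply, act_apply,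
    wedgeAt_apply]
  exact Finset.sum_congr rfl fun i _ => by split_ifs <;> simp

theorem wedge_mem_bounded {x : TateIndex n r → N} (hx : x ∈ bounded K n r N) :
    wedge r ρ b x ∈ bounded K n r N := by
  obtain ⟨c, hc⟩ := hx
  refine ⟨c, fun p hp => ?_⟩
  rw [wedge_apply]
  refine Finset.sum_eq_zero fun i _ => ?_
  rw [hc (p.1.erase i, p.2) hp, map_zero, smul_zero, ite_self]

theorem tate_mem_bounded {x : TateIndex n r → N} (hx : x ∈ bounded K n r N) :
    tate ρ y a x ∈ bounded K n r N := by
  obtain ⟨c, hc⟩ := hx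
  refine ⟨c, fun p hp => ?_⟩
  rw [tate_apply]
  obtain ⟨l, hl⟩ := hp
  rw [Finset.sum_eq_zero, Finset.sum_eq_zero, add_zero]
  · intro j _
    refine Finset.sum_eq_zero fun i _ => ?_
    rw [hc (p.1.erase i, p.2 + Pi.single j 1) ⟨l, ?_⟩, map_zero, smul_zero, ite_self]
    exact hl.trans_le (Nat.le_add_right _ _)
  · intro i _
    rw [hc (insert i p.1, p.2) ⟨l, hl⟩, map_zero, smul_zero, ite_self]

theorem tate_constants {x : TateIndex n r → N} (hx : x ∈ constants K n r N) :
    tate ρ y a x = 0 := by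
  ext p
  rw [tate_apply, Finset.sum_eq_zero, Finset.sum_eq_zero, add_zero]
  · rfl
  · intro j _
    refine Finset.sum_eq_zero fun i _ => ?_
    rw [hx (p.1.erase i, p.2 + Pi.single j 1) ?_, map_zero, smul_zero, ite_self]
    intro h
    have := congrFun (congrArg Prod.snd h) j
    simp at this
  · intro i _
    rw [hx (insert i p.1, p.2) ?_, map_zero, smul_zero, ite_self]
    intro h
    exact Finset.insert_ne_empty _ _ (congrArg Prod.fst h)

/-- The coefficient of a divided power of the last variable. -/
def slice (k : ℕ) (x : TateIndex n (r + 1) → N) : TateIndex n r → N :=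
  fun p => x (p.1, Fin.snoc (α := fun _ => ℕ) p.2 k)

theorem snoc_add_single_castSucc (p : Fin r → ℕ) (k : ℕ) (j : Fin r) :
    Fin.snoc (α := fun _ => ℕ) p k + Pi.single j.castSucc 1 =
      Fin.snoc (α := fun _ => ℕ) (p + Pi.single j 1) k := by
  ext i
  induction i using Fin.lastCases with
  | last => simp [Pi.single_apply, (Fin.castSucc_lt_last j).ne']
  | cast i => simp [Pi.single_apply]

theorem snoc_add_single_last (p : Fin r → ℕ) (k : ℕ) :
    Fin.snoc (α := fun _ => ℕ) p k + Pi.single (Fin.last r) 1 =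
      Fin.snoc (α := fun _ => ℕ) p (k + 1) := by
  ext i
  induction i using Fin.lastCases with
  | last => simp
  | cast i => simp [Pi.single_apply, (Fin.castSucc_lt_last i).ne]

/-- Lowering the last exponent shifts the slice index, and all other operators act within a slice.
This puts the differential in the form `d (X k) + z (X (k + 1))` required by
`exists_boundary_of_adjoin_divided_power`. -/
theorem slice_tate (a : Fin (r + 1) → Fin n → S) (x : TateIndex n (r + 1) → N) (k : ℕ) :
    slice k (tate ρ y a x) = tate ρ y (fun j => a j.castSucc) (slice k x) +
      wedge r ρ (a (Fin.last r)) (slice (k + 1) x) := by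
  ext p
  simp only [slice, Pi.add_apply, tate_apply, wedge_apply, Fin.sum_univ_castSucc,
    snoc_add_single_castSucc, snoc_add_single_last, add_assoc]

end Action

theorem wedge_mem_valuedIn (b : Fin n → S) {I : Ideal S} {x : TateIndex n r → S}
    (hx : x ∈ valuedIn K n r I) : wedge r (Algebra.lmul K S) b x ∈ valuedIn K n r I := by
  intro p
  rw [wedge_apply]
  refine I.sum_mem fun i _ => ?_
  split_ifs
  · exact zsmul_mem (I.mul_mem_left _ (hx _)) _
  · exact I.zero_mem

theorem tate_mem_valuedIn (y : Fin n → S) (a : Fin r → Fin n → S) {I : Ideal S}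
    {x : TateIndex n r → S} (hx : x ∈ valuedIn K n r I) :
    tate (Algebra.lmul K S) y a x ∈ valuedIn K n r I := by
  intro p
  rw [tate_apply]
  refine I.add_mem (I.sum_mem fun i _ => ?_) (I.sum_mem fun j _ => I.sum_mem fun i _ => ?_)
  · split_ifs
    · exact I.zero_mem
    · exact zsmul_mem (I.mul_mem_left _ (hx _)) _
  · split_ifs
    · exact zsmul_mem (I.mul_mem_left _ (hx _)) _
    · exact I.zero_mem

theorem span_range_castSucc (g : Fin (r + 1) → S) :
    Ideal.span (Set.range g) =
      Ideal.span {g (Fin.last r)} ⊔ Ideal.span (Set.range fun j : Fin r => g j.castSucc) := by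
  rw [← Ideal.span_insert]
  congr 1
  ext s
  simp only [Set.mem_range, Set.mem_insert_iff]
  constructor
  · rintro ⟨i, rfl⟩
    induction i using Fin.lastCases with
    | last => exact Or.inl rfl
    | cast i => exact Or.inr ⟨i, rfl⟩
  · rintro (rfl | ⟨i, rfl⟩)
    exacts [⟨_, rfl⟩, ⟨_, rfl⟩]

/-- If the Koszul complex of the `y i` is exact and the `∑ i, y i * a j i` form a regular
sequence, then the Tate construction is exact. -/
theorem exists_tate_boundary (y : Fin n → S)
    (hy : ∀ x : TateIndex n 0 → S, koszul 0 (Algebra.lmul K S) y x = 0 →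
      ∃ u, x - koszul 0 (Algebra.lmul K S) y u ∈ constants K n 0 S) (r : ℕ) :
    ∀ (a : Fin r → Fin n → S) (g : Fin r → S), (∀ j, ∑ i, y i * a j i = g j) →
      (∀ j s, g j * s ∈ Ideal.span (g '' {i | i < j}) → s ∈ Ideal.span (g '' {i | i < j})) →
      ∀ x ∈ bounded K n r S,
        tate (Algebra.lmul K S) y a x ∈ valuedIn K n r (Ideal.span (Set.range g)) →
        ∃ u ∈ bounded K n r S, ∃ c ∈ constants K n r S,
          x - tate (Algebra.lmul K S) y a u - c ∈ valuedIn K n r (Ideal.span (Set.range g)) := by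
  induction r with
  | zero =>
    intro a g _ _ x _ hx
    have htate : ∀ u : TateIndex n 0 → S,
        tate (Algebra.lmul K S) y a u = koszul 0 (Algebra.lmul K S) y u := by
      intro u
      simp [tate]
    have h0 : Ideal.span (Set.range g) = ⊥ := by
      rw [Set.range_eq_empty, Ideal.span_empty]
    obtain ⟨u, hu⟩ := hy x (by
      ext p
      have := hx p
      rw [h0, htate] at this
      exact this)
    refine ⟨u, ⟨0, fun p ⟨j, _⟩ => j.elim0⟩, _, hu, ?_⟩
    rw [htate, sub_self]
    exact Submodule.zero_mem _
  | succ r ih =>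
    intro a g hg hreg x hxb hx
    have hlast : g '' {i | i < Fin.last r} = Set.range fun j : Fin r => g j.castSucc := by
      ext s
      constructor
      · rintro ⟨i, hi, rfl⟩
        exact ⟨i.castPred hi.ne, by simp⟩
      · rintro ⟨j, rfl⟩
        exact ⟨_, Fin.castSucc_lt_last j, rfl⟩
    have hcast : ∀ j : Fin r, g '' {i | i < j.castSucc} =
        (fun i : Fin r => g i.castSucc) '' {i | i < j} := by
      intro j
      ext s
      constructor
      · rintro ⟨i, hi, rfl⟩
        refine ⟨i.castPred (hi.trans (Fin.castSucc_lt_last j)).ne, ?_, by simp⟩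
        exact Fin.castSucc_lt_castSucc_iff.1 (by simpa using hi)
      · rintro ⟨i, hi, rfl⟩
        exact ⟨_, Fin.castSucc_lt_castSucc_iff.2 hi, rfl⟩
    have hsplit := span_range_castSucc g
    have hregl := hreg (Fin.last r)
    rw [hlast] at hregl
    set I := Ideal.span (Set.range fun j : Fin r => g j.castSucc) with hI
    set I' := Ideal.span (Set.range g) with hI'
    have hII' : I ≤ I' := hsplit ▸ le_sup_right
    have hgI' : ∀ s, g (Fin.last r) * s ∈ I' := fun s =>
      I'.mul_mem_right _ (Ideal.subset_span ⟨_, rfl⟩)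
    let d := tate (Algebra.lmul K S) y fun j : Fin r => a j.castSucc
    let z := wedge r (Algebra.lmul K S) (a (Fin.last r))
    obtain ⟨b, hb⟩ := hxb
    obtain ⟨U, hUV, ⟨b', hb'⟩, hU1, c, hc, hU2⟩ := exists_boundary_of_adjoin_divided_power d z
      (act n r (Algebra.lmul K S) (g (Fin.last r))) (bounded K n r S) (valuedIn K n r I)
      (valuedIn K n r I') (constants K n r S)
      (fun x => tate_mem_bounded _ _ _) (fun x => wedge_mem_bounded _ _)
      (constants_le_bounded S) (fun x => tate_mem_valuedIn _ _) (fun x => wedge_mem_valuedIn _)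
      (fun x => tate_mem_valuedIn _ _) (fun x => wedge_mem_valuedIn _)
      (fun x hx p => hII' (hx p)) (fun x p => hgI' (x p))
      (fun x p => by
        have := congrFun (LinearMap.congr_fun
          (tate_mul_tate (Algebra.lmul K S) y fun j : Fin r => a j.castSucc) x) p
        rw [Module.End.mul_apply] at this
        rw [this, LinearMap.sum_apply, Finset.sum_apply]
        refine I.sum_mem fun j _ => ?_
        rw [hg]
        exact I.mul_mem_right _ (Ideal.subset_span ⟨j, rfl⟩))
      (fun x => by
        have := LinearMap.congr_fun (tate_wedge_anticommute (Algebra.lmul K S) y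
          (fun j : Fin r => a j.castSucc) (a (Fin.last r))) x
        rwa [hg] at this)
      (fun x => LinearMap.congr_fun (wedge_mul_wedge (Algebra.lmul K S) (a (Fin.last r))) x)
      (fun x => (LinearMap.congr_fun (commute_act_tate (Algebra.lmul K S) y
          (fun j : Fin r => a j.castSucc) (g (Fin.last r))) x).symm)
      (fun x hx p => hregl _ (hx p)) (fun x => tate_constants _ _ _)
      (fun x ⟨b, hb⟩ hx => by
        -- The quotient by the last relation is taken to be 0 wherever `x p = 0`, so that the chosen
        -- family stays bounded.
        have h1 : ∀ p, ∃ w, x p - g (Fin.last r) * w ∈ I ∧ (x p = 0 → w = 0) := by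
          intro p
          by_cases h0 : x p = 0
          · exact ⟨0, by simp [h0], fun _ => rfl⟩
          · have := hx p
            rw [hsplit, Submodule.mem_sup] at this
            obtain ⟨s, hs, t, ht, hst⟩ := this
            rw [Ideal.mem_span_singleton'] at hs
            obtain ⟨w, rfl⟩ := hs
            refine ⟨w, ?_, fun h => absurd h h0⟩
            rw [← hst, mul_comm, add_sub_cancel_left]
            exact ht
        choose w hw hw0 using h1
        exact ⟨w, ⟨b, fun p hp => hw0 p (hb p hp)⟩, hw⟩)
      (ih (fun j => a j.castSucc) (fun j => g j.castSucc) (fun j => hg _) (fun j s => by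
        rw [← hcast]; exact hreg _ s)) b
      (fun k => slice k x) (fun k => ⟨b, fun p ⟨j, hj⟩ => hb _ ⟨j.castSucc, by simpa using hj⟩⟩)
      (fun k hk p => by
        have : slice k x p = 0 := hb _ ⟨Fin.last r, by simpa using hk⟩
        rw [this]; exact I'.zero_mem)
      (fun k p => by
        have := congrFun (slice_tate (Algebra.lmul K S) y a x k) p
        rw [← this]
        exact hx _)
    -- Each slice has its own bound on the exponents. Only the slices up to `b'` can be nonzero, so
    -- the sum of their bounds serves for all.
    have hUb : ∃ B, ∀ k p, (∃ j, B < p.2 j) → U k p = 0 := by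
      choose B hB using hUV
      refine ⟨∑ k ∈ Finset.range (b' + 1), B k, fun k p ⟨j, hj⟩ => ?_⟩
      by_cases hk : b' < k
      · rw [hb' k hk]; rfl
      · exact hB k p ⟨j, lt_of_le_of_lt (Finset.single_le_sum (f := B) (fun _ _ => Nat.zero_le _)
          (Finset.mem_range.2 (by omega))) hj⟩
    obtain ⟨B, hB⟩ := hUb
    -- The slices are glued along the last exponent; the constant `c` will be placed where that
    -- exponent is 0.
    let u : TateIndex n (r + 1) → S := fun p => U (p.2 (Fin.last r)) (p.1, Fin.init p.2)
    have hslice : ∀ k, slice k u = U k := by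
      intro k
      ext p
      simp [slice, u]
    refine ⟨u, ⟨max b' B, fun p ⟨j, hj⟩ => ?_⟩,
      fun p => if p.2 (Fin.last r) = 0 then c (p.1, Fin.init p.2) else 0, fun p hp => ?_,
      fun p => ?_⟩
    · rw [max_lt_iff] at hj
      induction j using Fin.lastCases with
      | last => exact congrFun (hb' _ hj.1) _
      | cast j => exact hB _ _ ⟨j, hj.2⟩
    · dsimp only
      split_ifs with h
      · apply hc
        intro h'
        apply hp
        refine Prod.ext (Prod.mk.inj h').1 ?_
        have h2 : Fin.init (α := fun _ => ℕ) p.2 = 0 := (Prod.mk.inj h').2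
        ext j
        induction j using Fin.lastCases with
        | last => exact h
        | cast j => exact congrFun h2 j
      · rfl
    · obtain ⟨P, k⟩ := p
      rw [← Fin.snoc_init_self (α := fun _ => ℕ) k]
      have h1 := congrFun (slice_tate (Algebra.lmul K S) y a u (k (Fin.last r)))
        (P, Fin.init (α := fun _ => ℕ) k)
      rw [hslice, hslice] at h1
      change tate (Algebra.lmul K S) y a u (P, Fin.snoc (α := fun _ => ℕ)
        (Fin.init (α := fun _ => ℕ) k) (k (Fin.last r))) = _ at h1
      rw [Pi.sub_apply, Pi.sub_apply, h1]
      generalize k (Fin.last r) = l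
      simp only [Fin.snoc_last, Fin.init_snoc]
      rcases l with - | l
      · rw [if_pos rfl]
        exact hU2 (P, Fin.init (α := fun _ => ℕ) k)
      · rw [if_neg (Nat.succ_ne_zero _), sub_zero]
        exact hU1 l (P, Fin.init (α := fun _ => ℕ) k)

end General

/-! ### Exactness of the Koszul complex of the variables. -/

section Polynomial

open MvPolynomial

/-- Division of a polynomial by a variable, discarding the remainder. -/
noncomputable def divX (i : Fin n) : Module.End K (MvPolynomial (Fin n) K) where
  toFun p := p.divMonomial (Finsupp.single i 1)
  map_add' p q := add_divMonomial _ _ _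
  map_smul' c p := by
    ext s
    simp [coeff_divMonomial]

theorem divX_X_mul_self (i : Fin n) (p : MvPolynomial (Fin n) K) : divX i (X i * p) = p :=
  X_mul_divMonomial i p

theorem divX_X_mul {i j : Fin n} (h : i ≠ j) (p : MvPolynomial (Fin n) K) :
    divX i (X j * p) = X j * divX i p := by
  classical
  ext s
  change coeff s ((X j * p).divMonomial _) = coeff s (X j * p.divMonomial _)
  rw [coeff_divMonomial, coeff_X_mul', coeff_X_mul', coeff_divMonomial]
  have h1 : j ∈ (Finsupp.single i 1 + s).support ↔ j ∈ s.support := by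
    simp [Finsupp.single_apply, h]
  simp only [h1]
  split_ifs with h2
  · congr 1
    ext k
    by_cases hk : k = j
    · subst hk
      simp [Finsupp.single_apply, h]
    · have : j ≠ k := fun h => hk h.symm
      simp [Finsupp.single_apply, this]
  · rfl

/-- The contracting homotopy in the direction of one variable. -/
theorem koszul_homotopy (i : Fin n) (x : TateIndex n 0 → MvPolynomial (Fin n) K)
    (p : TateIndex n 0) :
    (koszul 0 (Algebra.lmul K _) X (wedgeAt 0 K _ i ((divX i).compLeft _ x)) +
      wedgeAt 0 K _ i ((divX i).compLeft _ (koszul 0 (Algebra.lmul K _) X x))) p =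
      if i ∈ p.1 then x p else X i * divX i (x p) := by
  simp only [koszul, LinearMap.sum_apply, map_sum, Module.End.mul_apply]
  -- The summands with `j ≠ i` cancel: `divX i` commutes with multiplication by `X j`, while
  -- contraction at `j` anticommutes with the wedge at `i`.
  rw [← Finset.sum_add_distrib, Finset.sum_eq_single_of_mem i (Finset.mem_univ i)]
  · rw [Pi.add_apply, act_apply, contractAt_wedgeAt_apply]
    have h1 : (divX i).compLeft (TateIndex n 0) (act n 0 (Algebra.lmul K _) (X i)
        (contractAt 0 K _ i x)) = contractAt 0 K _ i x := by
      ext1 q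
      exact divX_X_mul_self i _
    rw [h1, wedgeAt_contractAt_apply]
    split_ifs
    · simp
    · simp
  · intro j _ hj
    have h1 : (divX i).compLeft (TateIndex n 0) (act n 0 (Algebra.lmul K _) (X j)
        (contractAt 0 K _ j x)) = act n 0 (Algebra.lmul K _) (X j)
          (contractAt 0 K _ j ((divX i).compLeft _ x)) := by
      rw [← compLeft_contractAt]
      ext1 q
      exact divX_X_mul hj.symm _
    rw [h1]
    have h2 := LinearMap.congr_fun (commute_act_wedgeAt (n := n) (r := 0)
      (Algebra.lmul K (MvPolynomial (Fin n) K)) (X j) i)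
      (contractAt 0 K _ j ((divX i).compLeft _ x))
    rw [Module.End.mul_apply, Module.End.mul_apply] at h2
    rw [← h2, ← map_add]
    have h3 := LinearMap.congr_fun (contractAt_wedgeAt_anticommute (r := 0) (K := K)
      (N := MvPolynomial (Fin n) K) hj) ((divX i).compLeft _ x)
    rw [LinearMap.add_apply, Module.End.mul_apply, Module.End.mul_apply] at h3
    rw [h3, LinearMap.zero_apply, map_zero]

/-- The Koszul complex of the variables of a polynomial ring is exact. -/
theorem exists_koszul_boundary (x : TateIndex n 0 → MvPolynomial (Fin n) K)
    (hx : koszul 0 (Algebra.lmul K _) X x = 0) :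
    ∃ u, x - koszul 0 (Algebra.lmul K _) X u ∈ constants K n 0 (MvPolynomial (Fin n) K) := by
  -- The directions are treated one by one, `t` being the set of those already done. The homotopy
  -- for a new `i` clears the coefficients whose index set contains `i`, and on the others it
  -- subtracts `X i * divX i` of the coefficient, so those already zero stay zero.
  have key : ∀ t : Finset (Fin n), ∃ u : TateIndex n 0 → MvPolynomial (Fin n) K, ∀ p : TateIndex n 0, (∃ i ∈ t, i ∈ p.1) →
      (x - koszul 0 (Algebra.lmul K (MvPolynomial (Fin n) K)) X u) p = 0 := by
    intro t
    induction t using Finset.induction with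
    | empty => exact ⟨0, fun p ⟨i, hi, _⟩ => absurd hi (Finset.notMem_empty i)⟩
    | insert i t _ ih =>
      obtain ⟨u, hu⟩ := ih
      set x' := x - koszul 0 (Algebra.lmul K (MvPolynomial (Fin n) K)) X u with hx'
      have hd : koszul 0 (Algebra.lmul K (MvPolynomial (Fin n) K)) X x' = 0 := by
        rw [hx', map_sub, hx, zero_sub, neg_eq_zero]
        exact LinearMap.congr_fun (koszul_mul_koszul (Algebra.lmul K (MvPolynomial (Fin n) K)) X) u
      refine ⟨u + wedgeAt 0 K (MvPolynomial (Fin n) K) i ((divX i).compLeft _ x'), fun p ⟨j, hj, hjp⟩ => ?_⟩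
      have h := koszul_homotopy i x' p
      rw [hd, map_zero, map_zero, add_zero] at h
      rw [map_add, ← sub_sub, ← hx', Pi.sub_apply, h]
      split_ifs with hi
      · exact sub_self _
      · have : j ∈ t := (Finset.mem_insert.1 hj).resolve_left (by rintro rfl; exact hi hjp)
        rw [hu p ⟨j, this, hjp⟩, map_zero, mul_zero, sub_zero]
  obtain ⟨u, hu⟩ := key Finset.univ
  refine ⟨u, fun p hp => ?_⟩
  obtain ⟨i, hi⟩ : p.1.Nonempty := by
    rw [Finset.nonempty_iff_ne_empty]
    intro h
    exact hp (Prod.ext h (Subsingleton.elim _ _))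
  exact hu p ⟨i, Finset.mem_univ i, hi⟩

end Polynomial

end TateIndex

/-! ## The homogeneous components of the Tate resolution -/

namespace TateIndex

variable {n r : ℕ} {K : Type*} [Field K] {S : Type*} [CommRing S] [Algebra K S]
  {N : Type*} [AddCommGroup N] [Module K N]

/-- The homological degree of a basis element. -/
def hdeg (p : TateIndex n r) : ℕ := p.1.card + 2 * ∑ j, p.2 j

theorem hdeg_insert {i : Fin n} {p : TateIndex n r} (h : i ∉ p.1) :
    hdeg ((insert i p.1, p.2) : TateIndex n r) = hdeg p + 1 := by
  simp only [hdeg, Finset.card_insert_of_notMem h]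
  omega

theorem hdeg_erase {i : Fin n} {p : TateIndex n r} (h : i ∈ p.1) (j : Fin r) :
    hdeg ((p.1.erase i, p.2 + Pi.single j 1) : TateIndex n r) = hdeg p + 1 := by
  have h1 := Finset.card_erase_add_one h
  simp only [hdeg, Pi.add_apply, Finset.sum_add_distrib, Finset.sum_pi_single', Finset.mem_univ,
    if_true]
  omega

variable (n r) in
/-- The basis elements of a fixed homological degree. -/
abbrev Basis (m : ℕ) : Type := {p : TateIndex n r // hdeg p = m}

instance (m : ℕ) : Finite (Basis n r m) := by
  let F : Basis n r m → Finset (Fin n) × (Fin r → Fin (m + 1)) := fun p =>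
    (p.1.1, fun j => ⟨p.1.2 j, by
      have h1 := p.2
      have h2 : p.1.2 j ≤ ∑ j, p.1.2 j :=
        Finset.single_le_sum (f := p.1.2) (fun _ _ => Nat.zero_le _) (Finset.mem_univ j)
      simp only [hdeg] at h1
      omega⟩)
  refine Finite.of_injective F fun p q h => ?_
  have h1 : p.1.1 = q.1.1 := congrArg (fun z => z.1) h
  have h2 : p.1.2 = q.1.2 := by
    ext j
    exact congrArg (fun z => ((z.2 j : Fin (m + 1)) : ℕ)) h
  exact Subtype.ext (Prod.ext h1 h2)

noncomputable instance (m : ℕ) : Fintype (Basis n r m) := Fintype.ofFinite _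

variable (n r) in
/-- The unit basis element. -/
def Basis.unit : Basis n r 0 := ⟨(∅, 0), by simp [hdeg]⟩

theorem Basis.eq_unit (b : Basis n r 0) : b = Basis.unit n r := by
  obtain ⟨⟨I, k⟩, h⟩ := b
  simp only [hdeg, Nat.add_eq_zero_iff, Finset.card_eq_zero, mul_eq_zero,
    Finset.sum_eq_zero_iff, Finset.mem_univ, true_implies] at h
  refine Subtype.ext (Prod.ext h.1 ?_)
  ext j
  exact (h.2.resolve_left (by norm_num)) j

variable (r) in
/-- The exterior variables. -/
def Basis.ext (i : Fin n) : Basis n r 1 := ⟨({i}, 0), by simp [hdeg]⟩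

variable (n) in
/-- The divided power variables. -/
def Basis.div (j : Fin r) : Basis n r 2 := ⟨(∅, Pi.single j 1), by simp [hdeg]⟩

variable (K N) in
/-- Extension by zero. -/
def extendZero (m : ℕ) : (Basis n r m → N) →ₗ[K] (TateIndex n r → N) where
  toFun x p := if h : hdeg p = m then x ⟨p, h⟩ else 0
  map_add' x y := by ext p; by_cases h : hdeg p = m <;> simp [h]
  map_smul' c x := by ext p; by_cases h : hdeg p = m <;> simp [h]

theorem extendZero_apply_val {m : ℕ} (x : Basis n r m → N) (b : Basis n r m) :
    extendZero K N m x b.1 = x b := dif_pos b.2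

theorem extendZero_apply_of_ne {m : ℕ} (x : Basis n r m → N) {p : TateIndex n r}
    (h : hdeg p ≠ m) : extendZero K N m x p = 0 := dif_neg h

theorem extendZero_mem_bounded {m : ℕ} (x : Basis n r m → N) :
    extendZero K N m x ∈ bounded K n r N := by
  refine ⟨m, fun p ⟨j, hj⟩ => extendZero_apply_of_ne x ?_⟩
  have h2 : p.2 j ≤ ∑ j, p.2 j :=
    Finset.single_le_sum (f := p.2) (fun _ _ => Nat.zero_le _) (Finset.mem_univ j)
  simp only [hdeg]
  omega

variable (ρ : S →ₐ[K] Module.End K N) (y : Fin n → S) (a : Fin r → Fin n → S)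

/-- The differential of the Tate resolution in a fixed homological degree. -/
def tateMap (m : ℕ) : (Basis n r (m + 1) → N) →ₗ[K] (Basis n r m → N) :=
  LinearMap.funLeft K N Subtype.val ∘ₗ tate ρ y a ∘ₗ extendZero K N (m + 1)

theorem tateMap_apply (m : ℕ) (x : Basis n r (m + 1) → N) (b : Basis n r m) :
    tateMap ρ y a m x b = (∑ i, if h : i ∈ b.1.1 then 0 else
        sign i b.1.1 • ρ (y i) (x ⟨(insert i b.1.1, b.1.2), by rw [hdeg_insert h, b.2]⟩)) +
      ∑ j, ∑ i, if h : i ∈ b.1.1 then sign i b.1.1 •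
        ρ (a j i) (x ⟨(b.1.1.erase i, b.1.2 + Pi.single j 1), by rw [hdeg_erase h, b.2]⟩)
        else 0 := by
  change tate ρ y a (extendZero K N (m + 1) x) b.1 = _
  rw [tate_apply]
  congr 1
  · refine Finset.sum_congr rfl fun i _ => ?_
    by_cases h : i ∈ b.1.1
    · rw [if_pos h, dif_pos h]
    · rw [if_neg h, dif_neg h]
      congr 2
      exact dif_pos (by rw [hdeg_insert h, b.2])
  · refine Finset.sum_congr rfl fun j _ => Finset.sum_congr rfl fun i _ => ?_
    by_cases h : i ∈ b.1.1
    · rw [if_pos h, dif_pos h]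
      congr 2
      exact dif_pos (by rw [hdeg_erase h, b.2])
    · rw [if_neg h, dif_neg h]

/-- The differential lowers the homological degree by exactly one, so the image is supported in
degree `m`. Identities for `tate` thereby pass to the single homological degrees. -/
theorem tate_extendZero (m : ℕ) (x : Basis n r (m + 1) → N) :
    tate ρ y a (extendZero K N (m + 1) x) = extendZero K N m (tateMap ρ y a m x) := by
  ext p
  by_cases h : hdeg p = m
  · exact (extendZero_apply_val (K := K) (tateMap ρ y a m x) ⟨p, h⟩).symm
  · rw [extendZero_apply_of_ne _ h, tate_apply, Finset.sum_eq_zero, Finset.sum_eq_zero, add_zero]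
    · intro j _
      refine Finset.sum_eq_zero fun i _ => ?_
      split_ifs with hi
      · rw [extendZero_apply_of_ne, map_zero, smul_zero]
        rw [hdeg_erase hi]
        omega
      · rfl
    · intro i _
      split_ifs with hi
      · rfl
      · rw [extendZero_apply_of_ne, map_zero, smul_zero]
        rw [hdeg_insert hi]
        omega

theorem tateMap_comp_val (m : ℕ) (x : TateIndex n r → N) (b : Basis n r m) :
    tateMap ρ y a m (fun b => x b.1) b = tate ρ y a x b.1 := by
  rw [tateMap_apply, tate_apply]
  congr 1

theorem extendZero_injective (m : ℕ) : Function.Injective (extendZero (n := n) (r := r) K N m) :=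
  fun x x' h => funext fun b => by
    rw [← extendZero_apply_val (K := K) x, h, extendZero_apply_val]

theorem tateMap_tateMap (h : ∀ j, ρ (∑ i, y i * a j i) = 0) (m : ℕ)
    (x : Basis n r (m + 2) → N) : tateMap ρ y a m (tateMap ρ y a (m + 1) x) = 0 := by
  apply extendZero_injective (K := K)
  rw [← tate_extendZero, ← tate_extendZero, map_zero, ← Module.End.mul_apply, tate_mul_tate,
    LinearMap.sum_apply]
  refine Finset.sum_eq_zero fun j _ => ?_
  ext p
  rw [Module.End.mul_apply, lowerAt_apply, act_apply, h]
  rfl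

theorem tateMap_zero_apply (x : Basis n r 1 → N) :
    tateMap ρ y a 0 x (Basis.unit n r) = ∑ i, ρ (y i) (x (Basis.ext r i)) := by
  rw [tateMap_apply]
  have h1 : ∀ i : Fin n, i ∉ (Basis.unit n r).1.1 := fun i => Finset.notMem_empty i
  simp only [h1, dif_neg, not_false_eq_true, Finset.sum_const_zero, add_zero]
  refine Finset.sum_congr rfl fun i _ => ?_
  have : sign i (Basis.unit n r).1.1 = 1 := Finset.prod_empty
  rw [this, one_smul]
  rfl

theorem compLeft_tateMap {N' : Type*} [AddCommGroup N'] [Module K N']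
    (ρ' : S →ₐ[K] Module.End K N') (φ : N →ₗ[K] N') (h : ∀ s x, φ (ρ s x) = ρ' s (φ x)) (m : ℕ)
    (x : Basis n r (m + 1) → N) :
    φ.compLeft _ (tateMap ρ y a m x) = tateMap ρ' y a m (φ.compLeft _ x) := by
  have h1 : extendZero K N' (m + 1) (φ.compLeft _ x) =
      φ.compLeft _ (extendZero K N (m + 1) x) := by
    ext p
    by_cases hp : hdeg p = m + 1
    · exact (extendZero_apply_val _ ⟨p, hp⟩).trans
        (congrArg φ (extendZero_apply_val (K := K) x ⟨p, hp⟩)).symm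
    · rw [extendZero_apply_of_ne _ hp, LinearMap.compLeft_apply, Function.comp_apply,
        extendZero_apply_of_ne _ hp, map_zero]
  ext b
  exact (congrFun (compLeft_tate ρ y a ρ' φ h (extendZero K N (m + 1) x)) b.1).trans
    (congrFun (congrArg (tate ρ' y a) h1.symm) b.1)

/-- Exactness of the Tate resolution of a complete intersection, with coefficients in a free
module. -/
theorem exists_tateMap_eq {f : Fin r → MvPolynomial (Fin n) K}
    (a : Fin r → Fin n → MvPolynomial (Fin n) K) (ha : ∀ j, ∑ i, MvPolynomial.X i * a j i = f j)
    (hf : ∀ j s, f j * s ∈ Ideal.span (f '' {i | i < j}) → s ∈ Ideal.span (f '' {i | i < j}))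
    (ρ : MvPolynomial (Fin n) K →ₐ[K] Module.End K N) {ι : Type*}
    (Θ : (ι → MvPolynomial (Fin n) K) →ₗ[K] N) (hΘ : Function.Surjective Θ)
    (hΘs : ∀ s x, Θ (s • x) = ρ s (Θ x))
    (hΘ0 : ∀ x, Θ x = 0 ↔ ∀ i, x i ∈ Ideal.span (Set.range f)) (m : ℕ)
    (x : Basis n r (m + 1) → N) (hx : tateMap ρ MvPolynomial.X a m x = 0) :
    ∃ u, tateMap ρ MvPolynomial.X a (m + 1) u = x := by
  -- The boundary is found coordinatewise over the polynomial ring. A lift of a cycle along `Θ` is a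
  -- cycle modulo the relations, because the kernel of `Θ` consists of the tuples with entries in
  -- the ideal of relations.
  have h1 : ∀ b, ∃ X, Θ X = x b := fun b => hΘ _
  choose X hX using h1
  have hcomp := fun (i : ι) => compLeft_tateMap (n := n) (r := r) (K := K)
    (Algebra.lsmul K K (ι → MvPolynomial (Fin n) K)) MvPolynomial.X a
    (Algebra.lmul K (MvPolynomial (Fin n) K)) (LinearMap.proj i) (fun _ _ => rfl)
  have hΘc := compLeft_tateMap (n := n) (r := r) (K := K)
    (Algebra.lsmul K K (ι → MvPolynomial (Fin n) K)) MvPolynomial.X a ρ Θ hΘs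
  have h2 : ∀ i, ∃ U : TateIndex n r → MvPolynomial (Fin n) K, ∀ b : Basis n r (m + 1),
      X b i - tate (Algebra.lmul K _) MvPolynomial.X a U b.1 ∈ Ideal.span (Set.range f) := by
    intro i
    obtain ⟨U, -, c, hc, hU⟩ := exists_tate_boundary MvPolynomial.X exists_koszul_boundary r a f ha
      hf (extendZero K _ (m + 1) fun b => X b i) (extendZero_mem_bounded _) (by
        rw [tate_extendZero]
        intro p
        by_cases hp : hdeg p = m
        · have := extendZero_apply_val (K := K) (tateMap (Algebra.lmul K _) MvPolynomial.X a m
            fun b => X b i) ⟨p, hp⟩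
          rw [this]
          have h3 := congrFun (hcomp i m X) ⟨p, hp⟩
          change _ = tateMap (Algebra.lmul K _) MvPolynomial.X a m (fun b => X b i) ⟨p, hp⟩ at h3
          rw [← h3]
          refine (hΘ0 (tateMap (Algebra.lsmul K K (ι → MvPolynomial (Fin n) K)) MvPolynomial.X a m X
            ⟨p, hp⟩)).1 ?_ i
          have h4 := congrFun (hΘc m X) ⟨p, hp⟩
          have h5 : Θ.compLeft _ X = x := funext hX
          rw [h5, hx] at h4
          exact h4
        · rw [extendZero_apply_of_ne _ hp]
          exact Ideal.zero_mem _)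
    refine ⟨U, fun b => ?_⟩
    have h3 := hU b.1
    -- The constant `c` is supported in homological degree 0 and is invisible in degree `m + 1`.
    rw [Pi.sub_apply, Pi.sub_apply, extendZero_apply_val, hc, sub_zero] at h3
    · exact h3
    · intro h
      have := b.2
      rw [h] at this
      simp [hdeg] at this
  choose U hU using h2
  refine ⟨Θ.compLeft _ fun b i => U i b.1, ?_⟩
  rw [← hΘc]
  ext b
  rw [← hX b]
  refine (sub_eq_zero.1 ?_).symm
  rw [LinearMap.compLeft_apply, Function.comp_apply, ← map_sub, hΘ0]
  intro i
  have h3 := congrFun (hcomp i (m + 1) fun b i => U i b.1) b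
  have h4 := hU i b
  rw [← tateMap_comp_val] at h4
  change tateMap (Algebra.lsmul K K _) MvPolynomial.X a (m + 1) (fun b i => U i b.1) b i = _ at h3
  rw [Pi.sub_apply, h3]
  exact h4

end TateIndex

/-! ## Presentations as complete intersections -/

section WeightedHomogeneous

open MvPolynomial

variable {K : Type*} [Field K] {n : ℕ}

theorem weightedHomogeneousComponent_X_mul (d : Fin n → ℤ) (m : ℤ) (i : Fin n)
    (p : MvPolynomial (Fin n) K) :
    weightedHomogeneousComponent d m (X i * p) =
      X i * weightedHomogeneousComponent d (m - d i) p := by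
  classical
  ext s
  rw [coeff_weightedHomogeneousComponent, coeff_X_mul', coeff_X_mul',
    coeff_weightedHomogeneousComponent]
  by_cases hi : i ∈ s.support
  · have h1 : s = (s - Finsupp.single i 1) + Finsupp.single i 1 := by
      refine (tsub_add_cancel_of_le ?_).symm
      rw [Finsupp.single_le_iff]
      exact Nat.one_le_iff_ne_zero.2 (Finsupp.mem_support_iff.1 hi)
    have h2 : Finsupp.weight d s = Finsupp.weight d (s - Finsupp.single i 1) + d i := by
      conv_lhs => rw [h1, map_add]
      simp [Finsupp.weight_single]
    simp only [hi, if_true, h2, eq_sub_iff_add_eq]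
  · simp [hi]

/-- A homogeneous polynomial without constant and linear terms is a combination of the variables
whose coefficients are homogeneous polynomials without constant term. -/
theorem exists_eq_sum_X_mul (d : Fin n → ℤ) (m : ℤ) (f : MvPolynomial (Fin n) K)
    (hf : IsWeightedHomogeneous d f m)
    (hf2 : f ∈ Ideal.span (Set.range (X (R := K) (σ := Fin n))) ^ 2) :
    ∃ a : Fin n → MvPolynomial (Fin n) K, ∑ i, X i * a i = f ∧
      (∀ i, IsWeightedHomogeneous d (a i) (m - d i)) ∧ ∀ i, constantCoeff (a i) = 0 := by
  classical
  have hX : Ideal.span (Set.range (X (R := K) (σ := Fin n))) ≤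
      RingHom.ker (constantCoeff (R := K) (σ := Fin n)) := by
    rw [Ideal.span_le]
    rintro _ ⟨i, rfl⟩
    simp
  -- Reading the square as an ideal times the span of the variables yields coefficients that lie in
  -- the ideal again. Passing to their homogeneous components keeps the constant terms zero.
  rw [pow_two, ← smul_eq_mul, Submodule.mem_ideal_smul_span_iff_exists_sum] at hf2
  obtain ⟨a, ha, hsum⟩ := hf2
  refine ⟨fun i => weightedHomogeneousComponent d (m - d i) (a i), ?_,
    fun i => weightedHomogeneousComponent_isWeightedHomogeneous _ _, fun i => ?_⟩
  · simp only [← weightedHomogeneousComponent_X_mul]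
    rw [← map_sum]
    have h1 : ∑ i, X i * a i = f := by
      rw [← hsum, Finsupp.sum_fintype _ _ (by simp)]
      exact Finset.sum_congr rfl fun i _ => mul_comm _ _
    rw [h1, hf.weightedHomogeneousComponent_same]
  · have h1 : constantCoeff (a i) = 0 := hX (ha i)
    rw [constantCoeff_eq, coeff_weightedHomogeneousComponent]
    split_ifs
    exacts [h1, rfl]

theorem mem_span_X_of_constantCoeff_eq_zero {p : MvPolynomial (Fin n) K}
    (hp : constantCoeff p = 0) : ∃ a : Fin n → MvPolynomial (Fin n) K, p = ∑ i, a i * X i := by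
  have h1 : p ∈ idealOfVars (Fin n) K := by
    rw [← pow_one (idealOfVars (Fin n) K), mem_pow_idealOfVars_iff']
    intro x hx
    have : x = 0 := (Finsupp.degree_eq_zero_iff x).1 (Nat.lt_one_iff.1 hx)
    rw [this]
    exact hp
  rw [idealOfVars, Ideal.mem_span_range_iff_exists_fun] at h1
  obtain ⟨c, hc⟩ := h1
  exact ⟨c, hc.symm⟩

end WeightedHomogeneous

namespace CIPresentation

open MvPolynomial

variable {K : Type v} {A : Type u} [Field K] [Ring A] [Algebra K A] {𝒜 : ℤ → Submodule K A}
  {S : Subalgebra K A} {n : ℕ} {d e : Fin n → ℤ} (P : CIPresentation 𝒜 S n d e)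

/-- Unfolds regularity modulo an initial segment of the list into the cancellation rule for elements
that `exists_tate_boundary` consumes. -/
theorem mem_span_of_mul_mem_span (j : Fin n) (s : MvPolynomial (Fin n) K)
    (h : P.f j * s ∈ Ideal.span (P.f '' {i | i < j})) :
    s ∈ Ideal.span (P.f '' {i | i < j}) := by
  have h1 := P.regular.regular_mod_prev j (by simp)
  have h2 : (Ideal.ofList ((List.ofFn P.f).take j) • ⊤ :
      Submodule (MvPolynomial (Fin n) K) (MvPolynomial (Fin n) K)) =
      Ideal.span (P.f '' {i | i < j}) := by
    rw [smul_eq_mul, Ideal.mul_top, Ideal.ofList]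
    congr 1
    ext x
    simp only [Set.mem_setOf_eq, Set.mem_image, List.mem_take_iff_getElem, List.getElem_ofFn,
      List.length_ofFn]
    constructor
    · rintro ⟨i, hi, rfl⟩
      exact ⟨⟨i, by omega⟩, by rw [Fin.lt_def]; simp only; omega, rfl⟩
    · rintro ⟨i, hi, rfl⟩
      exact ⟨i, by have := i.2; rw [Fin.lt_def] at hi; omega, rfl⟩
  rw [isSMulRegular_quotient_iff_mem_of_smul_mem, h2] at h1
  refine h1 s ?_
  simpa using h

/-- These are the coefficients of the cycles killed by the divided power variables. Their vanishing
constant terms, which come from `minimal`, are what makes the resolution minimal. -/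
theorem exists_coefficients : ∃ a : Fin n → Fin n → MvPolynomial (Fin n) K,
    (∀ j, ∑ i, X i * a j i = P.f j) ∧
    (∀ j i, IsWeightedHomogeneous d (a j i) (e j - d i)) ∧ ∀ j i, constantCoeff (a j i) = 0 := by
  choose a h1 h2 h3 using fun j => exists_eq_sum_X_mul d (e j) (P.f j) (P.degree_rel j) (P.minimal j)
  exact ⟨a, h1, h2, h3⟩

theorem φ_f (j : Fin n) : P.φ (P.f j) = 0 := by
  have : P.f j ∈ RingHom.ker P.φ := by
    rw [P.ker_eq]
    exact Ideal.subset_span ⟨j, rfl⟩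
  exact this

theorem φ_mem [GradedAlgebra 𝒜] {s : MvPolynomial (Fin n) K} {m : ℤ}
    (hs : IsWeightedHomogeneous d s m) : P.φ s ∈ 𝒜 m := by
  have h1 : ∀ t : Fin n →₀ ℕ, P.φ (monomial t 1) ∈ 𝒜 (Finsupp.weight d t) := by
    intro t
    induction t using Finsupp.induction_linear with
    | zero =>
      rw [map_zero, monomial_zero', C_1, map_one]
      exact SetLike.one_mem_graded 𝒜
    | add t t' h h' =>
      have : monomial (t + t') (1 : K) = monomial t 1 * monomial t' 1 := by
        rw [monomial_mul, one_mul]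
      rw [this, map_mul, map_add]
      exact SetLike.mul_mem_graded h h'
    | single i k =>
      rw [← X_pow_eq_monomial, map_pow, Finsupp.weight_single]
      exact SetLike.pow_mem_graded k (P.degree_gen i)
  rw [s.as_sum, map_sum]
  refine Submodule.sum_mem _ fun t ht => ?_
  have h2 : monomial t (coeff t s) = coeff t s • monomial t 1 := by simp [smul_monomial]
  rw [h2, map_smul, ← hs (mem_support_iff.1 ht)]
  exact Submodule.smul_mem _ _ (h1 t)

end CIPresentation

/-! ## Extension groups and resolutions -/

section ExtNonzero

variable {C : Type*} [Category* C] [Abelian C]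

/-- A nonzero identity that is a sum of maps through other objects. -/
theorem exists_extNonzero_of_sum {ι : Type*} [Fintype ι] {X Y : C} {Z : ι → C}
    (p : ∀ i, X ⟶ Z i) (q : ∀ i, Z i ⟶ X) (h : ∑ i, p i ≫ q i = 𝟙 X) {m : ℕ}
    (hX : ExtNonzero X Y m) : ∃ i, ExtNonzero (Z i) Y m := by
  haveI := HasExt.standard C
  by_contra! hn
  have h0 : ∀ i (x : Abelian.Ext (Z i) Y m), x = 0 := fun i x => by
    by_contra h'
    exact hn i ⟨x, 0, h'⟩
  obtain ⟨x, hx⟩ := @exists_ne (Abelian.Ext X Y m) hX 0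
  apply hx
  rw [← Abelian.Ext.mk₀_id_comp x, ← h, Abelian.Ext.mk₀_sum, Abelian.Ext.sum_comp]
  refine Finset.sum_eq_zero fun i _ => ?_
  rw [← Abelian.Ext.mk₀_comp_mk₀, Abelian.Ext.comp_assoc _ _ x (zero_add 0) (zero_add m) (by omega),
    h0 i ((Abelian.Ext.mk₀ (q i)).comp x _), Abelian.Ext.comp_zero]

theorem ExtNonzero.of_retract_left {X Y Z : C} (i : X ⟶ Z) (p : Z ⟶ X) (h : i ≫ p = 𝟙 X) {m : ℕ}
    (hX : ExtNonzero X Y m) : ExtNonzero Z Y m :=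
  (exists_extNonzero_of_sum (ι := Unit) (Z := fun _ => Z) (fun _ => i) (fun _ => p) (by simpa)
    hX).choose_spec

theorem ExtNonzero.of_retract_right {X Y Z : C} (i : Y ⟶ Z) (p : Z ⟶ Y) (h : i ≫ p = 𝟙 Y) {m : ℕ}
    (hX : ExtNonzero X Y m) : ExtNonzero X Z m := by
  haveI := HasExt.standard C
  by_contra hn
  have h0 : ∀ (x : Abelian.Ext X Z m), x = 0 := fun x => by
    by_contra h'
    exact hn ⟨x, 0, h'⟩
  obtain ⟨x, hx⟩ := @exists_ne (Abelian.Ext X Y m) hX 0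
  apply hx
  rw [← Abelian.Ext.comp_mk₀_id x, ← h, ← Abelian.Ext.mk₀_comp_mk₀,
    ← Abelian.Ext.comp_assoc x _ _ (add_zero m) (zero_add 0) (by omega),
    h0 (x.comp (Abelian.Ext.mk₀ i) _), Abelian.Ext.zero_comp]

theorem extNonzero_zero_iff {X Y : C} : ExtNonzero X Y 0 ↔ ∃ f : X ⟶ Y, f ≠ 0 := by
  haveI := HasExt.standard C
  change Nontrivial (Abelian.Ext X Y 0) ↔ _
  rw [Abelian.Ext.addEquiv₀.toEquiv.nontrivial_congr, nontrivial_iff_exists_ne 0]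

/-- Dimension shifting along a projective object. -/
theorem extNonzero_succ_iff {S : ShortComplex C} (hS : S.ShortExact) [Projective S.X₂] (Y : C)
    (m : ℕ) : ExtNonzero S.X₃ Y (m + 2) ↔ ExtNonzero S.X₁ Y (m + 1) := by
  haveI := HasExt.standard C
  constructor
  · intro h
    obtain ⟨x, hx⟩ := @exists_ne (Abelian.Ext S.X₃ Y (m + 2)) h 0
    obtain ⟨x₁, rfl⟩ := Abelian.Ext.contravariant_sequence_exact₃ hS Y x
      (Abelian.Ext.eq_zero_of_projective _) (n₀ := m + 1) (by omega)
    refine ⟨x₁, 0, ?_⟩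
    rintro rfl
    exact hx (Abelian.Ext.comp_zero _ _ _ _ _)
  · intro h
    obtain ⟨x, hx⟩ := @exists_ne (Abelian.Ext S.X₁ Y (m + 1)) h 0
    refine ⟨hS.extClass.comp x (by omega), 0, fun h0 => ?_⟩
    obtain ⟨x₂, rfl⟩ := Abelian.Ext.contravariant_sequence_exact₁ hS Y x (by omega) h0
    apply hx
    rw [Abelian.Ext.eq_zero_of_projective x₂, Abelian.Ext.comp_zero]

/-- Degree 1 is treated apart from `extNonzero_succ_iff`, since projectivity of the middle term
kills its higher `Ext` but not `Hom`. A class in `Ext¹` comes from a map on the kernel, and is zero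
exactly when that map extends. -/
theorem extNonzero_one_iff {S : ShortComplex C} (hS : S.ShortExact) [Projective S.X₂] (Y : C) :
    ExtNonzero S.X₃ Y 1 ↔ ∃ f : S.X₁ ⟶ Y, ∀ g : S.X₂ ⟶ Y, S.f ≫ g ≠ f := by
  haveI := HasExt.standard C
  constructor
  · intro h
    obtain ⟨x, hx⟩ := @exists_ne (Abelian.Ext S.X₃ Y 1) h 0
    obtain ⟨x₁, rfl⟩ := Abelian.Ext.contravariant_sequence_exact₃ hS Y x
      (Abelian.Ext.eq_zero_of_projective _) (n₀ := 0) (by omega)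
    obtain ⟨f, rfl⟩ := (Abelian.Ext.mk₀_bijective _ _).2 x₁
    refine ⟨f, ?_⟩
    rintro g rfl
    apply hx
    rw [← Abelian.Ext.mk₀_comp_mk₀, ← Abelian.Ext.comp_assoc _ _ _ (add_zero 1) (zero_add 0)
      (by omega),
      hS.extClass_comp, Abelian.Ext.zero_comp]
  · rintro ⟨f, hf⟩
    refine ⟨hS.extClass.comp (Abelian.Ext.mk₀ f) (by omega), 0, fun h0 => ?_⟩
    obtain ⟨x₂, hx⟩ := Abelian.Ext.contravariant_sequence_exact₁ hS Y _ (by omega) h0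
    obtain ⟨g, rfl⟩ := (Abelian.Ext.mk₀_bijective _ _).2 x₂
    rw [Abelian.Ext.mk₀_comp_mk₀] at hx
    exact hf g ((Abelian.Ext.mk₀_bijective _ _).1 hx)

/-- One direction of dimension shifting suffices, since on the costandard side only vanishing is
needed. -/
theorem ExtNonzero.of_injective_succ {S : ShortComplex C} (hS : S.ShortExact) [Injective S.X₂]
    {X : C} {m : ℕ} (h : ExtNonzero X S.X₁ (m + 1)) : ExtNonzero X S.X₃ m := by
  haveI := HasExt.standard C
  obtain ⟨x, hx⟩ := @exists_ne (Abelian.Ext X S.X₁ (m + 1)) h 0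
  obtain ⟨x₁, rfl⟩ := Abelian.Ext.covariant_sequence_exact₁ X hS x
    (Abelian.Ext.eq_zero_of_injective _) (n₀ := m) (by omega)
  refine ⟨x₁, 0, ?_⟩
  rintro rfl
  exact hx (Abelian.Ext.zero_comp _ _ _ _ _)

end ExtNonzero

namespace GrMod

variable {K : Type v} {R : Type u} [Field K] [Ring R] [Algebra K R] {ℛ : ℤ → Submodule K R}

theorem mono_of_injective {M N : GrMod ℛ} (f : M ⟶ N) (hf : Function.Injective f.toLin) :
    Mono f := ⟨fun g h e => by
  ext x
  exact hf (congrArg (fun k : _ ⟶ N => k.toLin x) e)⟩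

theorem epi_of_surjective {M N : GrMod ℛ} (f : M ⟶ N) (hf : Function.Surjective f.toLin) :
    Epi f := ⟨fun g h e => by
  ext x
  obtain ⟨y, rfl⟩ := hf x
  exact congrArg (fun k : M ⟶ _ => k.toLin y) e⟩

/-- The inclusion of the kernel of an epimorphism as a short exact sequence. -/
theorem shortExact_of_surjective {M N : GrMod ℛ} (f : M ⟶ N) (hf : Function.Surjective f.toLin) :
    (ShortComplex.mk (M.subι _ (isGraded_ker f)) f (by ext x; exact x.2)).ShortExact where
  exact := ShortComplex.exact_of_f_is_kernel _ (isLimitKer f)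
  mono_f := mono_of_injective _ Subtype.val_injective
  epi_g := epi_of_surjective _ hf

/-- The projection to the cokernel of a monomorphism as a short exact sequence. -/
theorem shortExact_of_injective {M N : GrMod ℛ} (f : M ⟶ N) (hf : Function.Injective f.toLin) :
    (ShortComplex.mk f (N.quotπ _ (isGraded_range f)) (by
      ext x
      exact (Submodule.Quotient.mk_eq_zero _).2 ⟨x, rfl⟩)).ShortExact where
  exact := ShortComplex.exact_of_g_is_cokernel _ (isColimitCoker f)
  mono_f := mono_of_injective _ hf
  epi_g := epi_of_surjective _ (Submodule.mkQ_surjective _)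

/-- Corestriction of a morphism to a graded submodule. -/
def codRestrict {M N : GrMod ℛ} (f : M ⟶ N) (W : Submodule R N) (hW : N.IsGraded W)
    (h : ∀ x, f.toLin x ∈ W) : M ⟶ N.sub W hW :=
  ⟨f.toLin.codRestrict W h, fun i x hx => f.map_mem i x hx⟩

/-- The morphism from a quotient induced by a morphism. -/
def desc {M N : GrMod ℛ} (f : M ⟶ N) (W : Submodule R M) (hW : M.IsGraded W)
    (h : ∀ x ∈ W, f.toLin x = 0) : M.quot W hW ⟶ N :=
  ⟨W.liftQ f.toLin h, by
    rintro i _ ⟨x, hx, rfl⟩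
    exact f.map_mem i x hx⟩

/-- A morphism vanishing on the kernel of a surjective one factors through it. -/
theorem exists_factor {P M N : GrMod ℛ} (ε : P ⟶ M) (hε : Function.Surjective ε.toLin) (g : P ⟶ N)
    (h : ∀ x, ε.toLin x = 0 → g.toLin x = 0) : ∃ f : M ⟶ N, ε ≫ f = g := by
  have hS := shortExact_of_surjective ε hε
  haveI := hS.epi_g
  exact ⟨hS.exact.desc g (by ext x; exact h _ x.2), hS.exact.g_desc _ _⟩

/-- Extension groups computed from a projective resolution. -/
theorem extNonzero_iff_of_projective_resolution (N : GrMod ℛ) (m : ℕ) :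
    ∀ (P : ℕ → GrMod ℛ) (_ : ∀ m, Projective (P m)) (d : ∀ m, P (m + 1) ⟶ P m)
      (_ : ∀ m x, (d m).toLin x = 0 ↔ ∃ y, (d (m + 1)).toLin y = x)
      (_ : ∀ m (g : P m ⟶ N), d m ≫ g = 0) (M : GrMod ℛ) (ε : P 0 ⟶ M)
      (_ : Function.Surjective ε.toLin) (_ : ∀ x, ε.toLin x = 0 ↔ ∃ y, (d 0).toLin y = x),
      ExtNonzero M N m ↔ ∃ g : P m ⟶ N, g ≠ 0 := by
  induction m with
  | zero =>
    intro P _ d _ hN M ε hε hd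
    haveI := epi_of_surjective ε hε
    rw [extNonzero_zero_iff]
    constructor
    · rintro ⟨f, hf⟩
      exact ⟨ε ≫ f, fun h => hf (by rwa [← cancel_epi ε, comp_zero])⟩
    · rintro ⟨g, hg⟩
      obtain ⟨f, rfl⟩ := exists_factor ε hε g (fun x hx => by
        obtain ⟨y, rfl⟩ := (hd x).1 hx
        exact congrArg (fun k : P 1 ⟶ N => k.toLin y) (hN 0 g))
      exact ⟨f, fun h => hg (by rw [h, comp_zero])⟩
  | succ m ih =>
    intro P hP d hexact hN M ε hε hd
    have hS := shortExact_of_surjective ε hε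
    -- The shifted complex resolves the kernel of `ε`, to which dimension shifting leads.
    let ε' := codRestrict (d 0) _ (isGraded_ker ε) (fun x => (hd _).2 ⟨x, rfl⟩)
    have hε' : Function.Surjective ε'.toLin := fun ⟨x, hx⟩ => by
      obtain ⟨y, rfl⟩ := (hd x).1 hx
      exact ⟨y, rfl⟩
    have hker : ∀ x, ε'.toLin x = 0 ↔ ∃ y, (d 1).toLin y = x := fun x => by
      rw [← hexact]
      exact Subtype.ext_iff
    rcases m with - | m
    -- Since `d 0 ≫ k = 0` for every `k : P 0 ⟶ N`, such a `k` vanishes on the kernel of `ε`. A map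
    -- on the kernel therefore extends only if it is zero.
    · refine (extNonzero_one_iff hS N).trans ⟨?_, ?_⟩
      · rintro ⟨f, hf⟩
        refine ⟨ε' ≫ f, fun h => hf 0 ?_⟩
        haveI := epi_of_surjective ε' hε'
        rw [← cancel_epi ε', h, comp_zero, comp_zero]
      · rintro ⟨g, hg⟩
        obtain ⟨f, rfl⟩ := exists_factor ε' hε' g (fun x hx => by
          obtain ⟨y, rfl⟩ := (hker x).1 hx
          exact congrArg (fun k : P 2 ⟶ N => k.toLin y) (hN 1 g))
        refine ⟨f, ?_⟩
        rintro k rfl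
        exact hg (hN 0 k)
    · refine (extNonzero_succ_iff hS N m).trans ?_
      exact ih (fun m => P (m + 1)) (fun m => hP _) (fun m => d (m + 1)) (fun m => hexact (m + 1))
        (fun m => hN (m + 1)) _ ε' hε' hker

/-- Vanishing of extension groups by means of an injective resolution. -/
theorem not_extNonzero_of_injective_resolution (N : GrMod ℛ) (m : ℕ) :
    ∀ (I : ℕ → GrMod ℛ) (_ : ∀ m, Injective (I m)) (d : ∀ m, I m ⟶ I (m + 1))
      (_ : ∀ m x, (d (m + 1)).toLin x = 0 ↔ ∃ y, (d m).toLin y = x) (M : GrMod ℛ) (η : M ⟶ I 0)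
      (_ : Function.Injective η.toLin) (_ : ∀ x, (d 0).toLin x = 0 ↔ ∃ y, η.toLin y = x)
      (_ : ∀ g : N ⟶ I m, g = 0), ¬ ExtNonzero N M m := by
  induction m with
  | zero =>
    intro I _ d _ M η hη _ hN h
    obtain ⟨f, hf⟩ := extNonzero_zero_iff.1 h
    haveI := mono_of_injective η hη
    exact hf (by rw [← cancel_mono η, hN (f ≫ η), zero_comp])
  | succ m ih =>
    intro I hI d hexact M η hη hd hN h
    have h1 := ExtNonzero.of_injective_succ (shortExact_of_injective η hη) h
    have h0 : ∀ x ∈ LinearMap.range η.toLin, (d 0).toLin x = 0 := fun x hx => (hd x).2 hx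
    refine ih (fun m => I (m + 1)) (fun m => hI _) (fun m => d (m + 1)) (fun m => hexact (m + 1)) _
      (desc (d 0) _ (isGraded_range η) h0) ?_ ?_ hN h1
    · rw [← LinearMap.ker_eq_bot, eq_bot_iff]
      intro x hx
      obtain ⟨y, rfl⟩ := Submodule.mkQ_surjective _ x
      exact (Submodule.Quotient.mk_eq_zero _).2 ((hd y).1 hx)
    · intro x
      refine (hexact 0 x).trans ⟨?_, ?_⟩
      · rintro ⟨y, rfl⟩
        exact ⟨Submodule.Quotient.mk y, rfl⟩
      · rintro ⟨y, rfl⟩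
        obtain ⟨z, rfl⟩ := Submodule.mkQ_surjective _ y
        exact ⟨z, rfl⟩

end GrMod

/-! ## Free and cofree graded modules -/

namespace GrMod

variable {K : Type v} {A : Type u} [Field K] [Ring A] [Algebra K A] [Module.Finite K A]
  (𝒜 : ℤ → Submodule K A) [GradedAlgebra 𝒜]

section Free

variable {β β' : Type} [Fintype β] [Fintype β'] (δ : β → ℤ) (δ' : β' → ℤ)

/-- The graded free module with basis elements of degrees `δ b`. -/
def free : GrMod 𝒜 where
  carrier := β → A
  gr k := Submodule.pi Set.univ fun b => 𝒜 (k - δ b)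
  isInternal := by
    classical
    obtain ⟨p, s, hp₀, hp, hp', -, hs, -⟩ := exists_projections 𝒜
    refine isInternal_of_separating (W := β → A) _ ?_
      (fun k => LinearMap.pi fun b => p (k - δ b) ∘ₗ LinearMap.proj b) ?_ ?_
    · intro x
      rw [← Finset.univ_sum_single x]
      refine Submodule.sum_mem _ fun b _ => ?_
      rw [← hs (x b)]
      have : Pi.single b (∑ i ∈ s, p i (x b)) =
          ∑ i ∈ s, (Pi.single b (p i (x b)) : β → A) :=
        map_sum (LinearMap.single K (fun _ => A) b) _ _
      rw [this]
      refine Submodule.sum_mem _ fun i _ => Submodule.mem_iSup_of_mem (i + δ b) ?_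
      intro b' _
      by_cases h : b' = b
      · subst h
        change (Pi.single b' (p i (x b')) : β → A) b' ∈ 𝒜 (i + δ b' - δ b')
        rw [Pi.single_eq_same, add_sub_cancel_right]
        exact hp₀ _ _
      · rw [Pi.single_eq_of_ne h]
        exact Submodule.zero_mem _
    · intro i j x hx hij
      ext b
      exact hp' _ _ _ (hx b trivial) (by omega)
    · intro i x hx h0
      ext b
      have := congrFun h0 b
      exact (hp _ _ (hx b trivial)).symm.trans this
  smul_mem := by
    intro i j r x hr hx b _
    have := SetLike.mul_mem_graded hr (hx b trivial)
    rwa [← add_sub_assoc] at this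

variable {𝒜 δ δ'}

theorem mem_free_gr {k : ℤ} {x : β → A} :
    (x : free 𝒜 δ) ∈ (free 𝒜 δ).gr k ↔ ∀ b, x b ∈ 𝒜 (k - δ b) :=
  ⟨fun h b => h b trivial, fun h b _ => h b⟩

theorem single_mem_free_gr [DecidableEq β] (b : β) {i : ℤ} {a : A} (ha : a ∈ 𝒜 i) :
    (Pi.single b a : β → A) ∈ (((free 𝒜 δ).gr (i + δ b) : Submodule K (free 𝒜 δ)) :
      Set (free 𝒜 δ)) := by
  refine mem_free_gr.2 fun b' => ?_
  by_cases h : b' = b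
  · subst h
    rw [Pi.single_eq_same, add_sub_cancel_right]
    exact ha
  · rw [Pi.single_eq_of_ne h]
    exact Submodule.zero_mem _

/-- The morphism from a graded free module with prescribed values on the basis. -/
def freeLift {M : GrMod 𝒜} (y : β → M) (hy : ∀ b, y b ∈ M.gr (δ b)) : free 𝒜 δ ⟶ M where
  toLin :=
    { toFun := fun x : β → A => ∑ b, x b • y b
      map_add' := fun x x' => by
        rw [← Finset.sum_add_distrib]
        exact Finset.sum_congr rfl fun b _ => add_smul _ _ _
      map_smul' := fun r x => by
        rw [RingHom.id_apply, Finset.smul_sum]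
        exact Finset.sum_congr rfl fun b _ => mul_smul _ _ _ }
  map_mem i x hx := by
    refine Submodule.sum_mem _ fun b _ => ?_
    have := M.smul_mem (mem_free_gr.1 hx b) (hy b)
    rwa [sub_add_cancel] at this

theorem freeLift_single [DecidableEq β] {M : GrMod 𝒜} (y : β → M)
    (hy : ∀ b, y b ∈ M.gr (δ b)) (b : β) (a : A) :
    (freeLift y hy).toLin (Pi.single b a : β → A) = a • y b := by
  change ∑ b', (Pi.single b a : β → A) b' • y b' = _
  rw [Finset.sum_eq_single_of_mem b (Finset.mem_univ b), Pi.single_eq_same]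
  intro b' _ h
  rw [Pi.single_eq_of_ne h, zero_smul]

theorem free_hom_apply [DecidableEq β] {M : GrMod 𝒜} (f : free 𝒜 δ ⟶ M) (x : β → A) :
    f.toLin x = ∑ b, x b • f.toLin (Pi.single b 1 : β → A) := by
  conv_lhs => rw [← Finset.univ_sum_single x]
  refine (map_sum f.toLin _ _).trans (Finset.sum_congr rfl fun b _ => ?_)
  have h1 : (Pi.single b (x b) : β → A) = x b • (Pi.single b 1 : β → A) := by
    rw [← Pi.single_smul, smul_eq_mul, mul_one]
  exact (congrArg f.toLin h1).trans (f.toLin.map_smul (x b) _)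

theorem free_hom_ext [DecidableEq β] {M : GrMod 𝒜} {f g : free 𝒜 δ ⟶ M}
    (h : ∀ b, f.toLin (Pi.single b 1 : β → A) = g.toLin (Pi.single b 1 : β → A)) : f = g := by
  ext x
  refine (free_hom_apply f x).trans (Eq.trans ?_ (free_hom_apply g x).symm)
  exact Finset.sum_congr rfl fun b _ => congrArg _ (h b)

/-- The images of the homogeneous basis elements lift to homogeneous elements of the same degrees,
by `exists_preimage_mem`. -/
instance : Projective (free 𝒜 δ) where
  factors {E X} f e _ := by
    classical
    have hf : ∀ b, f.toLin (Pi.single b 1 : β → A) ∈ X.gr (δ b) := fun b => by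
      have := single_mem_free_gr (δ := δ) b (SetLike.one_mem_graded 𝒜)
      rw [zero_add] at this
      exact f.map_mem _ _ this
    choose y hy hy' using fun b => exists_preimage_mem e (surjective_of_epi e) (hf b)
    refine ⟨freeLift y hy, free_hom_ext fun b => ?_⟩
    rw [← hy' b]
    refine congrArg e.toLin ((freeLift_single y hy b 1).trans (one_smul _ _))

/-- The value at the basis element `b` may be any element of degree `δ b`, and these values
determine the map. -/
theorem exists_free_hom_ne_zero_iff {N : GrMod 𝒜} {l : ℤ} (hN : N.IsConcentratedIn l)
    [Nontrivial N] : (∃ g : free 𝒜 δ ⟶ N, g ≠ 0) ↔ ∃ b, δ b = l := by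
  classical
  constructor
  · rintro ⟨g, hg⟩
    by_contra! h
    refine hg (free_hom_ext fun b => ?_)
    have := single_mem_free_gr (δ := δ) b (SetLike.one_mem_graded 𝒜)
    rw [zero_add] at this
    have h1 := N.comp_of_mem (g.map_mem _ _ this)
    have h2 : g.toLin (Pi.single b 1 : β → A) ∈ N.gr l := by rw [hN]; trivial
    rw [N.comp_of_ne h2 (h b).symm] at h1
    exact h1.symm
  · rintro ⟨b, rfl⟩
    obtain ⟨x, hx⟩ := exists_ne (0 : N)
    have hx' : x ∈ N.gr (δ b) := by rw [hN]; trivial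
    refine ⟨freeLift (Pi.single b x) fun b' => ?_, fun h => hx ?_⟩
    · by_cases h : b' = b
      · subst h
        rwa [Pi.single_eq_same]
      · rw [Pi.single_eq_of_ne h]
        exact Submodule.zero_mem _
    · have h1 := freeLift_single (M := N) (δ := δ) (Pi.single b x) (by
        intro b'
        by_cases h : b' = b
        · subst h
          rwa [Pi.single_eq_same]
        · rw [Pi.single_eq_of_ne h]
          exact Submodule.zero_mem _) b 1
      rw [h, Pi.single_eq_same, one_smul] at h1
      exact h1.symm

end Free

end GrMod

/-- The space of linear maps from a free right module to a vector space. -/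
def CofreeModule (K : Type v) (A : Type u) (β : Type) (W : Type u) [Field K] [Ring A] [Algebra K A]
    [AddCommGroup W] [Module K W] : Type u := (β → A) →ₗ[K] W

namespace CofreeModule

variable {K : Type v} {A : Type u} {β : Type} {W : Type u} [Field K] [Ring A] [Algebra K A]
  [AddCommGroup W] [Module K W]

instance : AddCommGroup (CofreeModule K A β W) := inferInstanceAs (AddCommGroup ((β → A) →ₗ[K] W))
instance : Module K (CofreeModule K A β W) := inferInstanceAs (Module K ((β → A) →ₗ[K] W))
instance [Finite β] [Module.Finite K A] [Module.Finite K W] :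
    Module.Finite K (CofreeModule K A β W) :=
  inferInstanceAs (Module.Finite K ((β → A) →ₗ[K] W))

/-- The underlying linear map. -/
def toLin (H : CofreeModule K A β W) : (β → A) →ₗ[K] W := H

@[ext]
theorem ext {H H' : CofreeModule K A β W} (h : ∀ x, H.toLin x = H'.toLin x) : H = H' :=
  LinearMap.ext h

/-- The action of `A` on maps: `(a h)(x) = h(x a)`. -/
instance : SMul A (CofreeModule K A β W) := ⟨fun r H => H.toLin ∘ₗ (LinearMap.mulRight K r).compLeft β⟩

theorem smul_apply (r : A) (H : CofreeModule K A β W) (x : β → A) :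
    (r • H).toLin x = H.toLin fun b => x b * r := rfl

theorem add_apply (H H' : CofreeModule K A β W) (x : β → A) :
    (H + H').toLin x = H.toLin x + H'.toLin x := rfl

theorem zero_apply (x : β → A) : (0 : CofreeModule K A β W).toLin x = 0 := rfl

instance : Module A (CofreeModule K A β W) where
  one_smul H := by ext x; simp only [smul_apply, mul_one]
  mul_smul r s H := by ext x; simp only [smul_apply, mul_assoc]
  smul_zero r := rfl
  smul_add r H H' := rfl
  add_smul r s H := by
    ext x
    rw [smul_apply, add_apply, smul_apply, smul_apply, ← map_add]
    congr 1
    ext b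
    exact mul_add _ _ _
  zero_smul H := by
    ext x
    rw [smul_apply, zero_apply]
    simp only [mul_zero]
    exact map_zero H.toLin

instance : IsScalarTower K A (CofreeModule K A β W) where
  smul_assoc c r H := by
    ext x
    change H.toLin (fun b => x b * c • r) = c • H.toLin (fun b => x b * r)
    rw [← map_smul]
    congr 1
    ext b
    exact mul_smul_comm _ _ _

end CofreeModule

namespace GrMod

variable {K : Type v} {A : Type u} [Field K] [Ring A] [Algebra K A] [Module.Finite K A]
  (𝒜 : ℤ → Submodule K A) [GradedAlgebra 𝒜]

section Cofree

variable {β β' : Type} [Fintype β] [Fintype β'] (δ : β → ℤ) (δ' : β' → ℤ) (k : ℤ)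
  (W : Type u) [AddCommGroup W] [Module K W] [Module.Finite K W]

/-- The graded cofree module: the maps from a free right module to a vector space placed in
degree `k`. -/
def cofree : GrMod 𝒜 where
  carrier := CofreeModule K A β W
  gr i :=
    { carrier := {H | ∀ j, i + j ≠ k → ∀ x : β → A, (∀ b, x b ∈ 𝒜 (j - δ b)) → H.toLin x = 0}
      add_mem' := fun h h' j hj x hx => by
        rw [CofreeModule.add_apply, h j hj x hx, h' j hj x hx, add_zero]
      zero_mem' := fun _ _ _ _ => rfl
      smul_mem' := fun c H h j hj x hx => by
        change c • H.toLin x = 0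
        rw [h j hj x hx, smul_zero] }
  isInternal := by
    obtain ⟨s, -, hs⟩ := (free 𝒜 δ).exists_sum_comp
    refine isInternal_of_separating (W := (β → A) →ₗ[K] W) _ ?_
      (fun i => LinearMap.lcomp K W ((free 𝒜 δ).comp (k - i))) ?_ ?_
    · intro H
      have hsum : H = ∑ j ∈ s, (H.toLin ∘ₗ (free 𝒜 δ).comp j : CofreeModule K A β W) := by
        refine LinearMap.ext fun x => ?_
        refine Eq.trans ?_ (LinearMap.sum_apply s (fun j => H.toLin ∘ₗ (free 𝒜 δ).comp j) x).symm
        exact (congrArg H.toLin (hs x)).symm.trans (map_sum H.toLin _ _)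
      rw [hsum]
      refine Submodule.sum_mem _ fun j _ => Submodule.mem_iSup_of_mem (k - j) ?_
      intro j' hj' x hx
      have h1 := (free 𝒜 δ).comp_of_ne (mem_free_gr.2 hx) (show j' ≠ j by omega)
      exact (congrArg H.toLin h1).trans (map_zero H.toLin)
    · intro i i' H hH hi
      refine LinearMap.ext fun x => ?_
      exact hH (k - i') (by omega) _ (mem_free_gr.1 ((free 𝒜 δ).comp_mem _ _))
    · intro i H hH h0
      refine (free 𝒜 δ).linearMap_ext (f := H.toLin) (g := 0) fun j x hx => ?_
      by_cases hj : i + j = k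
      · have h1 := LinearMap.congr_fun h0 x
        change H.toLin ((free 𝒜 δ).comp (k - i) x) = 0 at h1
        have : k - i = j := by omega
        rw [this, (free 𝒜 δ).comp_of_mem hx] at h1
        exact h1
      · exact hH j hj x (mem_free_gr.1 hx)
  smul_mem := by
    intro i j r H hr hH l hl x hx
    refine hH (l + i) (by omega) (fun b => x b * r) fun b => ?_
    have := SetLike.mul_mem_graded (hx b) hr
    rwa [← add_sub_right_comm] at this

variable {𝒜 δ δ' k W}

/-- The morphism to a graded cofree module with prescribed components. -/
def cofreeLift {M : GrMod 𝒜} (γ : β → M →ₗ[K] W)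
    (hγ : ∀ b i y, y ∈ M.gr i → i + δ b ≠ k → γ b y = 0) : M ⟶ cofree 𝒜 δ k W where
  toLin :=
    { toFun := fun y =>
        (∑ b, γ b ∘ₗ (LinearMap.toSpanSingleton A M y).restrictScalars K ∘ₗ LinearMap.proj b :
          (β → A) →ₗ[K] W)
      map_add' := fun y y' => by
        refine LinearMap.ext fun x => ?_
        refine Eq.trans ?_ (LinearMap.add_apply _ _ _).symm
        simp only [LinearMap.sum_apply, ← Finset.sum_add_distrib]
        refine Finset.sum_congr rfl fun b _ => ?_
        simp
      map_smul' := fun r y => by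
        refine LinearMap.ext fun x => ?_
        change _ = (∑ b, γ b ∘ₗ (LinearMap.toSpanSingleton A M y).restrictScalars K ∘ₗ
          LinearMap.proj b : (β → A) →ₗ[K] W) fun b => x b * r
        simp only [LinearMap.sum_apply]
        refine Finset.sum_congr rfl fun b _ => ?_
        simp [mul_smul] }
  map_mem i y hy := by
    intro j hj x hx
    change (∑ b, γ b ∘ₗ (LinearMap.toSpanSingleton A M y).restrictScalars K ∘ₗ LinearMap.proj b :
          (β → A) →ₗ[K] W) x = 0
    rw [LinearMap.sum_apply]
    refine Finset.sum_eq_zero fun b _ => ?_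
    exact hγ b (j - δ b + i) _ (M.smul_mem (hx b) hy) (by omega)

theorem cofreeLift_apply {M : GrMod 𝒜} (γ : β → M →ₗ[K] W)
    (hγ : ∀ b i y, y ∈ M.gr i → i + δ b ≠ k → γ b y = 0) (y : M) (x : β → A) :
    CofreeModule.toLin ((cofreeLift γ hγ).toLin y) x = ∑ b, γ b (x b • y) :=
  LinearMap.sum_apply _ _ _

theorem cofree_hom_apply [DecidableEq β] {M : GrMod 𝒜} (g : M ⟶ cofree 𝒜 δ k W) (y : M)
    (x : β → A) : CofreeModule.toLin (g.toLin y) x =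
      ∑ b, CofreeModule.toLin (g.toLin (x b • y)) (Pi.single b 1) := by
  conv_lhs => rw [← Finset.univ_sum_single x]
  rw [map_sum]
  refine Finset.sum_congr rfl fun b _ => ?_
  have h1 : g.toLin (x b • y) = x b • g.toLin y := g.toLin.map_smul _ _
  rw [h1]
  refine Eq.trans ?_ (CofreeModule.smul_apply (x b) (g.toLin y) (Pi.single b 1)).symm
  congr 1
  ext b'
  by_cases h : b' = b
  · subst h
    simp
  · simp [h]

theorem cofree_hom_single_eq_zero [DecidableEq β] {M : GrMod 𝒜} (g : M ⟶ cofree 𝒜 δ k W) {i : ℤ}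
    {y : M} (hy : y ∈ M.gr i) {b : β} (h : i + δ b ≠ k) :
    CofreeModule.toLin (g.toLin y) (Pi.single b 1) = 0 := by
  have h1 := single_mem_free_gr (δ := δ) b (SetLike.one_mem_graded 𝒜)
  rw [zero_add] at h1
  exact g.map_mem i y hy (δ b) h _ (mem_free_gr.1 h1)

/-- A map into a cofree module amounts to the linear maps obtained by evaluation at the basis
vectors. These extend along a linear retraction, and composing with the projection to degree `k - δ
b` restores homogeneity. -/
instance : Injective (cofree 𝒜 δ k W) where
  factors {X Y} g f _ := by
    classical
    obtain ⟨r, hr⟩ := LinearMap.exists_leftInverse_of_injective (f.toLin.restrictScalars K)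
      (LinearMap.ker_eq_bot.2 (injective_of_mono f))
    let ev : β → X →ₗ[K] W := fun b =>
      { toFun := fun y => CofreeModule.toLin (g.toLin y) (Pi.single b 1)
        map_add' := fun y y' => by rw [map_add]; rfl
        map_smul' := fun c y => by
          have : g.toLin (c • y) = c • g.toLin y := (g.toLin.restrictScalars K).map_smul c y
          rw [this]; rfl }
    have hγ : ∀ b i y, y ∈ Y.gr i → i + δ b ≠ k → (ev b ∘ₗ r ∘ₗ Y.comp (k - δ b)) y = 0 := by
      intro b i y hy h
      rw [LinearMap.comp_apply, LinearMap.comp_apply, Y.comp_of_ne hy (by omega), map_zero, map_zero]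
    refine ⟨cofreeLift _ hγ, ?_⟩
    · ext y
      refine CofreeModule.ext fun x => ?_
      refine (cofreeLift_apply _ hγ (f.toLin y) x).trans ?_
      rw [cofree_hom_apply]
      refine Finset.sum_congr rfl fun b _ => ?_
      have h1 : x b • f.toLin y = f.toLin (x b • y) := (f.toLin.map_smul _ _).symm
      rw [h1, LinearMap.comp_apply, LinearMap.comp_apply, Hom.comp_apply]
      have h2 : r (f.toLin (X.comp (k - δ b) (x b • y))) = X.comp (k - δ b) (x b • y) :=
        LinearMap.congr_fun hr _
      rw [h2]
      have h3 : ev b ∘ₗ X.comp (k - δ b) = ev b := X.linearMap_ext fun i z hz => by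
        rw [LinearMap.comp_apply]
        by_cases hi : i + δ b = k
        · have : k - δ b = i := by omega
          rw [this, X.comp_of_mem hz]
        · rw [X.comp_of_ne hz (by omega), map_zero]
          exact (cofree_hom_single_eq_zero g hz hi).symm
      exact LinearMap.congr_fun h3 _

/-- Evaluation at the basis vector `b` only sees elements of degree `k - δ b`, and `N` has none
besides zero. -/
theorem cofree_hom_eq_zero {N : GrMod 𝒜} {l : ℤ} (hN : N.IsConcentratedIn l)
    (h : ∀ b, l + δ b ≠ k) (g : N ⟶ cofree 𝒜 δ k W) : g = 0 := by
  classical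
  ext y
  refine CofreeModule.ext fun x => ?_
  rw [cofree_hom_apply]
  refine Finset.sum_eq_zero fun b _ => ?_
  have : x b • y ∈ N.gr l := by rw [hN]; trivial
  exact cofree_hom_single_eq_zero g this (h b)

/-- The morphism between cofree modules induced by a homogeneous map between free right modules. -/
def cofreeMap (W : Type u) [AddCommGroup W] [Module K W] [Module.Finite K W] (k : ℤ)
    (T : (β' → A) →ₗ[K] (β → A)) (hT : ∀ x r, T (fun b => x b * r) = fun b => T x b * r)
    (hgr : ∀ i (x : β' → A), (∀ b, x b ∈ 𝒜 (i - δ' b)) → ∀ b, T x b ∈ 𝒜 (i - δ b)) :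
    cofree 𝒜 δ k W ⟶ cofree 𝒜 δ' k W where
  toLin :=
    { toFun := fun H => (CofreeModule.toLin H ∘ₗ T : (β' → A) →ₗ[K] W)
      map_add' := fun _ _ => rfl
      map_smul' := fun r H => LinearMap.ext fun x => congrArg (CofreeModule.toLin H) (hT x r).symm }
  map_mem i H hH j hj x hx := hH j hj _ (hgr j x hx)

end Cofree

end GrMod

/-- Exactness of the dual of an exact sequence of vector spaces. -/
theorem exists_comp_eq_iff_of_exact {K V V' V'' W : Type*} [Field K] [AddCommGroup V] [Module K V]
    [AddCommGroup V'] [Module K V'] [AddCommGroup V''] [Module K V''] [AddCommGroup W] [Module K W]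
    (T' : V'' →ₗ[K] V') (T : V' →ₗ[K] V) (h : ∀ x, T x = 0 ↔ ∃ y, T' y = x) (H : V' →ₗ[K] W) :
    H ∘ₗ T' = 0 ↔ ∃ G : V →ₗ[K] W, G ∘ₗ T = H := by
  constructor
  · intro hH
    obtain ⟨s, hs⟩ := T.rangeRestrict.exists_rightInverse_of_surjective T.range_rangeRestrict
    -- `H ∘ₗ s` is the map induced by `H` on the range of `T`; the choice of section is harmless
    -- because `H` kills the kernel of `T`.
    obtain ⟨G, hG⟩ := (H ∘ₗ s).exists_extend
    refine ⟨G, LinearMap.ext fun x => ?_⟩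
    have h1 : G (T x) = H (s ⟨T x, ⟨x, rfl⟩⟩) := LinearMap.congr_fun hG ⟨T x, ⟨x, rfl⟩⟩
    rw [LinearMap.comp_apply, h1, ← sub_eq_zero, ← map_sub]
    have h2 : T (s ⟨T x, ⟨x, rfl⟩⟩ - x) = 0 := by
      rw [map_sub, sub_eq_zero]
      exact congrArg Subtype.val (LinearMap.congr_fun hs ⟨T x, ⟨x, rfl⟩⟩)
    obtain ⟨y, hy⟩ := (h _).1 h2
    rw [← hy]
    exact LinearMap.congr_fun hH y
  · rintro ⟨G, rfl⟩
    refine LinearMap.ext fun y => ?_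
    have : T (T' y) = 0 := (h _).2 ⟨y, rfl⟩
    rw [LinearMap.comp_apply, LinearMap.comp_apply, this, map_zero]
    rfl

/-! ## The internal degree of the Tate resolution -/

namespace TateIndex

variable {n r : ℕ} (w : Fin n → ℤ) (e : Fin r → ℤ)

/-- The internal degree of a basis element. -/
def ideg (p : TateIndex n r) : ℤ := ∑ i ∈ p.1, w i + ∑ j, (p.2 j : ℤ) * e j

theorem ideg_insert {i : Fin n} {p : TateIndex n r} (h : i ∉ p.1) :
    ideg w e ((insert i p.1, p.2) : TateIndex n r) = ideg w e p + w i := by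
  simp only [ideg, Finset.sum_insert h]
  ring

/-- The increment `e j - w i` is the degree of the coefficient `a j i`, which makes the differential
homogeneous. -/
theorem ideg_erase {i : Fin n} {p : TateIndex n r} (h : i ∈ p.1) (j : Fin r) :
    ideg w e ((p.1.erase i, p.2 + Pi.single j 1) : TateIndex n r) = ideg w e p + (e j - w i) := by
  have h1 := Finset.sum_erase_add p.1 w h
  have h2 : ∑ j', ((p.2 + Pi.single j 1 : Fin r → ℕ) j' : ℤ) * e j' =
      ∑ j', (p.2 j' : ℤ) * e j' + e j := by
    have h3 : ∀ j', ((p.2 + Pi.single j 1 : Fin r → ℕ) j' : ℤ) * e j' =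
        (p.2 j' : ℤ) * e j' + if j' = j then e j else 0 := by
      intro j'
      by_cases hj : j' = j
      · subst hj
        simp [add_mul]
      · simp [hj]
    simp only [h3, Finset.sum_add_distrib, Finset.sum_ite_eq', Finset.mem_univ, if_true]
  simp only [ideg]
  rw [h2, ← h1]
  ring

theorem ideg_unit : ideg w e (Basis.unit n r).1 = 0 := by simp [ideg, Basis.unit]

theorem ideg_ext (i : Fin n) : ideg w e (Basis.ext r i).1 = w i := by simp [ideg, Basis.ext]

theorem ideg_div (j : Fin r) : ideg w e (Basis.div n j).1 = e j := by
  have h : ∀ j', ((Pi.single j 1 : Fin r → ℕ) j' : ℤ) * e j' = if j' = j then e j else 0 := by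
    intro j'
    by_cases hj : j' = j
    · subst hj
      simp
    · simp [hj]
  simp only [ideg, Basis.div, Finset.sum_empty, zero_add, h, Finset.sum_ite_eq', Finset.mem_univ,
    if_true]

/-- Exterior variables have homological degree 1 and odd internal degree, divided power variables
homological degree 2 and even internal degree; both degrees are additive. -/
theorem hdeg_modEq_ideg (hw : ∀ i, Odd (w i)) (he : ∀ j, Even (e j)) (p : TateIndex n r) :
    (hdeg p : ℤ) ≡ ideg w e p [ZMOD 2] := by
  simp only [hdeg, ideg, Nat.cast_add, Nat.cast_mul]
  refine Int.ModEq.add ?_ ?_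
  · rw [Finset.card_eq_sum_ones, Nat.cast_sum]
    refine Int.ModEq.sum fun i _ => ?_
    exact (Int.odd_iff.1 (hw i)).symm
  · have h1 : (2 : ℤ) ∣ ∑ j, (p.2 j : ℤ) * e j :=
      Finset.dvd_sum fun j _ => Dvd.dvd.mul_left (even_iff_two_dvd.1 (he j)) _
    refine (Int.modEq_zero_iff_dvd.2 ?_).trans (Int.modEq_zero_iff_dvd.2 h1).symm
    exact Dvd.intro _ rfl

variable {w e}

/-- The differential of the Tate resolution is homogeneous. -/
theorem tateMap_mem {K : Type*} [Field K] {S : Type*} [CommRing S] [Algebra K S]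
    {N : Type*} [AddCommGroup N] [Module K N] {ρ : S →ₐ[K] Module.End K N} {y : Fin n → S}
    {a : Fin r → Fin n → S} (gr : ℤ → Submodule K N)
    (hy : ∀ i k x, x ∈ gr k → ρ (y i) x ∈ gr (k + w i))
    (ha : ∀ j i k x, x ∈ gr k → ρ (a j i) x ∈ gr (k + (e j - w i))) {m : ℕ} {k : ℤ}
    {x : Basis n r (m + 1) → N} (hx : ∀ b, x b ∈ gr (k - ideg w e b.1)) (b : Basis n r m) :
    tateMap ρ y a m x b ∈ gr (k - ideg w e b.1) := by
  rw [tateMap_apply]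
  refine Submodule.add_mem _ (Submodule.sum_mem _ fun i _ => ?_)
    (Submodule.sum_mem _ fun j _ => Submodule.sum_mem _ fun i _ => ?_)
  · split_ifs with h
    · exact Submodule.zero_mem _
    · refine zsmul_mem ?_ _
      have h1 := hy i _ _ (hx ⟨(insert i b.1.1, b.1.2), by rw [hdeg_insert h, b.2]⟩)
      rw [ideg_insert w e h, sub_add_eq_sub_sub, sub_add_cancel] at h1
      exact h1
  · split_ifs with h
    · refine zsmul_mem ?_ _
      have h1 := ha j i _ _ (hx ⟨(b.1.1.erase i, b.1.2 + Pi.single j 1), by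
        rw [hdeg_erase h, b.2]⟩)
      rw [ideg_erase w e h, sub_add_eq_sub_sub, sub_add_cancel] at h1
      exact h1
    · exact Submodule.zero_mem _

end TateIndex

/-! ## Freeness of `A` over `A⁺` and `A⁻` -/

namespace CIPresentation

open MvPolynomial

variable {K : Type v} {A : Type u} [Field K] [Ring A] [Algebra K A] {𝒜 : ℤ → Submodule K A}
  {S : Subalgebra K A} {n : ℕ} {d e : Fin n → ℤ} (P : CIPresentation 𝒜 S n d e)

/-- The left action of the polynomial ring on `A`. -/
noncomputable def leftAct : MvPolynomial (Fin n) K →ₐ[K] Module.End K A :=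
  (Algebra.lmul K A).comp P.φ

/-- The right action of the polynomial ring on `A`. -/
noncomputable def rightAct : MvPolynomial (Fin n) K →ₐ[K] Module.End K A :=
  AlgHom.ofLinearMap ((LinearMap.mul K A).flip ∘ₗ P.φ.toLinearMap)
    -- Right multiplication reverses products; commutativity of the polynomial ring turns this into
    -- a homomorphism.
    (by ext x; simp) (fun s t => by ext x; rw [mul_comm s t]; simp [mul_assoc])

theorem leftAct_apply (s : MvPolynomial (Fin n) K) (x : A) : P.leftAct s x = P.φ s * x := rfl

theorem rightAct_apply (s : MvPolynomial (Fin n) K) (x : A) : P.rightAct s x = x * P.φ s := rfl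

theorem φ_mem_subalgebra (s : MvPolynomial (Fin n) K) : P.φ s ∈ S := by
  exact P.range_eq.le ⟨s, rfl⟩

/-- A linear surjection from a free module over the polynomial ring, for a subalgebra over
which `A` is free. -/
theorem exists_presentation {V : Type*} [AddCommGroup V] [Module K V] [Module.Finite K V]
    (ψ : V ⊗[K] S ≃ₗ[K] A) (ρ : MvPolynomial (Fin n) K →ₐ[K] Module.End K A)
    (hρ : ∀ v s t, ψ (v ⊗ₜ (⟨P.φ (s * t), P.φ_mem_subalgebra _⟩)) =
      ρ s (ψ (v ⊗ₜ ⟨P.φ t, P.φ_mem_subalgebra _⟩))) :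
    ∃ (ι : Type) (Θ : (ι → MvPolynomial (Fin n) K) →ₗ[K] A), Function.Surjective Θ ∧
      (∀ s x, Θ (s • x) = ρ s (Θ x)) ∧
      ∀ x, Θ x = 0 ↔ ∀ i, x i ∈ Ideal.span (Set.range P.f) := by
  classical
  let b := Module.finBasis K V
  let φ' : MvPolynomial (Fin n) K →ₗ[K] S :=
    P.φ.toLinearMap.codRestrict (Subalgebra.toSubmodule S) P.φ_mem_subalgebra
  have hφ' : Function.Surjective φ' := fun x => by
    have h1 : (x : A) ∈ P.φ.range := by rw [P.range_eq]; exact x.2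
    obtain ⟨s, hs⟩ := h1
    exact ⟨s, Subtype.ext hs⟩
  -- A basis of `V` identifies `A` with tuples over `S`. Lifting the entries along `P.φ` gives a
  -- presentation whose kernel is computed entrywise.
  let E : (Fin (Module.finrank K V) → S) ≃ₗ[K] A :=
    (Finsupp.linearEquivFunOnFinite K S _).symm ≪≫ₗ
      (TensorProduct.equivFinsuppOfBasisLeft b).symm ≪≫ₗ ψ
  have hE : ∀ x, E x = ∑ i, ψ (b i ⊗ₜ x i) := by
    intro x
    change ψ ((TensorProduct.equivFinsuppOfBasisLeft b).symm _) = _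
    rw [TensorProduct.equivFinsuppOfBasisLeft_symm_apply, Finsupp.sum_fintype _ _ (by simp),
      map_sum]
    rfl
  refine ⟨_, E.toLinearMap ∘ₗ φ'.compLeft _, ?_, ?_, ?_⟩
  · exact E.surjective.comp fun x => by
      choose y hy using fun i => hφ' (x i)
      exact ⟨y, funext hy⟩
  · intro s x
    simp only [LinearMap.comp_apply, LinearEquiv.coe_coe, hE, map_sum]
    exact Finset.sum_congr rfl fun i _ => hρ (b i) s (x i)
  · intro x
    simp only [LinearMap.comp_apply, LinearEquiv.coe_coe, LinearEquiv.map_eq_zero_iff]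
    rw [funext_iff, ← P.ker_eq]
    refine forall_congr' fun i => ?_
    exact Subtype.ext_iff

end CIPresentation

namespace TriangularDecomposition

variable {K : Type v} {A : Type u} [Field K] [Ring A] [Algebra K A] [Module.Finite K A]
  {𝒜 : ℤ → Submodule K A} [GradedAlgebra 𝒜] (D : TriangularDecomposition 𝒜)
  {n : ℕ} {d e : Fin n → ℤ}

/-- The triangular decomposition makes `A` the free right `A⁺`-module on `A⁻ ⊗ T`. -/
theorem exists_presentation_right (P : CIPresentation 𝒜 D.Apos n d e) :
    ∃ (ι : Type) (Θ : (ι → MvPolynomial (Fin n) K) →ₗ[K] A), Function.Surjective Θ ∧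
      (∀ s x, Θ (s • x) = P.rightAct s (Θ x)) ∧
      ∀ x, Θ x = 0 ↔ ∀ i, x i ∈ Ideal.span (Set.range P.f) := by
  obtain ⟨ψ, hψ⟩ : ∃ ψ : (D.Aneg ⊗[K] D.T) ⊗[K] D.Apos ≃ₗ[K] A, ∀ v z, ψ (v ⊗ₜ z) =
      LinearMap.mul' K A (TensorProduct.map D.Aneg.val.toLinearMap D.T.val.toLinearMap v) * z :=
    ⟨LinearEquiv.ofBijective _ D.bijective_mul, fun _ _ => rfl⟩
  refine P.exists_presentation ψ _ fun v s t => ?_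
  rw [P.rightAct_apply, hψ, hψ]
  simp only [map_mul]
  rw [mul_assoc, ← map_mul, ← map_mul, mul_comm s t]

/-- With the tensor factors regrouped as `A⁻ ⊗ (T ⊗ A⁺)`, the same decomposition makes `A` a free
left `A⁻`-module. -/
theorem exists_presentation_left (P : CIPresentation 𝒜 D.Aneg n d e) :
    ∃ (ι : Type) (Θ : (ι → MvPolynomial (Fin n) K) →ₗ[K] A), Function.Surjective Θ ∧
      (∀ s x, Θ (s • x) = P.leftAct s (Θ x)) ∧
      ∀ x, Θ x = 0 ↔ ∀ i, x i ∈ Ideal.span (Set.range P.f) := by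
  obtain ⟨ψ, hψ⟩ : ∃ ψ : (D.T ⊗[K] D.Apos) ⊗[K] D.Aneg ≃ₗ[K] A, ∀ x y (z : D.Aneg),
      ψ ((x ⊗ₜ y) ⊗ₜ z) = z * x * y :=
    ⟨TensorProduct.comm K _ _ ≪≫ₗ (TensorProduct.assoc K _ _ _).symm ≪≫ₗ
      LinearEquiv.ofBijective _ D.bijective_mul, fun _ _ _ => rfl⟩
  refine P.exists_presentation ψ _ fun v s t => ?_
  rw [P.leftAct_apply]
  induction v with
  | zero => rw [TensorProduct.zero_tmul, TensorProduct.zero_tmul, LinearEquiv.map_zero, mul_zero]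
  | add x y hx hy => rw [TensorProduct.add_tmul, TensorProduct.add_tmul, LinearEquiv.map_add,
      LinearEquiv.map_add, mul_add,
      hx, hy]
  | tmul x y =>
    rw [hψ, hψ]
    simp only [map_mul, mul_assoc]

end TriangularDecomposition

/-! ## The free resolution and the cofree resolution -/

namespace CIPresentation

open MvPolynomial TateIndex

variable {K : Type v} {A : Type u} [Field K] [Ring A] [Algebra K A] [Module.Finite K A]
  {𝒜 : ℤ → Submodule K A} [GradedAlgebra 𝒜]
  {S : Subalgebra K A} {n : ℕ} {d e : Fin n → ℤ} (P : CIPresentation 𝒜 S n d e)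
  (a : Fin n → Fin n → MvPolynomial (Fin n) K)

theorem sum_φ_eq_zero (ha : ∀ j, ∑ i, X i * a j i = P.f j) (j : Fin n) :
    P.φ (∑ i, X i * a j i) = 0 := by
  rw [ha, P.φ_f]

/-- The coefficients act from the right and so commute with left multiplications. The differential
of the free resolution is left `A`-linear for this reason. -/
theorem rightAct_tateMap_mul (m : ℕ) (r : A) (x : Basis n n (m + 1) → A) :
    tateMap P.rightAct X a m (fun b => r * x b) = fun b => r * tateMap P.rightAct X a m x b :=
  (compLeft_tateMap P.rightAct X a P.rightAct (LinearMap.mulLeft K r)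
    (fun s x => (mul_assoc r x (P.φ s)).symm) m x).symm

/-- Mirror image of `rightAct_tateMap_mul`: maps out of a complex of right modules form left
modules, as the cofree resolution requires. -/
theorem leftAct_tateMap_mul (m : ℕ) (r : A) (x : Basis n n (m + 1) → A) :
    tateMap P.leftAct X a m (fun b => x b * r) = fun b => tateMap P.leftAct X a m x b * r :=
  (compLeft_tateMap P.leftAct X a P.leftAct (LinearMap.mulRight K r)
    (fun s x => mul_assoc (P.φ s) x r) m x).symm

variable {a}

theorem rightAct_tateMap_mem (ha : ∀ j i, IsWeightedHomogeneous d (a j i) (e j - d i)) {m : ℕ}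
    {k : ℤ} {x : Basis n n (m + 1) → A} (hx : ∀ b, x b ∈ 𝒜 (k - ideg d e b.1))
    (b : Basis n n m) : tateMap P.rightAct X a m x b ∈ 𝒜 (k - ideg d e b.1) := by
  refine tateMap_mem 𝒜 ?_ ?_ hx b
  · intro i k x hx
    exact SetLike.mul_mem_graded hx (P.degree_gen i)
  · intro j i k x hx
    exact SetLike.mul_mem_graded hx (P.φ_mem (ha j i))

theorem leftAct_tateMap_mem (ha : ∀ j i, IsWeightedHomogeneous d (a j i) (e j - d i)) {m : ℕ}
    {k : ℤ} {x : Basis n n (m + 1) → A} (hx : ∀ b, x b ∈ 𝒜 (k - ideg d e b.1))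
    (b : Basis n n m) : tateMap P.leftAct X a m x b ∈ 𝒜 (k - ideg d e b.1) := by
  refine tateMap_mem 𝒜 ?_ ?_ hx b
  · intro i k x hx
    rw [add_comm]
    exact SetLike.mul_mem_graded (P.degree_gen i) hx
  · intro j i k x hx
    rw [add_comm]
    exact SetLike.mul_mem_graded (P.φ_mem (ha j i)) hx

/-- The degrees of the basis of the free modules in the resolution of a module generated in
degree `k`. -/
def freeDeg (d e : Fin n → ℤ) (k : ℤ) (m : ℕ) (b : Basis n n m) : ℤ := ideg d e b.1 + k

/-- The differential of the free resolution. -/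
noncomputable def freeDiff (ha : ∀ j i, IsWeightedHomogeneous d (a j i) (e j - d i)) (k : ℤ)
    (m : ℕ) : GrMod.free 𝒜 (freeDeg d e k (m + 1)) ⟶ GrMod.free 𝒜 (freeDeg d e k m) where
  toLin :=
    { toFun := fun x : Basis n n (m + 1) → A => tateMap P.rightAct X a m x
      map_add' := map_add _
      map_smul' := P.rightAct_tateMap_mul a m }
  map_mem i x hx := by
    replace hx := GrMod.mem_free_gr.1 hx
    refine GrMod.mem_free_gr.2 fun b => ?_
    have h1 := P.rightAct_tateMap_mem ha (k := i - k) (x := x) (fun b => by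
      have := hx b
      rwa [freeDeg, sub_add_eq_sub_sub_swap] at this) b
    rw [freeDeg, sub_add_eq_sub_sub_swap]
    exact h1

/-- The differential of the cofree resolution. -/
noncomputable def cofreeDiff (ha : ∀ j i, IsWeightedHomogeneous d (a j i) (e j - d i)) (k : ℤ)
    (W : Type u) [AddCommGroup W] [Module K W] [Module.Finite K W] (m : ℕ) :
    GrMod.cofree 𝒜 (fun b : Basis n n m => ideg d e b.1) k W ⟶
      GrMod.cofree 𝒜 (fun b : Basis n n (m + 1) => ideg d e b.1) k W :=
  GrMod.cofreeMap W k (tateMap P.leftAct X a m) (fun x r => P.leftAct_tateMap_mul a m r x)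
    fun _ _ hx b => P.leftAct_tateMap_mem ha hx b

theorem freeDiff_exact (ha : ∀ j i, IsWeightedHomogeneous d (a j i) (e j - d i))
    (ha' : ∀ j, ∑ i, X i * a j i = P.f j) {ι : Type}
    (Θ : (ι → MvPolynomial (Fin n) K) →ₗ[K] A) (hΘ : Function.Surjective Θ)
    (hΘs : ∀ s x, Θ (s • x) = P.rightAct s (Θ x))
    (hΘ0 : ∀ x, Θ x = 0 ↔ ∀ i, x i ∈ Ideal.span (Set.range P.f)) (k : ℤ) (m : ℕ)
    (x : GrMod.free 𝒜 (freeDeg d e k (m + 1))) :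
    (P.freeDiff ha k m).toLin x = 0 ↔ ∃ y, (P.freeDiff ha k (m + 1)).toLin y = x := by
  constructor
  · exact exists_tateMap_eq a ha' P.mem_span_of_mul_mem_span P.rightAct Θ hΘ hΘs hΘ0 m x
  · rintro ⟨y, rfl⟩
    refine tateMap_tateMap P.rightAct X a (fun j => ?_) m y
    ext x
    rw [P.rightAct_apply, P.sum_φ_eq_zero a ha', mul_zero]
    rfl

/-- Over a field, linear maps into `W` preserve exactness of the left-handed Tate complex. -/
theorem cofreeDiff_exact (ha : ∀ j i, IsWeightedHomogeneous d (a j i) (e j - d i))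
    (ha' : ∀ j, ∑ i, X i * a j i = P.f j) {ι : Type}
    (Θ : (ι → MvPolynomial (Fin n) K) →ₗ[K] A) (hΘ : Function.Surjective Θ)
    (hΘs : ∀ s x, Θ (s • x) = P.leftAct s (Θ x))
    (hΘ0 : ∀ x, Θ x = 0 ↔ ∀ i, x i ∈ Ideal.span (Set.range P.f)) (k : ℤ)
    (W : Type u) [AddCommGroup W] [Module K W] [Module.Finite K W] (m : ℕ)
    (x : GrMod.cofree 𝒜 (fun b : Basis n n (m + 1) => ideg d e b.1) k W) :
    (P.cofreeDiff ha k W (m + 1)).toLin x = 0 ↔ ∃ y, (P.cofreeDiff ha k W m).toLin y = x := by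
  refine exists_comp_eq_iff_of_exact (tateMap P.leftAct X a (m + 1)) (tateMap P.leftAct X a m)
    (fun x => ⟨?_, ?_⟩) x
  · exact exists_tateMap_eq a ha' P.mem_span_of_mul_mem_span P.leftAct Θ hΘ hΘs hΘ0 m x
  · rintro ⟨y, rfl⟩
    refine tateMap_tateMap P.leftAct X a (fun j => ?_) m y
    ext x
    rw [P.leftAct_apply, P.sum_φ_eq_zero a ha', zero_mul]
    rfl

end CIPresentation

/-! ## The Borel subalgebras -/

theorem CIPresentation.exists_φ_eq {K : Type v} {A : Type u} [Field K] [Ring A] [Algebra K A]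
    {𝒜 : ℤ → Submodule K A} {S : Subalgebra K A} {n : ℕ} {d e : Fin n → ℤ}
    (P : CIPresentation 𝒜 S n d e) (s : MvPolynomial (Fin n) K) :
    ∃ c : Fin n → MvPolynomial (Fin n) K, P.φ s = MvPolynomial.constantCoeff s • (1 : A) +
      ∑ i, P.φ (c i) * P.φ (MvPolynomial.X i) := by
  obtain ⟨c, hc⟩ := mem_span_X_of_constantCoeff_eq_zero
    (p := s - MvPolynomial.C (MvPolynomial.constantCoeff s)) (by simp)
  refine ⟨c, ?_⟩
  have h1 := congrArg P.φ (sub_eq_iff_eq_add.1 hc)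
  rw [map_add, map_sum, add_comm, MvPolynomial.algHom_C, Algebra.algebraMap_eq_smul_one] at h1
  simpa only [map_mul] using h1

namespace TriangularDecomposition

open MvPolynomial

variable {K : Type v} {A : Type u} [Field K] [Ring A] [Algebra K A]
  {𝒜 : ℤ → Submodule K A} [GradedAlgebra 𝒜] (D : TriangularDecomposition 𝒜)
  {n : ℕ} {d e : Fin n → ℤ}

/-- The supremum of two subalgebras that commute as subspaces is contained in their product. -/
theorem sup_le_mul_of_comm {S₁ S₂ : Subalgebra K A} (h : Subalgebra.toSubmodule S₁ *
    Subalgebra.toSubmodule S₂ = Subalgebra.toSubmodule S₂ * Subalgebra.toSubmodule S₁) :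
    Subalgebra.toSubmodule (S₁ ⊔ S₂) ≤ Subalgebra.toSubmodule S₁ * Subalgebra.toSubmodule S₂ := by
  have h1 : ∀ S : Subalgebra K A, Subalgebra.toSubmodule S * Subalgebra.toSubmodule S ≤
      Subalgebra.toSubmodule S := fun S => Submodule.mul_le.2 fun x hx y hy => S.mul_mem hx hy
  let B : Subalgebra K A := (Subalgebra.toSubmodule S₁ * Subalgebra.toSubmodule S₂).toSubalgebra
    (by
      rw [← one_mul (1 : A)]
      exact Submodule.mul_mem_mul S₁.one_mem S₂.one_mem)
    (fun x y hx hy => by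
      have h2 := Submodule.mul_mem_mul hx hy
      -- The two middle factors are exchanged by `h`, so the product of the two subspaces is closed
      -- under multiplication.
      rw [mul_assoc, ← mul_assoc (Subalgebra.toSubmodule S₂), ← h, mul_assoc, ← mul_assoc] at h2
      exact mul_le_mul' (h1 S₁) (h1 S₂) h2)
  have h3 : S₁ ⊔ S₂ ≤ B := by
    refine sup_le (fun x hx => ?_) (fun x hx => ?_)
    · rw [← mul_one x]
      exact Submodule.mul_mem_mul hx S₂.one_mem
    · rw [← one_mul x]
      exact Submodule.mul_mem_mul S₁.one_mem hx
  exact h3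

/-- Modulo the left ideal of the variables `A⁺` reduces to scalars, hence `T A⁺` to `T`. Since `T`
sits in degree 0, taking the component of degree `i > 0` leaves only the part in the ideal. -/
theorem degree_pos_decomposition [Module.Finite K A] (P : CIPresentation 𝒜 D.Apos n d e)
    {b : A} {i : ℤ} (hi : 0 < i) (hb : b ∈ D.Bpos) (hbi : b ∈ 𝒜 i) :
    b ∈ Submodule.span A (Set.range fun i => P.φ (X i)) := by
  let J : Submodule A A := Submodule.span A (Set.range fun i => P.φ (X i))
  have hJ : (GrMod.regular 𝒜).IsGraded J := (GrMod.regular 𝒜).isGraded_span _ (by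
    rintro _ ⟨i, rfl⟩
    exact ⟨d i, P.degree_gen i⟩)
  have h1 : b ∈ Subalgebra.toSubmodule D.T ⊔ J.restrictScalars K := by
    have h2 := sup_le_mul_of_comm D.mul_comm_pos hb
    rw [D.mul_comm_pos] at h2
    refine (Submodule.mul_le.2 fun t ht x hx => ?_ : _ ≤ Subalgebra.toSubmodule D.T ⊔
      J.restrictScalars K) h2
    obtain ⟨s, rfl⟩ := P.range_eq.ge hx
    obtain ⟨c, h3⟩ := P.exists_φ_eq s
    change t * P.φ s ∈ _
    rw [h3, mul_add, mul_smul_comm, mul_one, Finset.mul_sum]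
    refine Submodule.add_mem_sup (Submodule.smul_mem _ _ ht) (Submodule.sum_mem _ fun i _ => ?_)
    rw [← mul_assoc]
    exact Submodule.smul_mem J _ (Submodule.subset_span ⟨i, rfl⟩)
  obtain ⟨t, ht, y, hy, rfl⟩ := Submodule.mem_sup.1 h1
  have h2 : (GrMod.regular 𝒜).comp i (t + y) = t + y := (GrMod.regular 𝒜).comp_of_mem hbi
  have h3 : (GrMod.regular 𝒜).comp i t = 0 := (GrMod.regular 𝒜).comp_of_ne (D.T_le ht) hi.ne
  rw [← h2]
  refine (congrArg (· ∈ J) ((map_add ((GrMod.regular 𝒜).comp i) t y).trans ?_)).mpr (hJ i y hy)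
  exact (congrArg (· + (GrMod.regular 𝒜).comp i y) h3).trans (zero_add _)

/-- The same argument with `A⁻ T` and the right ideal of the variables. The component of degree `i`
is taken by replacing each coefficient `c j` with its component of degree `i - d j`. -/
theorem degree_neg_decomposition [Module.Finite K A] (P : CIPresentation 𝒜 D.Aneg n d e)
    {b : A} {i : ℤ} (hi : i < 0) (hb : b ∈ D.Bneg) (hbi : b ∈ 𝒜 i) :
    ∃ c : Fin n → A, b = ∑ i, P.φ (X i) * c i := by
  obtain ⟨p, -, -, hp, hp', -, -, hmul⟩ := GrMod.exists_projections 𝒜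
  let J : Submodule K A := LinearMap.range
    (∑ i, LinearMap.mulLeft K (P.φ (X i)) ∘ₗ LinearMap.proj i : (Fin n → A) →ₗ[K] A)
  have hJ : ∀ y, y ∈ J ↔ ∃ c : Fin n → A, y = ∑ i, P.φ (X i) * c i := by
    intro y
    refine exists_congr fun c => ?_
    rw [LinearMap.sum_apply]
    exact eq_comm
  have h1 : b ∈ Subalgebra.toSubmodule D.T ⊔ J := by
    have h2 := sup_le_mul_of_comm D.mul_comm_neg hb
    refine (Submodule.mul_le.2 fun x hx t ht => ?_ : _ ≤ Subalgebra.toSubmodule D.T ⊔ J) h2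
    obtain ⟨s, rfl⟩ := P.range_eq.ge hx
    obtain ⟨c, h3⟩ := P.exists_φ_eq s
    simp only [← map_mul, mul_comm (c _)] at h3
    simp only [map_mul] at h3
    change P.φ s * t ∈ _
    rw [h3, add_mul, smul_mul_assoc, one_mul, Finset.sum_mul]
    refine Submodule.add_mem_sup (Submodule.smul_mem _ _ ht) ((hJ _).2 ⟨fun i => P.φ (c i) * t, ?_⟩)
    exact Finset.sum_congr rfl fun i _ => mul_assoc _ _ _
  obtain ⟨t, ht, y, hy, rfl⟩ := Submodule.mem_sup.1 h1
  obtain ⟨c, rfl⟩ := (hJ y).1 hy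
  refine ⟨fun j => p (i - d j) (c j), ?_⟩
  have h2 : p i (t + ∑ i, P.φ (X i) * c i) = t + ∑ i, P.φ (X i) * c i := hp _ _ hbi
  rw [← h2, map_add, hp' 0 i t (D.T_le ht) hi.ne', zero_add, map_sum]
  refine Finset.sum_congr rfl fun j _ => ?_
  have := hmul (d j) (i - d j) _ (c j) (P.degree_gen j)
  rwa [add_sub_cancel] at this

/-- A proper left ideal. -/
theorem one_notMem_span [Module.Finite K A] (P : CIPresentation 𝒜 D.Apos n d e)
    (hd : ∀ i, 0 < d i) : (1 : A) ∉ Submodule.span A (Set.range fun i => P.φ (X i)) := by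
  intro h
  obtain ⟨p, s, hp₀, hp, hp', hs, hsum, -⟩ := GrMod.exists_projections 𝒜
  have hne : (s.filter fun i => 𝒜 i ≠ ⊥).Nonempty := by
    by_contra! h0
    have := D.nontrivial
    refine one_ne_zero (α := A) ?_
    rw [← hsum 1]
    refine Finset.sum_eq_zero fun i hi => ?_
    have h1 : 𝒜 i = ⊥ := by
      by_contra h2
      have := h0 ▸ Finset.mem_filter.2 ⟨hi, h2⟩
      simp at this
    have := hp₀ i 1
    rwa [h1, Submodule.mem_bot] at this
  -- `m` is the lowest degree in which `A` is nonzero. The variables raise degrees, so their left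
  -- ideal has no component in degree `m`; if it contained 1, it would be all of `A`.
  obtain ⟨m, hm, hmin⟩ := Finset.exists_min_image _ id hne
  have hlow : ∀ i < m, 𝒜 i = ⊥ := by
    intro i hi
    by_contra h0
    by_cases his : i ∈ s
    · exact absurd (hmin i (Finset.mem_filter.2 ⟨his, h0⟩)) (not_le.2 hi)
    · exact h0 (hs i his)
  have hz : ∀ j y, p m (y * P.φ (X j)) = 0 := by
    intro j y
    rw [← hsum y, Finset.sum_mul, map_sum]
    refine Finset.sum_eq_zero fun i _ => ?_
    by_cases hi : i + d j = m
    · have h1 := hp₀ i y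
      rw [hlow i (by have := hd j; omega), Submodule.mem_bot] at h1
      rw [h1, zero_mul, map_zero]
    · exact hp' _ _ _ (SetLike.mul_mem_graded (hp₀ i y) (P.degree_gen j)) hi
  refine (Finset.mem_filter.1 hm).2 (eq_bot_iff.2 fun x hx => ?_)
  have h1 : x ∈ Submodule.span A (Set.range fun i => P.φ (X i)) := by
    rw [← mul_one x]
    exact Submodule.smul_mem _ x h
  obtain ⟨c, hc⟩ := (Submodule.mem_span_range_iff_exists_fun A).1 h1
  rw [Submodule.mem_bot, ← hp m x hx, ← hc, map_sum]
  exact Finset.sum_eq_zero fun j _ => hz j _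

end TriangularDecomposition

/-! ## Simple graded `T`-modules -/

namespace GrMod

section Concentrated

variable {K : Type v} {R : Type u} [Field K] [Ring R] [Algebra K R] {ℛ : ℤ → Submodule K R}

theorem IsConcentratedIn.mem {M : GrMod ℛ} {k : ℤ} (h : M.IsConcentratedIn k) (x : M) :
    x ∈ M.gr k := by
  rw [h]
  trivial

theorem IsConcentratedIn.eq_zero {M : GrMod ℛ} {k i : ℤ} (h : M.IsConcentratedIn k) {x : M}
    (hx : x ∈ M.gr i) (hi : i ≠ k) : x = 0 := by
  rw [← M.comp_of_mem hx]
  exact M.comp_of_ne (h.mem x) hi.symm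

/-- In a module living in one degree every submodule is graded, so graded simplicity is ordinary
simplicity. -/
theorem IsConcentratedIn.isSimpleModule {M : GrMod ℛ} {k : ℤ} (h : M.IsConcentratedIn k)
    [Simple M] : IsSimpleModule R M := by
  rw [isSimpleModule_iff]
  have hnt : Nontrivial M := by
    by_contra h0
    rw [not_nontrivial_iff_subsingleton] at h0
    refine id_nonzero M ?_
    ext x
    exact Subsingleton.elim _ _
  refine { eq_bot_or_eq_top := fun W => ?_ }
  have hW : M.IsGraded W := fun i x hx => by
    by_cases hi : i = k
    · subst hi
      rwa [M.comp_of_mem (h.mem x)]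
    · rw [M.comp_of_ne (h.mem x) (Ne.symm hi)]
      exact W.zero_mem
  haveI := mono_of_injective (M.subι W hW) Subtype.val_injective
  by_cases h0 : M.subι W hW = 0
  · left
    rw [eq_bot_iff]
    intro x hx
    exact congrArg (fun g : M.sub W hW ⟶ M => g.toLin ⟨x, hx⟩) h0
  · right
    haveI := isIso_of_mono_of_nonzero h0
    rw [eq_top_iff]
    intro x _
    obtain ⟨y, rfl⟩ := surjective_of_epi (M.subι W hW) x
    exact y.2

end Concentrated

end GrMod

namespace TriangularDecomposition

variable {K : Type v} {A : Type u} [Field K] [Ring A] [Algebra K A]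
  {𝒜 : ℤ → Submodule K A} [GradedAlgebra 𝒜] (D : TriangularDecomposition 𝒜)

/-- A `T`-module placed in degree `k`. -/
def place (S : Type u) [AddCommGroup S] [Module K S] [Module D.T S] [IsScalarTower K D.T S]
    [Module.Finite K S] (k : ℤ) : D.TMod where
  carrier := S
  gr i := if i = k then ⊤ else ⊥
  isInternal := by
    refine isInternal_of_separating (W := S) _
      (fun x => Submodule.mem_iSup_of_mem k (by rw [if_pos rfl]; trivial))
      (fun i => if i = k then LinearMap.id else 0) ?_ ?_
    · intro i j x hx hij
      split_ifs at hx ⊢ with h1 h2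
      · omega
      · rw [(Submodule.mem_bot K).1 hx, map_zero]
      · rfl
      · rfl
    · intro i x hx h0
      split_ifs at hx h0 with h1
      · exact h0
      · exact hx
  smul_mem := by
    intro i j t x ht hx
    by_cases hi : i = 0
    · subst hi
      rw [zero_add]
      split_ifs at hx ⊢
      · trivial
      · rw [(Submodule.mem_bot K).1 hx, smul_zero]
        exact Submodule.zero_mem _
    · have h1 : t = 0 := by
        have h2 := DirectSum.degree_eq_of_mem_mem 𝒜 (D.T_le t.2) ht
        by_contra h3
        exact hi (h2 fun h => h3 (Subtype.ext h)).symm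
      rw [h1, zero_smul]
      exact Submodule.zero_mem _

variable (S : Type u) [AddCommGroup S] [Module K S] [Module D.T S] [IsScalarTower K D.T S]
    [Module.Finite K S] (k : ℤ)

theorem place_isConcentratedIn : (D.place S k).IsConcentratedIn k := if_pos rfl

theorem place_simple [IsSimpleModule D.T S] : Simple (D.place S k) where
  mono_isIso_iff_nonzero {Y} f _ := by
    constructor
    · rintro h rfl
      haveI := IsSimpleModule.nontrivial D.T S
      obtain ⟨x, hx⟩ := exists_ne (0 : S)
      obtain ⟨y, hy⟩ := GrMod.surjective_of_epi (0 : Y ⟶ D.place S k) x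
      exact hx hy.symm
    · intro h
      have h1 : LinearMap.range f.toLin = ⊥ ∨ LinearMap.range f.toLin = ⊤ :=
        IsSimpleOrder.eq_bot_or_eq_top (α := Submodule D.T S) (LinearMap.range f.toLin)
      rcases h1 with h1 | h1
      · exact absurd (GrMod.Hom.ext (LinearMap.range_eq_bot.1 h1)) h
      · haveI := GrMod.epi_of_surjective f (LinearMap.range_eq_top.1 h1)
        exact isIso_of_mono_of_epi f

end TriangularDecomposition

/-! ## The module presented by the variables -/

namespace CIPresentation

open MvPolynomial TateIndex

variable {K : Type v} {A : Type u} [Field K] [Ring A] [Algebra K A]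
  {𝒜 : ℤ → Submodule K A} {S : Subalgebra K A} {n : ℕ} {d e : Fin n → ℤ}
  (P : CIPresentation 𝒜 S n d e) {a : Fin n → Fin n → MvPolynomial (Fin n) K}

section Annihilated

variable {N : Type*} [AddCommGroup N] [Module K N] [Module A N] [IsScalarTower K A N]

theorem φ_smul_of_X_smul_eq_zero (h : ∀ i (x : N), P.φ (X i) • x = 0)
    (s : MvPolynomial (Fin n) K) (x : N) : P.φ s • x = constantCoeff s • x := by
  obtain ⟨c, hc⟩ := P.exists_φ_eq s
  rw [hc, add_smul, Finset.sum_smul, smul_assoc, one_smul, add_eq_left]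
  refine Finset.sum_eq_zero fun i _ => ?_
  rw [mul_smul, h, smul_zero]

/-- The differential multiplies only by variables and by the `a j i`. All of these lack a constant
term and so act by zero where the variables do. -/
theorem rightAct_tateMap_smul (h : ∀ i (x : N), P.φ (X i) • x = 0)
    (ha0 : ∀ j i, constantCoeff (a j i) = 0) (m : ℕ) (x : Basis n n (m + 1) → A)
    (b : Basis n n m) (z : N) : tateMap P.rightAct X a m x b • z = 0 := by
  have h1 : ∀ s y, constantCoeff s = 0 → P.rightAct s y ∈
      LinearMap.ker ((LinearMap.toSpanSingleton A N z).restrictScalars K) := by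
    intro s y hs
    change (y * P.φ s) • z = 0
    rw [mul_smul, P.φ_smul_of_X_smul_eq_zero h, hs, zero_smul, smul_zero]
  have h2 : tateMap P.rightAct X a m x b ∈
      LinearMap.ker ((LinearMap.toSpanSingleton A N z).restrictScalars K) := by
    rw [tateMap_apply]
    refine Submodule.add_mem _ (Submodule.sum_mem _ fun i _ => ?_)
      (Submodule.sum_mem _ fun j _ => Submodule.sum_mem _ fun i _ => ?_)
    · split_ifs
      · exact Submodule.zero_mem _
      · exact zsmul_mem (h1 _ _ (constantCoeff_X K _)) _
    · split_ifs
      · exact zsmul_mem (h1 _ _ (ha0 j i)) _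
      · exact Submodule.zero_mem _
  exact h2

end Annihilated

variable [Module.Finite K A] [GradedAlgebra 𝒜]

/-- Minimality of the resolution: maps into a module killed by the variables form a complex with
zero differential. -/
theorem freeDiff_comp (ha : ∀ j i, IsWeightedHomogeneous d (a j i) (e j - d i))
    (ha0 : ∀ j i, constantCoeff (a j i) = 0) {N : GrMod 𝒜}
    (h : ∀ i (x : N), P.φ (X i) • x = 0) (k : ℤ) (m : ℕ)
    (g : GrMod.free 𝒜 (freeDeg d e k m) ⟶ N) : P.freeDiff ha k m ≫ g = 0 := by
  classical
  ext x
  refine (GrMod.free_hom_apply g _).trans (Finset.sum_eq_zero fun b _ => ?_)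
  exact P.rightAct_tateMap_smul h ha0 m x b _

variable (ha : ∀ j i, IsWeightedHomogeneous d (a j i) (e j - d i)) (k : ℤ)

/-- The cyclic module in which the variables kill the generator, which has degree `k`. -/
noncomputable def cyclic : GrMod 𝒜 :=
  (GrMod.free 𝒜 (freeDeg d e k 0)).quot _ (GrMod.isGraded_range (P.freeDiff ha k 0))

/-- The projection from the free module. -/
noncomputable def cyclicπ : GrMod.free 𝒜 (freeDeg d e k 0) ⟶ P.cyclic ha k :=
  GrMod.quotπ _ _ (GrMod.isGraded_range (P.freeDiff ha k 0))

theorem cyclicπ_surjective : Function.Surjective (P.cyclicπ ha k).toLin :=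
  Submodule.mkQ_surjective _

theorem cyclicπ_eq_zero_iff (x : GrMod.free 𝒜 (freeDeg d e k 0)) :
    (P.cyclicπ ha k).toLin x = 0 ↔ ∃ y, (P.freeDiff ha k 0).toLin y = x :=
  Submodule.Quotient.mk_eq_zero _

/-- The generator of the cyclic module. -/
noncomputable def cyclicGen : P.cyclic ha k :=
  (P.cyclicπ ha k).toLin (fun _ => (1 : A) : Basis n n 0 → A)

theorem cyclicGen_mem : P.cyclicGen ha k ∈ (P.cyclic ha k).gr k := by
  refine (P.cyclicπ ha k).map_mem _ _ (GrMod.mem_free_gr.2 fun b => ?_)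
  rw [freeDeg, b.eq_unit, ideg_unit, zero_add, sub_self]
  exact SetLike.one_mem_graded 𝒜

theorem smul_cyclicGen (r : A) :
    r • P.cyclicGen ha k = (P.cyclicπ ha k).toLin (fun _ => r : Basis n n 0 → A) := by
  refine ((P.cyclicπ ha k).toLin.map_smul r _).symm.trans (congrArg (P.cyclicπ ha k).toLin ?_)
  exact funext fun _ => mul_one r

theorem exists_smul_cyclicGen (x : P.cyclic ha k) : ∃ r : A, x = r • P.cyclicGen ha k := by
  obtain ⟨y, rfl⟩ := P.cyclicπ_surjective ha k x
  refine ⟨(y : Basis n n 0 → A) (Basis.unit n n), ?_⟩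
  rw [smul_cyclicGen]
  exact congrArg (P.cyclicπ ha k).toLin (funext fun b => by rw [b.eq_unit])

theorem X_smul_cyclicGen (i : Fin n) : P.φ (X i) • P.cyclicGen ha k = 0 := by
  classical
  rw [smul_cyclicGen]
  refine (P.cyclicπ_eq_zero_iff ha k _).2 ⟨(Pi.single (Basis.ext n i) 1 : Basis n n 1 → A), funext fun b => ?_⟩
  rw [b.eq_unit]
  refine (tateMap_zero_apply P.rightAct X a _).trans ?_
  have h1 : ∀ j, P.rightAct (X j) ((Pi.single (Basis.ext n i) 1 : Basis n n 1 → A) (Basis.ext n j)) =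
      if j = i then P.φ (X j) else 0 := by
    intro j
    rw [P.rightAct_apply]
    by_cases hj : j = i
    · subst hj
      simp
    · have h2 : Basis.ext n j ≠ Basis.ext n i := fun h => hj (by
        have h3 := congrArg (fun b => b.1.1) h
        exact Finset.singleton_injective h3)
      simp [hj, h2]
  simp only [h1, Finset.sum_ite_eq', Finset.mem_univ, if_true]

theorem cyclicGen_ne_zero (h : (1 : A) ∉ Submodule.span A (Set.range fun i => P.φ (X i))) :
    P.cyclicGen ha k ≠ 0 := by
  intro h0
  obtain ⟨x, hx⟩ := (P.cyclicπ_eq_zero_iff ha k _).1 h0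
  have h1 : (1 : A) = ∑ i, P.rightAct (X i) ((x : Basis n n 1 → A) (Basis.ext n i)) :=
    (congrFun hx (Basis.unit n n)).symm.trans (tateMap_zero_apply P.rightAct X a _)
  refine h (h1 ▸ Submodule.sum_mem _ fun i _ => ?_)
  exact Submodule.smul_mem _ _ (Submodule.subset_span ⟨i, rfl⟩)

/-- The universal property of the cyclic module. -/
theorem exists_cyclic_hom {N : GrMod 𝒜} {y : N} (hy : y ∈ N.gr k)
    (h : ∀ i, P.φ (X i) • y = 0) : ∃ f : P.cyclic ha k ⟶ N, f.toLin (P.cyclicGen ha k) = y := by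
  have hfree : ∀ b : Basis n n 0, y ∈ N.gr (freeDeg d e k 0 b) := fun b => by
    rwa [freeDeg, b.eq_unit, ideg_unit, zero_add]
  have hlift : ∀ x, (GrMod.freeLift (fun _ => y) hfree).toLin x =
      (x : Basis n n 0 → A) (Basis.unit n n) • y := fun x =>
    Fintype.sum_eq_single _ fun b hb => absurd b.eq_unit hb
  obtain ⟨f, hf⟩ := GrMod.exists_factor (P.cyclicπ ha k) (P.cyclicπ_surjective ha k)
    (GrMod.freeLift (fun _ => y) hfree) (fun x hx => by
      obtain ⟨z, rfl⟩ := (P.cyclicπ_eq_zero_iff ha k x).1 hx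
      rw [hlift]
      refine (congrArg (· • y) (tateMap_zero_apply P.rightAct X a _)).trans ?_
      rw [Finset.sum_smul]
      refine Finset.sum_eq_zero fun i _ => ?_
      rw [P.rightAct_apply, mul_smul, h, smul_zero])
  refine ⟨f, ?_⟩
  have h1 := congrArg (fun g => g.toLin (fun _ => (1 : A) : Basis n n 0 → A)) hf
  exact h1.trans ((hlift _).trans (one_smul A y))

variable {k} in
theorem cyclic_hom_ext {N : GrMod 𝒜} {f g : P.cyclic ha k ⟶ N}
    (h : f.toLin (P.cyclicGen ha k) = g.toLin (P.cyclicGen ha k)) : f = g := by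
  ext x
  obtain ⟨r, rfl⟩ := P.exists_smul_cyclicGen ha k x
  rw [map_smul, map_smul, h]

end CIPresentation

/-! ## Standard modules -/

namespace TriangularDecomposition

open MvPolynomial

variable {K : Type v} {A : Type u} [Field K] [Ring A] [Algebra K A] [Module.Finite K A]
  {𝒜 : ℤ → Submodule K A} [GradedAlgebra 𝒜] (D : TriangularDecomposition 𝒜)

variable (lam : D.TMod)

/-- The projection from `A ⊗ lam` to the standard module. -/
noncomputable def standardMk : A ⊗[K] lam →ₗ[A] D.standard lam :=
  (Submodule.span A (D.tensorRel lam)).mkQ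

theorem standardMk_surjective : Function.Surjective (D.standardMk lam) :=
  (Submodule.span A (D.tensorRel lam)).mkQ_surjective

/-- The element `1 ⊗ v` of a standard module. -/
noncomputable def standardGen (v : lam) : D.standard lam := D.standardMk lam (1 ⊗ₜ[K] v)

variable {D} {lam}

theorem standardMk_eq_zero {z : A ⊗[K] lam} (hz : z ∈ D.tensorRel lam) :
    D.standardMk lam z = 0 :=
  (Submodule.Quotient.mk_eq_zero _).2 (Submodule.subset_span hz)

theorem smul_standardGen (r : A) (v : lam) :
    r • D.standardGen lam v = D.standardMk lam (r ⊗ₜ[K] v) := by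
  rw [standardGen, ← map_smul, TensorProduct.smul_tmul', smul_eq_mul, mul_one]

theorem standardGen_mem {v : lam} {k : ℤ} (hv : v ∈ lam.gr k) :
    D.standardGen lam v ∈ (D.standard lam).gr k :=
  ((D.tensor lam).quotπ _ ((D.tensor lam).isGraded_span _ (D.tensorRel_homogeneous lam))).map_mem
    _ _ (D.tmul_mem_tensor lam (SetLike.one_mem_graded 𝒜) hv (zero_add k))

theorem smul_standardGen_T (t : D.T) {v : lam} {k : ℤ} (hv : v ∈ lam.gr k) :
    (t : A) • D.standardGen lam v = D.standardGen lam (t • v) := by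
  rw [smul_standardGen, ← sub_eq_zero, standardGen, ← map_sub]
  exact standardMk_eq_zero (Or.inl ⟨t, k, v, hv, rfl⟩)

theorem smul_standardGen_of_pos {b : A} {i k : ℤ} (hi : 0 < i) (hb : b ∈ D.Bpos) (hbi : b ∈ 𝒜 i)
    {v : lam} (hv : v ∈ lam.gr k) : b • D.standardGen lam v = 0 := by
  rw [smul_standardGen]
  exact standardMk_eq_zero (Or.inr ⟨b, i, k, v, hi, hb, hbi, hv, rfl⟩)

theorem standard_induction {p : D.standard lam → Prop} (h0 : p 0)
    (hadd : ∀ x y, p x → p y → p (x + y)) (h : ∀ (r : A) v, p (r • D.standardGen lam v))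
    (x : D.standard lam) : p x := by
  obtain ⟨z, rfl⟩ := D.standardMk_surjective lam x
  induction z with
  | zero => rwa [map_zero]
  | add y z hy hz => rw [map_add]; exact hadd _ _ hy hz
  | tmul r v =>
    have := h r v
    rwa [smul_standardGen] at this

theorem standard_hom_ext {N : GrMod 𝒜} {f g : D.standard lam ⟶ N}
    (h : ∀ v, f.toLin (D.standardGen lam v) = g.toLin (D.standardGen lam v)) : f = g := by
  ext x
  induction x using standard_induction with
  | h0 => rw [map_zero, map_zero]
  | hadd x y hx hy => rw [map_add, map_add, hx, hy]
  | h r v => rw [map_smul, map_smul, h]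

/-- The universal property of standard modules. -/
theorem exists_standard_hom {N : GrMod 𝒜} (j : lam →ₗ[K] N)
    (hj : ∀ i v, v ∈ lam.gr i → j v ∈ N.gr i) (hT : ∀ (t : D.T) v, j (t • v) = (t : A) • j v)
    (hpos : ∀ (b : A) (i : ℤ) v, 0 < i → b ∈ D.Bpos → b ∈ 𝒜 i → b • j v = 0) :
    ∃ f : D.standard lam ⟶ N, ∀ v, f.toLin (D.standardGen lam v) = j v := by
  let F : A ⊗[K] lam →ₗ[A] N := TensorProduct.AlgebraTensorModule.lift
    ((LinearMap.toSpanSingleton A (lam →ₗ[K] N) j))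
  have hF : ∀ (r : A) v, F (r ⊗ₜ v) = r • j v := fun r v => rfl
  let F' : D.tensor lam ⟶ N := ⟨F, fun k z hz => by
    refine (Submodule.span_le.2 ?_ : _ ≤ (N.gr k).comap (F.restrictScalars K)) hz
    rintro _ ⟨i, i', rfl, r, hr, v, hv, rfl⟩
    exact N.smul_mem hr (hj i' v hv)⟩
  refine ⟨GrMod.desc F' _ ((D.tensor lam).isGraded_span _ (D.tensorRel_homogeneous lam)) ?_,
    fun v => (hF 1 v).trans (one_smul A _)⟩
  intro x hx
  refine (Submodule.span_le.2 ?_ : _ ≤ LinearMap.ker F) hx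
  rintro _ (⟨t, i, v, -, rfl⟩ | ⟨b, i, i', v, hi, hb, hbi, -, rfl⟩)
  · refine (LinearMap.map_sub F _ _).trans ?_
    rw [hF, hF, one_smul, hT, sub_self]
  · exact hpos b i v hi hb hbi

end TriangularDecomposition

/-! ## Heads and rigid modules -/

namespace GrMod

variable {K : Type v} {R : Type u} [Field K] [Ring R] [Algebra K R] {ℛ : ℤ → Submodule K R}

theorem sum_toLin_apply {M N : GrMod ℛ} {ι : Type*} (s : Finset ι) (f : ι → (M ⟶ N)) (x : M) :
    (∑ i ∈ s, f i).toLin x = ∑ i ∈ s, (f i).toLin x := by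
  classical
  induction s using Finset.induction_on with
  | empty => rfl
  | insert i s hi ih =>
    rw [Finset.sum_insert hi, Finset.sum_insert hi, ← ih]
    rfl

/-- Finite dimension provides a maximal proper graded submodule, and the radical is contained in it.
-/
theorem head_nontrivial (M : GrMod ℛ) [Nontrivial M] : Nontrivial M.head := by
  haveI : IsNoetherian R M := isNoetherian_of_tower K inferInstance
  obtain ⟨N, -, hN⟩ := exists_maximal_ge_of_wellFoundedGT
    (fun N : Submodule R M => M.IsGraded N ∧ N ≠ ⊤) ⊥
    ⟨fun i x hx => by
      rw [Submodule.mem_bot] at hx ⊢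
      rw [hx, map_zero], bot_ne_top⟩
  refine Submodule.Quotient.nontrivial_iff.2 fun h => hN.1.2 ?_
  rw [eq_top_iff, ← h]
  exact sInf_le hN

end GrMod

namespace TriangularDecomposition

open MvPolynomial

variable {K : Type v} {A : Type u} [Field K] [Ring A] [Algebra K A] [Module.Finite K A]
  {𝒜 : ℤ → Submodule K A} [GradedAlgebra 𝒜] {D : TriangularDecomposition 𝒜}
  {n : ℕ} {d e d' e' : Fin n → ℤ}

theorem IsRigid.X_smul_pos {S : GrMod 𝒜} (hS : D.IsRigid S) (P : CIPresentation 𝒜 D.Apos n d e)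
    (hd : ∀ i, 0 < d i) (i : Fin n) (x : S) : P.φ (X i) • x = 0 :=
  hS.2 (d i) (hd i) _ (P.φ_mem_subalgebra _) (P.degree_gen i) x

theorem IsRigid.X_smul_neg {S : GrMod 𝒜} (hS : D.IsRigid S) (P : CIPresentation 𝒜 D.Aneg n d e)
    (hd : ∀ i, d i < 0) (i : Fin n) (x : S) : P.φ (X i) • x = 0 :=
  hS.1 (d i) (hd i) _ (P.φ_mem_subalgebra _) (P.degree_gen i) x

/-- The homogeneous components of a rigid module are submodules. -/
theorem IsRigid.smul_mem_gr {S : GrMod 𝒜} (hS : D.IsRigid S)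
    (Pneg : CIPresentation 𝒜 D.Aneg n d e) (hd : ∀ i, d i < 0)
    (Ppos : CIPresentation 𝒜 D.Apos n d' e') (hd' : ∀ i, 0 < d' i) (r : A) {l : ℤ} {x : S}
    (hx : x ∈ S.gr l) : r • x ∈ S.gr l := by
  obtain ⟨z, rfl⟩ := D.bijective_mul.2 r
  induction z with
  | zero => rw [map_zero, zero_smul]; exact Submodule.zero_mem _
  | add y z hy hz => rw [map_add, add_smul]; exact Submodule.add_mem _ hy hz
  | tmul y r₃ =>
    induction y with
    | zero =>
      rw [TensorProduct.zero_tmul, map_zero, zero_smul]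
      exact Submodule.zero_mem _
    | add y z hy hz =>
      rw [TensorProduct.add_tmul, map_add, add_smul]
      exact Submodule.add_mem _ hy hz
    | tmul r₁ t =>
      change ((r₁ : A) * (t : A) * (r₃ : A)) • x ∈ S.gr l
      obtain ⟨s₁, hs₁⟩ := Pneg.range_eq.ge r₁.2
      obtain ⟨s₃, hs₃⟩ := Ppos.range_eq.ge r₃.2
      change Pneg.φ s₁ = r₁ at hs₁
      change Ppos.φ s₃ = r₃ at hs₃
      rw [← hs₁, ← hs₃, mul_smul, mul_smul,
        Ppos.φ_smul_of_X_smul_eq_zero (hS.X_smul_pos Ppos hd'),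
        Pneg.φ_smul_of_X_smul_eq_zero (hS.X_smul_neg Pneg hd)]
      have h1 := S.smul_mem (D.T_le t.2) ((S.gr l).smul_mem (constantCoeff s₃) hx)
      rw [zero_add] at h1
      exact Submodule.smul_mem _ _ h1

/-- `L(μ)` is spanned over `A` by the images of the vectors `1 ⊗ v`, all of degree `l`, and on a
rigid module `A` preserves each component. -/
theorem IsRigid.isConcentratedIn_L {mu : D.TMod} (hS : D.IsRigid (D.L mu))
    (Pneg : CIPresentation 𝒜 D.Aneg n d e) (hd : ∀ i, d i < 0)
    (Ppos : CIPresentation 𝒜 D.Apos n d' e') (hd' : ∀ i, 0 < d' i) {l : ℤ}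
    (hmu : mu.IsConcentratedIn l) : (D.L mu).IsConcentratedIn l := by
  refine eq_top_iff.2 fun x _ => ?_
  let π : D.standard mu ⟶ D.L mu := (D.standard mu).quotπ _ (D.standard mu).isGraded_rad
  obtain ⟨y, rfl⟩ : ∃ y, π.toLin y = x := Submodule.mkQ_surjective _ x
  induction y using standard_induction with
  | h0 => rw [map_zero]; exact Submodule.zero_mem _
  | hadd y z hy hz => rw [map_add]; exact Submodule.add_mem _ (hy trivial) (hz trivial)
  | h r v =>
    rw [map_smul]
    exact hS.smul_mem_gr Pneg hd Ppos hd' r (π.map_mem _ _ (standardGen_mem (hmu.mem v)))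

/-! ## Standard modules and the cyclic module -/

section Standard

variable (P : CIPresentation 𝒜 D.Apos n d e) {a : Fin n → Fin n → MvPolynomial (Fin n) K}
  (ha : ∀ j i, IsWeightedHomogeneous d (a j i) (e j - d i)) {k : ℤ} {lam : D.TMod}

/-- For `b` in `B⁺` of positive degree, `b * j v` is again such an element. It lies in the left
ideal of the variables and so kills the generator. -/
theorem exists_hom_cyclic (hlam : lam.IsConcentratedIn k) (j : lam →ₗ[D.T] D.T) :
    ∃ f : D.standard lam ⟶ P.cyclic ha k,
      ∀ v, f.toLin (D.standardGen lam v) = (j v : A) • P.cyclicGen ha k := by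
  refine exists_standard_hom ((LinearMap.toSpanSingleton A _ (P.cyclicGen ha k)).restrictScalars K ∘ₗ
    D.T.val.toLinearMap ∘ₗ j.restrictScalars K) ?_ ?_ ?_
  · intro i v hv
    by_cases hi : i = k
    · subst hi
      have h1 := (P.cyclic ha i).smul_mem (D.T_le (j v).2) (P.cyclicGen_mem ha i)
      rw [zero_add] at h1
      exact h1
    · rw [hlam.eq_zero hv hi, map_zero]
      exact Submodule.zero_mem _
  · intro t v
    change (j (t • v) : A) • P.cyclicGen ha k = (t : A) • (j v : A) • P.cyclicGen ha k
    rw [map_smul, smul_smul]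
    rfl
  · intro b i v hi hb hbi
    change b • (j v : A) • P.cyclicGen ha k = 0
    rw [smul_smul]
    have h1 : b * (j v : A) ∈ 𝒜 i := by
      have := SetLike.mul_mem_graded hbi (D.T_le (j v).2)
      rwa [add_zero] at this
    have h2 := D.degree_pos_decomposition P hi
      (mul_mem hb ((le_sup_right : D.T ≤ D.Bpos) (j v).2)) h1
    refine (Submodule.span_le.2 ?_ : _ ≤ LinearMap.ker
      (LinearMap.toSpanSingleton A _ (P.cyclicGen ha k))) h2
    rintro _ ⟨i, rfl⟩
    exact P.X_smul_cyclicGen ha k i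

theorem exists_hom_standard (hd : ∀ i, 0 < d i) (hlam : lam.IsConcentratedIn k)
    (p : D.T →ₗ[D.T] lam) :
    ∃ g : P.cyclic ha k ⟶ D.standard lam, g.toLin (P.cyclicGen ha k) = D.standardGen lam (p 1) :=
  P.exists_cyclic_hom ha k (standardGen_mem (hlam.mem _)) fun i =>
    smul_standardGen_of_pos (hd i) ((le_sup_left : D.Apos ≤ D.Bpos) (P.φ_mem_subalgebra _))
      (P.degree_gen i) (hlam.mem _)

theorem T_map_eq_smul {W : Type*} [AddCommGroup W] [Module D.T W] (p : D.T →ₗ[D.T] W) (t : D.T) :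
    p t = t • p 1 := by
  rw [← map_smul, smul_eq_mul, mul_one]

/-- A nonzero `v` makes `t ↦ t • v` a surjection from `T` to the simple module, which splits by
semisimplicity. The projection and its section induce the two morphisms. -/
theorem exists_retract_standard [IsSemisimpleRing D.T] (hd : ∀ i, 0 < d i)
    (hlam : lam.IsConcentratedIn k) [Simple lam] :
    ∃ (f : D.standard lam ⟶ P.cyclic ha k) (g : P.cyclic ha k ⟶ D.standard lam), f ≫ g = 𝟙 _ := by
  haveI := hlam.isSimpleModule
  obtain ⟨v, hv⟩ := @exists_ne lam (IsSimpleModule.nontrivial D.T lam) 0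
  obtain ⟨j, hj⟩ := IsSemisimpleModule.lifting_property (LinearMap.toSpanSingleton D.T lam v)
    (IsSimpleModule.toSpanSingleton_surjective D.T hv) LinearMap.id
  obtain ⟨f, hf⟩ := exists_hom_cyclic P ha hlam j
  obtain ⟨g, hg⟩ := exists_hom_standard P ha hd hlam (LinearMap.toSpanSingleton D.T lam v)
  refine ⟨f, g, standard_hom_ext fun w => ?_⟩
  change g.toLin (f.toLin _) = D.standardGen lam w
  rw [hf, map_smul, hg, smul_standardGen_T _ (hlam.mem _), ← T_map_eq_smul]
  exact congrArg (D.standardGen lam) (LinearMap.congr_fun hj w)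

/-- The cyclic module is a retract of a direct sum of standard modules of simple modules. -/
theorem exists_sum_standard [IsSemisimpleRing D.T] (hd : ∀ i, 0 < d i) (k : ℤ) :
    ∃ (r : ℕ) (lam : Fin r → D.TMod) (p : ∀ i, P.cyclic ha k ⟶ D.standard (lam i))
      (q : ∀ i, D.standard (lam i) ⟶ P.cyclic ha k),
      (∀ i, Simple (lam i) ∧ (lam i).IsConcentratedIn k) ∧ ∑ i, p i ≫ q i = 𝟙 _ := by
  classical
  obtain ⟨r, S, E, hS⟩ := IsSemisimpleModule.exists_linearEquiv_fin_dfinsupp D.T D.T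
  haveI : ∀ i, Module.Finite K (S i) := fun i =>
    inferInstanceAs (Module.Finite K ((S i).restrictScalars K))
  let pr : ∀ i, D.T →ₗ[D.T] S i := fun i => DFinsupp.lapply i ∘ₗ E.toLinearMap
  let inc : ∀ i, S i →ₗ[D.T] D.T := fun i => E.symm.toLinearMap ∘ₗ
    DFinsupp.lsingle (M := fun i => S i) i
  -- The unit of `T` decomposes along the simple summands. On the generator the sum of the
  -- composites is multiplication by this element.
  have hsum : ∑ i, inc i (pr i 1) = 1 := by
    have h1 : ∑ i, DFinsupp.single i (E 1 i) = E 1 := by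
      ext i
      simp [DFinsupp.single_apply]
    have h2 := congrArg E.symm h1
    rw [map_sum, E.symm_apply_apply] at h2
    exact h2
  have hlam := fun i => D.place_isConcentratedIn (S i) k
  choose q hq using fun i => exists_hom_cyclic P ha (hlam i) (inc i)
  choose p hp using fun i => exists_hom_standard P ha hd (hlam i) (pr i)
  refine ⟨r, fun i => D.place (S i) k, p, q, fun i => ⟨D.place_simple (S i) k, hlam i⟩, ?_⟩
  refine P.cyclic_hom_ext ha ?_
  rw [GrMod.sum_toLin_apply]
  have h1 : ∀ i, (p i ≫ q i).toLin (P.cyclicGen ha k) = (inc i (pr i 1) : A) • P.cyclicGen ha k := by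
    intro i
    change (q i).toLin ((p i).toLin _) = _
    rw [hp, hq]
    rfl
  simp only [h1]
  rw [← Finset.sum_smul, ← AddSubmonoidClass.coe_finsetSum, hsum]
  exact one_smul A _

/-- A nonzero module has a nonzero head. If all these `L(μ)` vanished, so would the standard
modules, and with them the cyclic module, whose generator is nonzero. -/
theorem exists_nontrivial_L [IsSemisimpleRing D.T] (P : CIPresentation 𝒜 D.Apos n d e)
    (hd : ∀ i, 0 < d i) (k : ℤ) :
    ∃ mu : D.TMod, Simple mu ∧ mu.IsConcentratedIn k ∧ Nontrivial (D.L mu) := by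
  obtain ⟨a, -, ha, -⟩ := P.exists_coefficients
  obtain ⟨r, lam, p, q, hlam, hsum⟩ := exists_sum_standard P ha hd k
  by_contra! h
  refine P.cyclicGen_ne_zero ha k (D.one_notMem_span P hd) ?_
  have h1 := congrArg (fun f => f.toLin (P.cyclicGen ha k)) hsum
  rw [GrMod.sum_toLin_apply] at h1
  refine h1.symm.trans (Finset.sum_eq_zero fun i _ => ?_)
  have h2 : Subsingleton (D.standard (lam i)) := by
    by_contra h3
    rw [not_subsingleton_iff_nontrivial] at h3
    exact not_subsingleton_iff_nontrivial.2 ((D.standard (lam i)).head_nontrivial)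
      (h (lam i) (hlam i).1 (hlam i).2)
  change (q i).toLin ((p i).toLin _) = 0
  rw [Subsingleton.elim ((p i).toLin (P.cyclicGen ha k)) 0, map_zero]

/-- Extension groups of the cyclic module and a rigid module. -/
theorem extNonzero_cyclic_iff (ha' : ∀ j, ∑ i, X i * a j i = P.f j)
    (ha0 : ∀ j i, constantCoeff (a j i) = 0) (hd : ∀ i, 0 < d i) {N : GrMod 𝒜}
    (hN : D.IsRigid N) (k : ℤ) (m : ℕ) : ExtNonzero (P.cyclic ha k) N m ↔
      ∃ g : GrMod.free 𝒜 (CIPresentation.freeDeg d e k m) ⟶ N, g ≠ 0 := by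
  obtain ⟨ι, Θ, h1, h2, h3⟩ := D.exists_presentation_right P
  exact GrMod.extNonzero_iff_of_projective_resolution N m
    (fun m => GrMod.free 𝒜 (CIPresentation.freeDeg d e k m)) (fun m => inferInstance)
    (P.freeDiff ha k) (P.freeDiff_exact ha ha' Θ h1 h2 h3 k)
    (P.freeDiff_comp ha ha0 (hN.X_smul_pos P hd) k) _ (P.cyclicπ ha k)
    (P.cyclicπ_surjective ha k) (P.cyclicπ_eq_zero_iff ha k)

end Standard
end TriangularDecomposition

/-! ## Costandard modules -/

namespace TriangularDecomposition

open MvPolynomial TateIndex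

variable {K : Type v} {A : Type u} [Field K] [Ring A] [Algebra K A] [Module.Finite K A]
  {𝒜 : ℤ → Submodule K A} [GradedAlgebra 𝒜] {D : TriangularDecomposition 𝒜}
  {n : ℕ} {d e d' e' : Fin n → ℤ}

/-- A semisimple module is a retract of the module of linear maps from `T` to it. -/
theorem exists_cofree_retraction [IsSemisimpleRing D.T] (lam : D.TMod) :
    ∃ r : CofreeModule K D.T Unit lam →ₗ[D.T] lam,
      ∀ (v : lam) (H : CofreeModule K D.T Unit lam), (∀ x, H.toLin x = x () • v) → r H = v := by
  let j : lam →ₗ[D.T] CofreeModule K D.T Unit lam :=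
    { toFun := fun v =>
        ((LinearMap.toSpanSingleton D.T lam v).restrictScalars K ∘ₗ LinearMap.proj () :
          (Unit → D.T) →ₗ[K] lam)
      map_add' := fun v w => LinearMap.ext fun x => smul_add _ _ _
      map_smul' := fun t v => LinearMap.ext fun x => (mul_smul (x ()) t v).symm }
  have hj : ∀ v x, (j v).toLin x = x () • v := fun v x => rfl
  -- Evaluation at `1` recovers `v`; semisimplicity then splits `j`.
  have hinj : Function.Injective j := fun v w h => by
    have h1 := congrArg (fun H : CofreeModule K D.T Unit lam => H.toLin fun _ => 1) h
    simpa only [hj, one_smul] using h1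
  obtain ⟨r, hr⟩ := IsSemisimpleModule.extension_property j hinj LinearMap.id
  refine ⟨r, fun v H hH => ?_⟩
  have : H = j v := CofreeModule.ext fun x => (hH x).trans (hj v x).symm
  rw [this]
  exact LinearMap.congr_fun hr v

variable (P : CIPresentation 𝒜 D.Aneg n d e) {a : Fin n → Fin n → MvPolynomial (Fin n) K}
  (ha : ∀ j i, IsWeightedHomogeneous d (a j i) (e j - d i)) (k : ℤ)

/-- The kernel of the first differential of the cofree resolution. -/
noncomputable def cocyclic (W : Type u) [AddCommGroup W] [Module K W] [Module.Finite K W] :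
    GrMod 𝒜 :=
  (GrMod.cofree 𝒜 (fun b : Basis n n 0 => ideg d e b.1) k W).sub _
    (GrMod.isGraded_ker (P.cofreeDiff ha k W 0))

/-- The last Tate differential has image the right ideal of the variables, so `cocyclic` consists of
the linear maps on `A` that vanish on that ideal. -/
theorem mem_cocyclic_iff {W : Type u} [AddCommGroup W] [Module K W] [Module.Finite K W]
    (H : CofreeModule K A (Basis n n 0) W) :
    H ∈ LinearMap.ker (P.cofreeDiff ha k W 0).toLin ↔
      ∀ i x, H.toLin (fun _ => P.φ (X i) * x) = 0 := by
  classical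
  have h1 : H ∈ LinearMap.ker (P.cofreeDiff ha k W 0).toLin ↔
      ∀ x, H.toLin (tateMap P.leftAct X a 0 x) = 0 := LinearMap.ext_iff
  have h2 : ∀ x, tateMap P.leftAct X a 0 x =
      ∑ i, fun _ => P.φ (X i) * x (Basis.ext n i) := by
    intro x
    ext b
    rw [b.eq_unit, tateMap_zero_apply, Finset.sum_apply]
    rfl
  rw [h1]
  constructor
  · intro h i x
    rw [← h (Pi.single (Basis.ext n i) x), h2]
    congr 1
    rw [Finset.sum_eq_single_of_mem i (Finset.mem_univ i), Pi.single_eq_same]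
    intro j _ hj
    have h3 : Basis.ext n j ≠ Basis.ext n i := fun h => hj (by
      have h4 := congrArg (fun b => b.1.1) h
      exact Finset.singleton_injective h4)
    ext b
    rw [Pi.single_eq_of_ne h3, mul_zero]
    rfl
  · intro h x
    rw [h2, map_sum]
    exact Finset.sum_eq_zero fun i _ => h i _

/-- `∇(λ)` embeds by forgetting `T`-linearity. Back from `cocyclic`, a map `H` is made `T`-linear as
`x ↦ r (t ↦ H (t x))`, where `r` retracts the linear maps `T → λ` onto `λ`; vanishing on the right
ideal of the variables extends to `B⁻` in negative degrees by `degree_neg_decomposition`. -/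
theorem exists_retract_costandard [IsSemisimpleRing D.T] (hd : ∀ i, d i < 0) {lam : D.TMod}
    (hlam : lam.IsConcentratedIn k) :
    ∃ (f : D.costandard lam ⟶ cocyclic P ha k lam) (g : cocyclic P ha k lam ⟶ D.costandard lam),
      f ≫ g = 𝟙 _ := by
  obtain ⟨r, hr⟩ := exists_cofree_retraction (D := D) lam
  have hX : ∀ i, P.φ (X i) ∈ D.Bneg := fun i =>
    (le_sup_left : D.Aneg ≤ D.Bneg) (P.φ_mem_subalgebra _)
  let f₀ : D.costandard lam ⟶ GrMod.cofree 𝒜 (fun b : Basis n n 0 => ideg d e b.1) k lam :=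
    { toLin :=
        { toFun := fun h : D.coind lam =>
            (h.1 ∘ₗ LinearMap.proj (Basis.unit n n) : (Basis n n 0 → A) →ₗ[K] lam)
          map_add' := fun _ _ => rfl
          map_smul' := fun _ _ => rfl }
      map_mem := fun i h hh j hj x hx => by
        have h1 : x (Basis.unit n n) ∈ 𝒜 (j - ideg d e (Basis.unit n n).1) := hx (Basis.unit n n)
        rw [ideg_unit, sub_zero] at h1
        exact hlam.eq_zero (hh j _ h1) hj }
  let f : D.costandard lam ⟶ cocyclic P ha k lam := GrMod.codRestrict f₀ _ _ fun h => by
    refine (mem_cocyclic_iff P ha k _).2 fun i x => ?_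
    exact h.2.2 (d i) _ (hd i) (hX i) (P.degree_gen i) x
  let ev : CofreeModule K A (Basis n n 0) lam → A → CofreeModule K D.T Unit lam := fun H x =>
    (H.toLin ∘ₗ LinearMap.pi (fun _ => LinearMap.mulRight K x ∘ₗ D.T.val.toLinearMap ∘ₗ
      LinearMap.proj ()) : (Unit → D.T) →ₗ[K] lam)
  have hev : ∀ H x t, (ev H x).toLin t = H.toLin fun _ => (t () : A) * x := fun _ _ _ => rfl
  have hker : ∀ H ∈ LinearMap.ker (P.cofreeDiff ha k lam 0).toLin, ∀ (i : ℤ) (b : A), i < 0 →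
      b ∈ D.Bneg → b ∈ 𝒜 i → ∀ x, CofreeModule.toLin H (fun _ => b * x) = 0 := by
    intro H hH i b hi hb hbi x
    obtain ⟨c, rfl⟩ := D.degree_neg_decomposition P hi hb hbi
    have h1 : (fun _ : Basis n n 0 => (∑ i, P.φ (X i) * c i) * x) =
        ∑ i, fun _ => P.φ (X i) * (c i * x) := by
      ext b
      rw [Finset.sum_apply, Finset.sum_mul]
      exact Finset.sum_congr rfl fun i _ => mul_assoc _ _ _
    rw [h1, map_sum]
    exact Finset.sum_eq_zero fun i _ => (mem_cocyclic_iff P ha k _).1 hH i _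
  let g₀ : CofreeModule K A (Basis n n 0) lam → (A →ₗ[K] lam) := fun H =>
    { toFun := fun x => r (ev H x)
      map_add' := fun x y => by
        rw [← map_add]
        congr 1
        ext t
        rw [CofreeModule.add_apply, hev, hev, hev, ← map_add]
        congr 1
        ext b
        exact mul_add _ _ _
      map_smul' := fun c x => by
        have h1 : ev H (c • x) = c • ev H x := CofreeModule.ext fun t => by
          change H.toLin (fun _ => (t () : A) * c • x) = c • H.toLin fun _ => (t () : A) * x
          rw [← map_smul]
          congr 1
          ext b
          exact mul_smul_comm _ _ _
        rw [h1]
        exact (r.restrictScalars K).map_smul c _ }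
  let g : cocyclic P ha k lam ⟶ D.costandard lam :=
    { toLin :=
        { toFun := fun H => (⟨g₀ H.1, by
            refine ⟨fun t x => ?_, fun i b hi hb hbi x => ?_⟩
            · refine Eq.trans (congrArg r ?_) (r.map_smul t (ev H.1 x))
              refine CofreeModule.ext fun s => ?_
              refine (hev _ _ _).trans (Eq.trans ?_ (CofreeModule.smul_apply t (ev H.1 x) s).symm)
              refine Eq.trans (congrArg (CofreeModule.toLin H.1) ?_) (hev _ _ _).symm
              exact funext fun _ => (mul_assoc _ _ _).symm
            · refine Eq.trans (congrArg r ?_) (map_zero r)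
              refine CofreeModule.ext fun s => ?_
              refine (hev _ _ _).trans (Eq.trans ?_ (CofreeModule.zero_apply s).symm)
              have h2 : (s () : A) * b ∈ 𝒜 i := by
                have := SetLike.mul_mem_graded (D.T_le (s ()).2) hbi
                rwa [zero_add] at this
              have h3 := hker H.1 H.2 i _ hi
                (mul_mem ((le_sup_right : D.T ≤ D.Bneg) (s ()).2) hb) h2 x
              simpa only [mul_assoc] using h3⟩ : D.coind lam)
          map_add' := fun H H' => Subtype.ext (LinearMap.ext fun x =>
            map_add r (ev H.1 x) (ev H'.1 x))
          map_smul' := fun s H => Subtype.ext (LinearMap.ext fun x => by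
            change r (ev (s • H).1 x) = r (ev H.1 (x * s))
            refine congrArg r (CofreeModule.ext fun t => ?_)
            refine (hev _ _ _).trans (Eq.trans ?_ (hev _ _ _).symm)
            refine (CofreeModule.smul_apply s H.1 _).trans (congrArg (CofreeModule.toLin H.1) ?_)
            exact funext fun _ => mul_assoc _ _ _) }
      map_mem := fun i H hH j x hx => by
        change r (ev H.1 x) ∈ lam.gr (i + j)
        by_cases hij : i + j = k
        · rw [hij]
          exact hlam.mem _
        · have h1 : ev H.1 x = 0 := by
            refine CofreeModule.ext fun t => (hev _ _ _).trans ?_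
            refine hH j hij _ fun b => ?_
            change (t () : A) * x ∈ 𝒜 (j - ideg d e b.1)
            rw [b.eq_unit, ideg_unit, sub_zero]
            have := SetLike.mul_mem_graded (D.T_le (t ()).2) hx
            rwa [zero_add] at this
          rw [h1, map_zero]
          exact Submodule.zero_mem _ }
  refine ⟨f, g, ?_⟩
  ext h
  refine Subtype.ext (LinearMap.ext fun x => ?_)
  -- For `T`-linear `h` the map `t ↦ h (t x)` is `t ↦ t • h x`, which `r` sends back to `h x`.
  refine hr (h.1 x) _ fun t => ?_
  exact h.2.1 (t ()) x

/-- Vanishing of extension groups of a rigid module by the kernel in the cofree resolution. -/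
theorem exists_of_extNonzero_cocyclic (ha' : ∀ j, ∑ i, X i * a j i = P.f j)
    (W : Type u) [AddCommGroup W] [Module K W] [Module.Finite K W] {N : GrMod 𝒜} {l : ℤ}
    (hN : N.IsConcentratedIn l) {m : ℕ} (h : ExtNonzero N (cocyclic P ha k W) m) :
    ∃ b : Basis n n m, l + ideg d e b.1 = k := by
  by_contra! hb
  obtain ⟨ι, Θ, h1, h2, h3⟩ := D.exists_presentation_left P
  refine GrMod.not_extNonzero_of_injective_resolution N m
    (fun m => GrMod.cofree 𝒜 (fun b : Basis n n m => ideg d e b.1) k W) (fun m => inferInstance)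
    (P.cofreeDiff ha k W) (P.cofreeDiff_exact ha ha' Θ h1 h2 h3 k W) _
    (GrMod.subι _ _ (GrMod.isGraded_ker (P.cofreeDiff ha k W 0))) Subtype.val_injective
    (fun x => ?_) (GrMod.cofree_hom_eq_zero hN hb) h
  exact ⟨fun hx => ⟨⟨x, hx⟩, rfl⟩, by rintro ⟨y, rfl⟩; exact y.2⟩

end TriangularDecomposition

/-! ### The parity criterion. -/

theorem mainTheorem10 {K : Type v} {A : Type u} [Field K] [Ring A] [Algebra K A]
    [Module.Finite K A] (𝒜 : ℤ → Submodule K A) [GradedAlgebra 𝒜]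
    (D : TriangularDecomposition 𝒜) [IsSemisimpleRing D.T]
    (n : ℕ) (d e : Fin n → ℤ) (hd : ∀ i, d i < 0)
    (Pneg : CIPresentation 𝒜 D.Aneg n d e)
    (Ppos : CIPresentation 𝒜 D.Apos n (fun i => -d i) (fun j => -e j))
    (hrigid : ∀ lam : D.TMod, Simple lam → D.IsRigid (D.L lam)) :
    D.KLProperty ↔ (∀ i, Odd (d i)) ∧ ∀ j, Even (e j) := by
  have hd' : ∀ i, 0 < -d i := fun i => by have := hd i; omega
  obtain ⟨a, ha', ha, ha0⟩ := Ppos.exists_coefficients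
  obtain ⟨c, hc', hc, -⟩ := Pneg.exists_coefficients
  constructor
  · intro hKL
    obtain ⟨mu, hmu, hmu0, hL⟩ :=
      TriangularDecomposition.exists_nontrivial_L Ppos hd' 0
    have hconc := (hrigid mu hmu).isConcentratedIn_L Pneg hd Ppos hd' hmu0
    -- The cyclic module is generated in degree minus the internal degree of `b`, so the free
    -- generator belonging to `b` falls in degree 0, where `L mu` lives. This makes `Ext^m` nonzero,
    -- hence nonzero for some standard summand, and the KL-property yields a congruence for every
    -- monomial `b`.
    have key : ∀ (m : ℕ) (b : TateIndex.Basis n n m),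
        (m : ℤ) ≡ -TateIndex.ideg (fun i => -d i) (fun j => -e j) b.1 [ZMOD 2] := by
      intro m b
      obtain ⟨r, lam, p, q, hlam, hsum⟩ := TriangularDecomposition.exists_sum_standard Ppos ha hd'
        (-TateIndex.ideg (fun i => -d i) (fun j => -e j) b.1)
      have h1 := (TriangularDecomposition.extNonzero_cyclic_iff Ppos ha ha' ha0 hd' (hrigid mu hmu)
        (-TateIndex.ideg (fun i => -d i) (fun j => -e j) b.1) m).2
        ((GrMod.exists_free_hom_ne_zero_iff hconc).2 ⟨b, add_neg_cancel _⟩)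
      obtain ⟨i, hi⟩ := exists_extNonzero_of_sum p q hsum h1
      have h2 := (hKL (lam i) mu _ 0 (hlam i).1 hmu (hlam i).2 hmu0 m).1 hi
      rwa [sub_zero] at h2
    constructor
    · intro i
      -- The congruences for the exterior variables (`m = 1`) and for the divided power variables
      -- (`m = 2`) are the two parity conditions.
      have h1 := key 1 (TateIndex.Basis.ext n i)
      rw [TateIndex.ideg_ext, neg_neg] at h1
      exact Int.odd_iff.2 h1.symm
    · intro j
      have h1 := key 2 (TateIndex.Basis.div n j)
      rw [TateIndex.ideg_div, neg_neg] at h1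
      exact Int.even_iff.2 h1.symm
  · rintro ⟨hodd, heven⟩ lam mu k l hlam hmu hk hl m
    have hconc := (hrigid mu hmu).isConcentratedIn_L Pneg hd Ppos hd' hl
    constructor
    · intro h
      obtain ⟨f, g, hfg⟩ := TriangularDecomposition.exists_retract_standard Ppos ha hd' hk
      obtain ⟨z, hz⟩ := (TriangularDecomposition.extNonzero_cyclic_iff Ppos ha ha' ha0 hd'
        (hrigid mu hmu) k m).1 (h.of_retract_left f g hfg)
      have hnt : Nontrivial (D.L mu) := by
        by_contra h0
        rw [not_nontrivial_iff_subsingleton] at h0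
        refine hz ?_
        ext x
        exact Subsingleton.elim _ _
      obtain ⟨b, hb⟩ := (GrMod.exists_free_hom_ne_zero_iff hconc).1 ⟨z, hz⟩
      have h1 := TateIndex.hdeg_modEq_ideg (fun i => -d i) (fun j => -e j)
        (fun i => (hodd i).neg) (fun j => (heven j).neg) b.1
      rw [b.2] at h1
      change TateIndex.ideg _ _ b.1 + k = l at hb
      rw [Int.ModEq] at h1 ⊢
      omega
    · intro h
      -- A nonzero class requires a monomial of homological degree `m` and internal degree `k - l`,
      -- now computed with the degrees `d` and `e` themselves.
      obtain ⟨f, g, hfg⟩ := TriangularDecomposition.exists_retract_costandard Pneg hc k hd hk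
      obtain ⟨b, hb⟩ := TriangularDecomposition.exists_of_extNonzero_cocyclic Pneg hc k hc' lam hconc
        (h.of_retract_right f g hfg)
      have h1 := TateIndex.hdeg_modEq_ideg d e hodd heven b.1
      rw [b.2] at h1
      rw [Int.ModEq] at h1 ⊢
      omega
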